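/- **Setting.** All manifolds, maps and curves are complex analytic. For a manifold $Z$ with a distribution $D$, its prolongation is $(\mathbb P D, D^1)$, where $\mathbb P D=\{(z,\ell): \ell\subset D(z)\text{ a line}\}$ and $D^1(z,\ell)=d\pi^{-1}(\ell)$ for the projection $\pi(z,\ell)=z$. Starting from $\mathcal P^0(n)=\mathbb C^n$, $\Delta_0=T\mathbb C^n$, iteration gives the Monster tower $(\mathcal P^k(n),\Delta_k)$. Local analytic diffeomorphisms $\phi$ of $\mathbb C^n$ and non-constant curve germs $\gamma$ in $\mathbb C^n$ at $t=0$ have prolongations $\phi^k$, $\gamma^k$ to level $k$ (at an isolated point where the velocity vanishes, the prolonged curve is defined by its limit). Points $p,q\in\mathcal P^k(n)$ are equivalent if $\phi^k(p)=q$ for some local diffeomorphism $\phi$; the equivalence classes are called orbits. Two curve germs (or jets) are RL-equivalent if they differ by a local diffeomorphism of $\mathbb C^n$ and a reparametrization germ of $(\mathbb C,0)$. The critical hyperplanes through $p\in\mathcal P^k(n)$ are the hyperplanes $\Delta_k(p)\cap T_p\mathcal P^{j}(F)\subset\Delta_k(p)$, where $F$ is a fiber of $\mathcal P^i(n)\to\mathcal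 P^{i-1}(n)$, $i\ge1$, $i+j=k$, and $\mathcal P^j(F)\subset\mathcal P^{i+j}(n)$ is its $j$-fold prolongation, assumed to pass through $p$; for $j=0$ this is the vertical hyperplane. A direction is critical if it lies in a critical hyperplane, and regular otherwise. A point $(p,\ell)$ gets the letter V if $\ell$ is vertical, T if $\ell$ is critical but not vertical, R if $\ell$ is regular; the code of a point at level $k$ lists the letters of its projections to levels $1,\dots,k$. RVT is the set of points with code RVT, and RVL is the set of those points $(p,\ell)$ with code RVV for which $\ell$ also lies in a critical hyperplane different from the vertical one. $Germ(p)$ is the set of curve germs $\gamma$ with $\gamma^k(0)=p$ such that $\gamma^k$ is immersed at $0$ and tangent there to a regular direction; $\gamma$ is then said to realize $p$. The embedding dimension of a curve germ is the least dimension of a smooth submanifold of $\mathbb C^n$ containing it. A point $p$ is spatial if every curve in $Germ(p)$ has embedding dimension at least $3$ and some curve in $Germ(p)$ has embedding dimension $3$. **Proposition.** Let $n=3$. There are no spatial points at levels $0,1,2$. The set of spatial points of $\mathcal P^3(3)$ is the disjoint union of exactly two orbits, $O$ and RVL. 1. $O$ is a relatively open subset of RVT. Both RVT and $O$ are (locally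 closed, smooth) submanifolds of $\mathcal P^3(3)$ of codimension $2$. Every curve germ with $5$-jet $(t^3,t^4,t^5)$ realizes a point of $O$, and a curve germ realizes a point of $O$ if and only if its $5$-jet is RL-equivalent to $(t^3,t^4,t^5)$. 2. RVL is a (locally closed, smooth) submanifold of $\mathcal P^3(3)$ of codimension $3$. A curve germ realizes a point of RVL if and only if its $7$-jet is RL-equivalent to $(t^4,t^6,t^7)$. -/

import Mathlib

open Filter Topology
open scoped LinearAlgebra.Projectivization

noncomputable section

namespace MonsterTower

/-! ## Charts of the tower

Everything is done for curves in `ℂ^n` with `n = m + 1`.  The tower is built by iterating the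
rank one prolongation `(Z, D) ↦ (ℙ D, D¹)`.  All levels carry the Kumpera-Ruiz charts: a chart at
level `k` is a word of length `k` in the letters `0, …, n - 1`, and its image is all of
`ℂ^n × (ℂ^(n-1))^k`. -/

/-- The space `ℂ^n × (ℂ^(n-1))^k` of coordinate values of a chart at level `k` (`n = m + 1`). -/
def Coord (m : ℕ) : ℕ → Type
  | 0 => Fin (m + 1) → ℂ
  | k + 1 => Coord m k × (Fin m → ℂ)

instance instNormedAddCommGroupCoord (m : ℕ) : ∀ k, NormedAddCommGroup (Coord m k)
  | 0 => inferInstanceAs (NormedAddCommGroup (Fin (m + 1) → ℂ))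
  | k + 1 =>
    haveI := instNormedAddCommGroupCoord m k
    inferInstanceAs (NormedAddCommGroup (Coord m k × (Fin m → ℂ)))

instance instNormedSpaceCoord (m : ℕ) : ∀ k, NormedSpace ℂ (Coord m k)
  | 0 => inferInstanceAs (NormedSpace ℂ (Fin (m + 1) → ℂ))
  | k + 1 =>
    haveI := instNormedSpaceCoord m k
    inferInstanceAs (NormedSpace ℂ (Coord m k × (Fin m → ℂ)))

/-- Names of the Kumpera-Ruiz charts at level `k`: words of length `k` in `n` letters. -/
def ChartIndex (m : ℕ) : ℕ → Type
  | 0 => Unit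
  | k + 1 => ChartIndex m k × Fin (m + 1)

/-- The coframe `(θ_0, …, θ_(n-1))` of the distribution in a chart; each `θ_i` is the differential
of a coordinate.  At level `0` it is `(dx_0, …, dx_(n-1))`.  In the chart `(w, i)`, whose new
coordinates are the ratios `θ_j / θ_i` (`j ≠ i`), the `i`-th form is kept and every other form is
replaced by the differential of the corresponding new coordinate. -/
def coframe (m : ℕ) : ∀ k, ChartIndex m k → Coord m k → Fin (m + 1) → ℂ
  | 0, _, v => v
  | k + 1, (w, i), (v, u) => i.insertNth (coframe m k w v i) u

/-- The data of a complex manifold with a distribution, given by charts.  This only carries the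
recursion that builds the tower.  As for manifolds in Mathlib, the tangent space at `p` is the
model space, a vector being written in the preferred chart `idx p` around `p`. -/
structure Stage (m k : ℕ) where
  /-- the points -/
  Pt : Type
  /-- the domain of each chart -/
  src : ChartIndex m k → Set Pt
  /-- the coordinates of each chart -/
  coord : ChartIndex m k → Pt → Coord m k
  /-- the preferred chart around a point -/
  idx : Pt → ChartIndex m k
  /-- the distribution -/
  distr : Pt → Submodule ℂ (Coord m k)

namespace Stage

variable {m k : ℕ} (S : Stage m k)

/-- The manifold topology: the topology generated by the chart neighbourhoods. -/
instance : TopologicalSpace S.Pt :=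
  TopologicalSpace.generateFrom
    {U | ∃ (w : ChartIndex m k) (O : Set (Coord m k)), IsOpen O ∧ U = S.src w ∩ S.coord w ⁻¹' O}

/-- The expression of a map `Φ` in the charts `w` (source) and `w'` (target), that is
`coord w' ∘ Φ ∘ (coord w)⁻¹`. -/
def localRep (Φ : S.Pt → S.Pt) (w w' : ChartIndex m k) : Coord m k → Coord m k :=
  Function.extend (fun q : S.src w => S.coord w q) (fun q => S.coord w' (Φ q)) 0

/-- The differential `dΦ_p : T_p → T_(Φ p)`. -/
def tangentMap (Φ : S.Pt → S.Pt) (p : S.Pt) : Coord m k →L[ℂ] Coord m k :=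
  fderiv ℂ (S.localRep Φ (S.idx p) (S.idx (Φ p))) (S.coord (S.idx p) p)

/-- The components in the chart `w` of a tangent vector at `p`. -/
def inChart (p : S.Pt) (w : ChartIndex m k) (v : Coord m k) : Coord m k :=
  fderiv ℂ (S.localRep id (S.idx p) w) (S.coord (S.idx p) p) v

/-- The velocity `dc/dt (t)` of a curve, a tangent vector at `c t`. -/
def velocity (c : ℂ → S.Pt) (t : ℂ) : Coord m k :=
  deriv (fun s => S.coord (S.idx (c t)) (c s)) t

/-- Velocities at `p` of analytic curve germs through `p` that lie in `N`; for a submanifold `N`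
this is the tangent space `T_p N`. -/
def tangentsTo (N : Set S.Pt) (p : S.Pt) : Set (Coord m k) :=
  {v | ∃ c : ℂ → S.Pt, c 0 = p ∧ (∀ᶠ t in 𝓝 0, c t ∈ N ∧ c t ∈ S.src (S.idx p)) ∧
    AnalyticAt ℂ (fun t => S.coord (S.idx p) (c t)) 0 ∧ S.velocity c 0 = v}

/-- The rank one prolongation `(ℙ D, D¹)` of `(Z, D)`.  Its points are the pairs `(p, ℓ)` with `ℓ`
a line in `D p`, and `D¹ (p, ℓ) = dπ⁻¹ (ℓ)` for the projection `π (p, ℓ) = p`.  The preferred chart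
around `(p, ℓ)` extends the preferred chart around `p`, so that `dπ` is the first projection. -/
def prolong : Stage m (k + 1) where
  Pt := Σ p : S.Pt, ℙ ℂ (S.distr p)
  src := fun w => {P | P.1 ∈ S.src w.1 ∧ coframe m k w.1 (S.inChart P.1 w.1 P.2.rep) w.2 ≠ 0}
  coord := fun w P => (S.coord w.1 P.1, fun j =>
    coframe m k w.1 (S.inChart P.1 w.1 P.2.rep) (w.2.succAbove j) /
      coframe m k w.1 (S.inChart P.1 w.1 P.2.rep) w.2)
  idx := fun P => (S.idx P.1,
    Classical.epsilon fun i => coframe m k (S.idx P.1) P.2.rep i ≠ 0)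
  distr := fun P =>
    (P.2.submodule.map (S.distr P.1).subtype).comap (LinearMap.fst ℂ (Coord m k) (Fin m → ℂ))

variable {S}

/-- The line `ℓ ⊆ D p ⊆ T_p` of a point `P = (p, ℓ)` of the prolongation. -/
def line (P : S.prolong.Pt) : Submodule ℂ (Coord m k) :=
  P.2.submodule.map (S.distr P.1).subtype

open Classical in
/-- The prolongation `Φ¹ (p, ℓ) = (Φ p, dΦ_p ℓ)` of a symmetry `Φ`.  (Where `dΦ_p ℓ` is not a line
of the distribution, which does not happen near the points of interest, the value is irrelevant.) -/
def prolongMap (Φ : S.Pt → S.Pt) (P : S.prolong.Pt) : S.prolong.Pt :=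
  if h : ∃ ℓ' : ℙ ℂ (S.distr (Φ P.1)), ℓ'.submodule.map (S.distr (Φ P.1)).subtype =
      (line P).map (S.tangentMap Φ P.1 : Coord m k →ₗ[ℂ] Coord m k)
  then ⟨Φ P.1, h.choose⟩ else P

/-- As germs at `t = 0`, the curve `c'` is the prolongation of `c`: it lies over `c`, it is
`(c t, span (dc/dt))` at the regular points `t ≠ 0`, and its value at `0` is the limit. -/
def IsProlongationOf (c : ℂ → S.Pt) (c' : ℂ → S.prolong.Pt) : Prop :=
  (∀ᶠ t in 𝓝 0, (c' t).1 = c t) ∧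
  (∀ᶠ t in 𝓝[≠] 0, line (c' t) = Submodule.span ℂ {S.velocity c t}) ∧
  Tendsto c' (𝓝[≠] 0) (𝓝 (c' 0))

/-- The prolongation of an integral submanifold `N`: the lines tangent to `N` and contained in the
distribution. -/
def prolongSet (N : Set S.Pt) : Set S.prolong.Pt :=
  {P | P.1 ∈ N ∧ (line P : Set (Coord m k)) ⊆ S.tangentsTo N P.1}

end Stage

/-- The tower `(𝒫^k(n), Δ_k)` over `ℂ^n`, `n = m + 1`. -/
def tower (m : ℕ) : ∀ k, Stage m k
  | 0 =>
    { Pt := Fin (m + 1) → ℂ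
      src := fun _ => Set.univ
      coord := fun _ x => x
      idx := fun _ => ()
      distr := fun _ => ⊤ }
  | k + 1 => (tower m k).prolong

/-- The points of `𝒫^k(n)`, `n = m + 1`. -/
abbrev Point (m k : ℕ) : Type := (tower m k).Pt

variable {m k : ℕ}

/-- The one step projection `π_(k+1,k)`. -/
def proj (P : Point m (k + 1)) : Point m k := Sigma.fst P

/-- The line in `Δ_k` at `proj P` that the point `P` is. -/
def lineOf (P : Point m (k + 1)) : Submodule ℂ (Coord m k) := Stage.line (S := tower m k) P

/-- The projection `π_(k,0)` to `ℂ^n`. -/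
def base : ∀ {k : ℕ}, Point m k → (Fin (m + 1) → ℂ)
  | 0, p => p
  | _ + 1, P => base (proj P)

/-! ## Critical hyperplanes and RVT codes -/

/-- The vertical space `V_k (p) = ker dπ_(k,k-1)` for `k ≥ 1`; there is none (`0`) at level `0`. -/
def verticalSpace : ∀ {k : ℕ}, Point m k → Submodule ℂ (Coord m k)
  | 0, _ => ⊥
  | k + 1, _ => LinearMap.ker (LinearMap.fst ℂ (Coord m k) (Fin m → ℂ))

/-- The submanifolds `𝒫^j (F) ⊆ 𝒫^(i+j)(n)` (`i ≥ 1`, `j ≥ 0`), where `F` is a fibre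
of `𝒫^i(n) → 𝒫^(i-1)(n)`. -/
inductive IsBabyMonster : ∀ {k : ℕ}, Set (Point m k) → Prop
  | fiber {k : ℕ} (q : Point m k) : IsBabyMonster (k := k + 1) {P | proj P = q}
  | prolong {k : ℕ} (N : Set (Point m k)) :
      IsBabyMonster N → IsBabyMonster (k := k + 1) (Stage.prolongSet (S := tower m k) N)

/-- The critical hyperplanes through `p`: the spaces `δ_i^j (p) = Δ_k (p) ∩ T_p (𝒫^j (F))`
for those `𝒫^j (F)`, `F` a fibre at level `i ≥ 1`, `i + j = k`, that pass through `p`. -/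
def criticalHyperplanes (p : Point m k) : Set (Set (Coord m k)) :=
  {H | ∃ N : Set (Point m k), IsBabyMonster N ∧ p ∈ N ∧
    H = ((tower m k).distr p : Set (Coord m k)) ∩ (tower m k).tangentsTo N p}

/-- A direction at `p` is critical if it lies in a critical hyperplane; otherwise regular. -/
def IsCriticalDirection (p : Point m k) (ℓ : Submodule ℂ (Coord m k)) : Prop :=
  ∃ H ∈ criticalHyperplanes p, (ℓ : Set (Coord m k)) ⊆ H

/-- A point `(p, ℓ)` is vertical if `ℓ` is a vertical line at `p`. -/
def IsVertical (P : Point m (k + 1)) : Prop := lineOf P ≤ verticalSpace (proj P)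

/-- A point `(p, ℓ)` is critical if `ℓ` is a critical direction at `p`. -/
def IsCritical (P : Point m (k + 1)) : Prop := IsCriticalDirection (proj P) (lineOf P)

/-- An `L` point is a point `(p, ℓ)` with `ℓ` in the intersection of the vertical hyperplane at `p`
and another critical hyperplane at `p`. -/
def IsL (P : Point m (k + 1)) : Prop :=
  IsVertical P ∧ ∃ H ∈ criticalHyperplanes (proj P),
    H ≠ (verticalSpace (proj P) : Set (Coord m k)) ∧ (lineOf P : Set (Coord m k)) ⊆ H

/-- Letters of the code: regular, vertical, tangency. -/
inductive Letter
  | R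
  | V
  | T

open Classical in
/-- The last letter of the code of a point: `V` if it is vertical, `T` if it is critical but not
vertical, `R` if it is regular. -/
def lastLetter (P : Point m (k + 1)) : Letter :=
  if IsVertical P then Letter.V else if IsCritical P then Letter.T else Letter.R

/-- The RVT code of a point at level `k`, a word of length `k`. -/
def code : ∀ {k : ℕ}, Point m k → List Letter
  | 0, _ => []
  | _ + 1, P => code (proj P) ++ [lastLetter P]

/-- The class `RVT` at level three. -/
def RVT (m : ℕ) : Set (Point m 3) := {p | code p = [Letter.R, Letter.V, Letter.T]}

/-- The class `RVL` at level three: the `L` points of `RVV`. -/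
def RVL (m : ℕ) : Set (Point m 3) := {p | code p = [Letter.R, Letter.V, Letter.V] ∧ IsL p}

/-! ## Equivalence of points -/

/-- Analytic diffeomorphisms between open subsets of `ℂ^n`. -/
def IsAnalyticDiffeo (φ : OpenPartialHomeomorph (Fin (m + 1) → ℂ) (Fin (m + 1) → ℂ)) : Prop :=
  AnalyticOnNhd ℂ φ φ.source ∧ AnalyticOnNhd ℂ φ.symm φ.target

/-- The `k`-th prolongation `φ^k` of a map of `ℂ^n`. -/
def prolongation (φ : (Fin (m + 1) → ℂ) → (Fin (m + 1) → ℂ)) : ∀ k, Point m k → Point m k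
  | 0 => φ
  | k + 1 => Stage.prolongMap (S := tower m k) (prolongation φ k)

/-- `p ∼ q`: some local analytic diffeomorphism `φ` of `ℂ^n` has `φ^k (p) = q`. -/
def PointEquiv (p q : Point m k) : Prop :=
  ∃ φ : OpenPartialHomeomorph (Fin (m + 1) → ℂ) (Fin (m + 1) → ℂ),
    IsAnalyticDiffeo φ ∧ base p ∈ φ.source ∧ prolongation φ k p = q

/-- A set of points that is a single equivalence class. -/
def IsOrbit (O : Set (Point m k)) : Prop := ∃ p, O = {q | PointEquiv p q}

/-! ## Submanifolds and codimension -/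

/-- Near its point `x`, the set `N` is a complex submanifold of codimension `c`: it is the zero set
of `c` analytic functions with linearly independent differentials. -/
def HasCodimAt {E : Type*} [NormedAddCommGroup E] [NormedSpace ℂ E] (N : Set E) (x : E) (c : ℕ) :
    Prop :=
  ∃ F : E → (Fin c → ℂ), AnalyticAt ℂ F x ∧ Function.Surjective (fderiv ℂ F x) ∧
    ∀ᶠ y in 𝓝 x, (y ∈ N ↔ F y = 0)

/-- A set of points of `𝒫^k(n)` is a (locally closed) complex submanifold of codimension `c`. -/
def HasCodim (N : Set (Point m k)) (c : ℕ) : Prop :=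
  ∀ p ∈ N, HasCodimAt
    ((tower m k).coord ((tower m k).idx p) '' (N ∩ (tower m k).src ((tower m k).idx p)))
    ((tower m k).coord ((tower m k).idx p) p) c

/-! ## Curve germs -/

/-- The embedding dimension of a curve germ at `t = 0`: the smallest `d` such that the germ lies in
a complex submanifold of dimension `d` of `ℂ^n`. -/
def embDim (γ : ℂ → (Fin (m + 1) → ℂ)) : ℕ :=
  sInf {d | ∃ (N : Set (Fin (m + 1) → ℂ)) (c : ℕ), c + d = m + 1 ∧
    (∀ x ∈ N, HasCodimAt N x c) ∧ ∀ᶠ t in 𝓝 0, γ t ∈ N}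

/-- The set `GermAt p` of the analytic curve germs `γ` at `t = 0` in `ℂ^n` with `γ^k (0) = p` and
`γ^k` immersed at `0` in a regular direction.  Here `c j` is the prolongation `γ^j`. -/
def GermAt (p : Point m k) : Set (ℂ → (Fin (m + 1) → ℂ)) :=
  {γ | AnalyticAt ℂ γ 0 ∧ ∃ c : ∀ j, ℂ → Point m j, c 0 = γ ∧
    (∀ j < k, Stage.IsProlongationOf (S := tower m j) (c j) (c (j + 1))) ∧
    c k 0 = p ∧ (tower m k).velocity (c k) 0 ≠ 0 ∧
    ¬ IsCriticalDirection p (Submodule.span ℂ {(tower m k).velocity (c k) 0})}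

/-- Every curve in `GermAt p` has embedding dimension at least `3`, and one has exactly `3`. -/
def IsSpatial (p : Point m k) : Prop :=
  (∀ γ ∈ GermAt p, 3 ≤ embDim γ) ∧ ∃ γ ∈ GermAt p, embDim γ = 3

/-- RL equivalence of curve germs at `t = 0`. -/
def RLEquiv (γ σ : ℂ → (Fin (m + 1) → ℂ)) : Prop :=
  ∃ (φ : OpenPartialHomeomorph (Fin (m + 1) → ℂ) (Fin (m + 1) → ℂ)) (τ : ℂ → ℂ),
    IsAnalyticDiffeo φ ∧ γ 0 ∈ φ.source ∧
    AnalyticAt ℂ τ 0 ∧ τ 0 = 0 ∧ deriv τ 0 ≠ 0 ∧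
    ∀ᶠ t in 𝓝 0, σ (τ t) = φ (γ t)

/-- Two curve germs at `t = 0` have the same `N`-jet. -/
def SameJet (N : ℕ) (γ σ : ℂ → (Fin (m + 1) → ℂ)) : Prop :=
  ∀ i ≤ N, iteratedDeriv i γ 0 = iteratedDeriv i σ 0

/-- The `N`-jets at `t = 0` of two curve germs are RL equivalent. -/
def JetEquiv (N : ℕ) (γ σ : ℂ → (Fin (m + 1) → ℂ)) : Prop :=
  ∃ σ' : ℂ → (Fin (m + 1) → ℂ), RLEquiv σ σ' ∧ SameJet N γ σ'

end MonsterTower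

end

open MonsterTower

noncomputable section

namespace MonsterTower

section

/-! ## The distribution in a chart -/

/-! In a Kumpera-Ruiz chart the distribution is spanned by an explicit frame, and a prolonged curve
is a system of scalar equations: every new coordinate is a ratio of derivatives of two old ones. A
map between charts that respects the distributions prolongs to another such map. This one fact
(`SymAt.prolong`) yields the analytic atlas on every level (`tower_charted`) and the functoriality
of prolongation under diffeomorphisms of the base (`PassesThrough.map`). In a chart each `𝒫^j (F)`
is an affine subspace that meets the distribution in a hyperplane `θ_a = 0`
(`mem_criticalHyperplanes`), so the letters of a code are vanishing conditions on coordinates.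

At level three let `u`, `v`, `w` be the successive ratio vectors of a curve and `U`, `V`, `W` their
values at `t = 0`. Up to a permutation of the axes a point is in one of five positions
(`exists_coordsIn`): RRR, RRV, RV followed by R or T, RVV without L, RVL. Integrating simple
polynomial choices of `w` produces a germ realizing the point. In all positions but two its third
component is a polynomial in the first two, so the germ is planar. The exceptions are RVT with `W 2
≠ 0`, which is the orbit `O`, and RVL.

In these two cases the regularity of the direction dictates orders of vanishing: after a triangular
linear change, the components of every realizing germ have exact orders `q + 3`, `2 q + 4`, `2 q +
5`, with `q = 0` for `O` and `q = 1` for RVL (`exists_tForm_of_ratioOf`). Conversely every germ with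
such orders realizes a point of the corresponding kind (`JType.exists_mem_realized`). The decisive
numerical fact is that `2 (q + 3) = 2 q + 6` exceeds all three orders: along such a germ the
nonlinear part of any analytic map vanishes to order `2 q + 6` (`Rem.taylor`). Hence the type `JType
q` is invariant under diffeomorphisms and reparametrizations and depends only on the `(2 q +
5)`-jet. A nonzero linear form cannot vanish to order `2 q + 6` on the germ, so no smooth surface
contains it (`JType.three_le_embDim`). The jet is brought to monomial form by affine maps alone when
`q = 0`; when `q = 1` one quadratic reparametrization is needed to remove the term `t ^ 5`.

Since a germ determines the point it passes through, transporting germs transports points. Every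
germ of type `q` is an affine image of one with normalized leading terms, and all the latter at the
origin realize one common point; so the points of type `q` form one orbit (`isOrbit_realized`).
Below level three, a point has regular points above it; these are not spatial, and a germ realizing
a regular point also realizes its projection (`mem_germAt_proj`). The submanifold statements hold
because the sets are given in charts by vanishing coordinates and open conditions. -/

instance instFiniteDimensionalCoord (m : ℕ) : ∀ k, FiniteDimensional ℂ (Coord m k)
  | 0 => inferInstanceAs (FiniteDimensional ℂ (Fin (m + 1) → ℂ))
  | k + 1 =>
    haveI := instFiniteDimensionalCoord m k
    inferInstanceAs (FiniteDimensional ℂ (Coord m k × (Fin m → ℂ)))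

instance instCompleteSpaceCoord (m k : ℕ) : CompleteSpace (Coord m k) :=
  FiniteDimensional.complete ℂ _

/-- The vector with `i`-th component `1` and the other components given by `u`. -/
def unitAt {m : ℕ} (i : Fin (m + 1)) (u : Fin m → ℂ) : Fin (m + 1) → ℂ :=
  i.insertNth (α := fun _ => ℂ) (1 : ℂ) u

@[simp] theorem unitAt_self {m : ℕ} (i : Fin (m + 1)) (u : Fin m → ℂ) : unitAt i u i = 1 := by
  simp [unitAt]

@[simp] theorem unitAt_succAbove {m : ℕ} (i : Fin (m + 1)) (u : Fin m → ℂ) (j : Fin m) :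
    unitAt i u (i.succAbove j) = u j := by
  simp [unitAt]

theorem unitAt_ne_zero {m : ℕ} (i : Fin (m + 1)) (u : Fin m → ℂ) : unitAt i u ≠ 0 := by
  intro h
  have := congrFun h i
  simp at this

/-- The ratios of the components of a vector to its `i`-th one. -/
def ratio {m : ℕ} (i : Fin (m + 1)) (θ : Fin (m + 1) → ℂ) : Fin m → ℂ :=
  fun j => θ (i.succAbove j) / θ i

theorem smul_unitAt_ratio {m : ℕ} {i : Fin (m + 1)} {θ : Fin (m + 1) → ℂ} (h : θ i ≠ 0) :
    θ i • unitAt i (ratio i θ) = θ := by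
  funext a
  rcases Fin.eq_self_or_eq_succAbove i a with rfl | ⟨j, rfl⟩
  · simp
  · simp [ratio, mul_div_cancel₀ _ h]

theorem ratio_unitAt {m : ℕ} (i : Fin (m + 1)) (u : Fin m → ℂ) : ratio i (unitAt i u) = u := by
  funext j
  simp [ratio]

theorem ratio_smul {m : ℕ} (i : Fin (m + 1)) {c : ℂ} (hc : c ≠ 0) (θ : Fin (m + 1) → ℂ) :
    ratio i (c • θ) = ratio i θ := by
  funext j
  simp [ratio, mul_div_mul_left _ _ hc]

theorem analyticAt_unitAt {m : ℕ} (i : Fin (m + 1)) (u : Fin m → ℂ) :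
    AnalyticAt ℂ (unitAt i) u := by
  rw [analyticAt_pi_iff]
  intro a
  rcases Fin.eq_self_or_eq_succAbove i a with rfl | ⟨j, rfl⟩
  · simp only [unitAt_self]
    exact analyticAt_const
  · simp only [unitAt_succAbove]
    exact (ContinuousLinearMap.proj (R := ℂ) (φ := fun _ : Fin m => ℂ) j).analyticAt u

theorem analyticAt_ratio {m : ℕ} {i : Fin (m + 1)} {θ : Fin (m + 1) → ℂ} (h : θ i ≠ 0) :
    AnalyticAt ℂ (ratio i) θ := by
  have hp : ∀ a, AnalyticAt ℂ (fun θ : Fin (m + 1) → ℂ => θ a) θ := fun a =>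
    (ContinuousLinearMap.proj (R := ℂ) (φ := fun _ : Fin (m + 1) => ℂ) a).analyticAt θ
  rw [analyticAt_pi_iff]
  intro j
  exact (hp _).div (hp _) h

theorem coframe_succ_self {m k : ℕ} (w : ChartIndex m k) (i : Fin (m + 1)) (v : Coord m k)
    (u : Fin m → ℂ) : coframe m (k + 1) (w, i) (v, u) i = coframe m k w v i := by
  simp [coframe]

theorem coframe_succ_succAbove {m k : ℕ} (w : ChartIndex m k) (i : Fin (m + 1)) (v : Coord m k)
    (u : Fin m → ℂ) (j : Fin m) :
    coframe m (k + 1) (w, i) (v, u) (i.succAbove j) = u j := by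
  simp [coframe]

theorem coframe_smul {m : ℕ} : ∀ {k : ℕ} (w : ChartIndex m k) (c : ℂ) (v : Coord m k),
    coframe m k w (c • v) = c • coframe m k w v
  | 0, _, _, _ => rfl
  | k + 1, (w, i), c, (v, u) => by
    funext a
    change coframe m (k + 1) (w, i) (c • v, c • u) a = c * coframe m (k + 1) (w, i) (v, u) a
    rcases Fin.eq_self_or_eq_succAbove i a with rfl | ⟨j, rfl⟩
    · rw [coframe_succ_self, coframe_succ_self, coframe_smul w, Pi.smul_apply, smul_eq_mul]
    · rw [coframe_succ_succAbove, coframe_succ_succAbove, Pi.smul_apply, smul_eq_mul]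

theorem coframe_add {m : ℕ} : ∀ {k : ℕ} (w : ChartIndex m k) (v v' : Coord m k),
    coframe m k w (v + v') = coframe m k w v + coframe m k w v'
  | 0, _, _, _ => rfl
  | k + 1, (w, i), (v, u), (v', u') => by
    funext a
    change coframe m (k + 1) (w, i) (v + v', u + u') a =
      coframe m (k + 1) (w, i) (v, u) a + coframe m (k + 1) (w, i) (v', u') a
    rcases Fin.eq_self_or_eq_succAbove i a with rfl | ⟨j, rfl⟩
    · rw [coframe_succ_self, coframe_succ_self, coframe_succ_self, coframe_add w, Pi.add_apply]
    · rw [coframe_succ_succAbove, coframe_succ_succAbove, coframe_succ_succAbove, Pi.add_apply]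

/-- The coframe of a chart as a linear map; it does not depend on the point. -/
def coframeL (m k : ℕ) (w : ChartIndex m k) : Coord m k →ₗ[ℂ] (Fin (m + 1) → ℂ) where
  toFun := coframe m k w
  map_add' := coframe_add w
  map_smul' := coframe_smul w

/-- The coframe of a chart as a continuous linear map. -/
def coframeCLM (m k : ℕ) (w : ChartIndex m k) : Coord m k →L[ℂ] (Fin (m + 1) → ℂ) :=
  LinearMap.toContinuousLinearMap (coframeL m k w)

/-- The frame of the distribution in a chart dual to the coframe. -/
def frame (m : ℕ) : ∀ k, ChartIndex m k → Coord m k → (Fin (m + 1) → ℂ) →ₗ[ℂ] Coord m k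
  | 0, _, _ => LinearMap.id
  | k + 1, (w, i), (x, u) =>
    LinearMap.prod (LinearMap.smulRight (LinearMap.proj i) (frame m k w x (unitAt i u)))
      (LinearMap.pi fun j => LinearMap.proj (i.succAbove j))

theorem frame_succ {m k : ℕ} (w : ChartIndex m k) (i : Fin (m + 1)) (x : Coord m k)
    (u : Fin m → ℂ) (θ : Fin (m + 1) → ℂ) :
    frame m (k + 1) (w, i) (x, u) θ =
      (θ i • frame m k w x (unitAt i u), fun j => θ (i.succAbove j)) := rfl

theorem coframe_frame (m : ℕ) : ∀ k w x θ, coframe m k w (frame m k w x θ) = θ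
  | 0, _, _, _ => rfl
  | k + 1, (w, i), (x, u), θ => by
    rw [frame_succ]
    funext a
    rcases Fin.eq_self_or_eq_succAbove i a with rfl | ⟨j, rfl⟩
    · rw [coframe_succ_self, coframe_smul, coframe_frame m k]
      simp
    · rw [coframe_succ_succAbove]

theorem frame_injective {m k : ℕ} (w : ChartIndex m k) (x : Coord m k) :
    Function.Injective (frame m k w x) :=
  Function.LeftInverse.injective (g := coframe m k w) (coframe_frame m k w x)

/-- The coframe has a kernel transverse to the distribution, so its values determine a vector only
among vectors of the distribution; hence the membership hypothesis. -/
theorem frame_coframe_of_mem_range {m k : ℕ} {w : ChartIndex m k} {x v : Coord m k}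
    (h : v ∈ LinearMap.range (frame m k w x)) : frame m k w x (coframe m k w v) = v := by
  obtain ⟨θ, rfl⟩ := h
  rw [coframe_frame]

section analytic
variable {E : Type*} [NormedAddCommGroup E] [NormedSpace ℂ E]

theorem analyticAt_frame {m : ℕ} : ∀ {k : ℕ} (w : ChartIndex m k) {f : E → Coord m k}
    {g : E → Fin (m + 1) → ℂ} {e : E}, AnalyticAt ℂ f e → AnalyticAt ℂ g e →
    AnalyticAt ℂ (fun y => frame m k w (f y) (g y)) e
  | 0, _, _, _, _, _, hg => hg
  | k + 1, (w, i), f, g, e, hf, hg => by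
    have hga : ∀ a, AnalyticAt ℂ (fun y => g y a) e := fun a => (analyticAt_pi_iff.1 hg) a
    have h1 : AnalyticAt ℂ (fun y => (f y : Coord m k × (Fin m → ℂ)).1) e :=
      AnalyticAt.comp (g := fun Y : Coord m k × (Fin m → ℂ) => Y.1)
        ((ContinuousLinearMap.fst ℂ (Coord m k) (Fin m → ℂ)).analyticAt _) hf
    have h2 : AnalyticAt ℂ (fun y => (f y : Coord m k × (Fin m → ℂ)).2) e :=
      AnalyticAt.comp (g := fun Y : Coord m k × (Fin m → ℂ) => Y.2)
        ((ContinuousLinearMap.snd ℂ (Coord m k) (Fin m → ℂ)).analyticAt _) hf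
    have h3 := analyticAt_frame w h1 ((analyticAt_unitAt i _).comp h2)
    have h4 : AnalyticAt ℂ (fun y => fun j => g y (i.succAbove j)) e :=
      analyticAt_pi_iff.2 fun j => hga _
    exact AnalyticAt.prod (F := Coord m k) (G := Fin m → ℂ) ((hga i).smul h3) h4

end analytic

/-! ## Symmetries of the distribution in charts -/

/-- `F` is at `x` an analytic immersion that respects the distributions in the charts `w`
and `w'`. -/
structure SymAt {m k : ℕ} (w w' : ChartIndex m k) (F : Coord m k → Coord m k) (x : Coord m k) :
    Prop where
  analytic : AnalyticAt ℂ F x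
  injective : Function.Injective (fderiv ℂ F x)
  distr : ∀ θ, fderiv ℂ F x (frame m k w x θ) ∈ LinearMap.range (frame m k w' (F x))

/-- The direction with ratios `u`, transported by `F` and measured in the coframe of `w'`. -/
def pushDir {m k : ℕ} (w w' : ChartIndex m k) (i : Fin (m + 1)) (F : Coord m k → Coord m k)
    (X : Coord m (k + 1)) : Fin (m + 1) → ℂ :=
  coframe m k w' (fderiv ℂ F (Prod.fst X) (frame m k w (Prod.fst X) (unitAt i (Prod.snd X))))

/-- The prolongation in charts `(w, i)`, `(w', i')` of a map given in charts `w`, `w'`. -/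
def prolongRep {m k : ℕ} (w w' : ChartIndex m k) (i i' : Fin (m + 1)) (F : Coord m k → Coord m k)
    (X : Coord m (k + 1)) : Coord m (k + 1) :=
  (F (Prod.fst X), ratio i' (pushDir w w' i F X))

theorem analyticAt_fst {m k : ℕ} (X : Coord m (k + 1)) :
    AnalyticAt ℂ (fun Y : Coord m (k + 1) => (Prod.fst Y : Coord m k)) X :=
  (ContinuousLinearMap.fst ℂ (Coord m k) (Fin m → ℂ)).analyticAt X

theorem analyticAt_snd {m k : ℕ} (X : Coord m (k + 1)) :
    AnalyticAt ℂ (fun Y : Coord m (k + 1) => (Prod.snd Y : Fin m → ℂ)) X :=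
  (ContinuousLinearMap.snd ℂ (Coord m k) (Fin m → ℂ)).analyticAt X

theorem analyticAt_pushDir {m k : ℕ} (w w' : ChartIndex m k) (i : Fin (m + 1))
    {F : Coord m k → Coord m k} {X : Coord m (k + 1)} (hF : AnalyticAt ℂ F (Prod.fst X)) :
    AnalyticAt ℂ (pushDir w w' i F) X := by
  have h1 : AnalyticAt ℂ (fun Y : Coord m (k + 1) => fderiv ℂ F (Prod.fst Y)) X :=
    AnalyticAt.fun_comp (f := fun Y : Coord m (k + 1) => (Prod.fst Y : Coord m k))
      hF.fderiv (analyticAt_fst X)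
  have h2 := analyticAt_frame w (analyticAt_fst X)
    ((analyticAt_unitAt i _).fun_comp (analyticAt_snd X))
  have h3 : AnalyticAt ℂ (fun Y : Coord m (k + 1) => fderiv ℂ F (Prod.fst Y)
      (frame m k w (Prod.fst Y) (unitAt i (Prod.snd Y)))) X :=
    AnalyticAt.comp₂ (h := fun p : (Coord m k →L[ℂ] Coord m k) × Coord m k => p.1 p.2)
      ((ContinuousLinearMap.id ℂ (Coord m k →L[ℂ] Coord m k)).analyticAt_bilinear _) h1 h2
  have h4 := ((coframeCLM m k w').analyticAt _).fun_comp h3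
  exact h4

/-- For immersivity, a vector killed by the prolonged differential is vertical, because `F` is an
immersion; on vertical vectors the differential is that of the projective map induced by an
injective linear map, hence injective. The prolonged distribution is respected because it is the
preimage of the tautological line, and that line is moved by `dF`. -/
theorem SymAt.prolong {m k : ℕ} {w w' : ChartIndex m k} {i i' : Fin (m + 1)}
    {F : Coord m k → Coord m k} {X : Coord m (k + 1)} (h : SymAt w w' F (Prod.fst X))
    (h0 : pushDir w w' i F X i' ≠ 0) :
    SymAt (m := m) (k := k + 1) (w, i) (w', i') (prolongRep w w' i i' F) X := by
  have hG : AnalyticAt ℂ (fun Y => ratio i' (pushDir w w' i F Y)) X :=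
    (analyticAt_ratio h0).fun_comp (analyticAt_pushDir w w' i h.analytic)
  have hF1 : AnalyticAt ℂ (fun Y : Coord m (k + 1) => F (Prod.fst Y)) X :=
    AnalyticAt.fun_comp (f := fun Y : Coord m (k + 1) => (Prod.fst Y : Coord m k))
      h.analytic (analyticAt_fst X)
  have hA : AnalyticAt ℂ (prolongRep w w' i i' F) X :=
    AnalyticAt.prod (F := Coord m k) (G := Fin m → ℂ) hF1 hG
  have hFd : HasFDerivAt F (fderiv ℂ F (Prod.fst X)) (Prod.fst X) :=
    h.analytic.differentiableAt.hasFDerivAt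
  have hD : fderiv ℂ (prolongRep w w' i i' F) X =
      ((fderiv ℂ F (Prod.fst X)).comp (ContinuousLinearMap.fst ℂ (Coord m k) (Fin m → ℂ))).prod
        (fderiv ℂ (fun Y => ratio i' (pushDir w w' i F Y)) X) := by
    refine HasFDerivAt.fderiv ?_
    have h1 : HasFDerivAt (fun Y : Coord m (k + 1) => F (Prod.fst Y))
        ((fderiv ℂ F (Prod.fst X)).comp (ContinuousLinearMap.fst ℂ (Coord m k) (Fin m → ℂ))) X :=
      HasFDerivAt.comp (f := fun Y : Coord m (k + 1) => (Prod.fst Y : Coord m k)) X hFd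
        (ContinuousLinearMap.fst ℂ (Coord m k) (Fin m → ℂ)).hasFDerivAt
    exact HasFDerivAt.prodMk (E := Coord m (k + 1)) (F := Coord m k) (G := Fin m → ℂ) h1
      hG.differentiableAt.hasFDerivAt
  have hDa : ∀ Y : Coord m (k + 1), fderiv ℂ (prolongRep w w' i i' F) X Y =
      (fderiv ℂ F (Prod.fst X) (Prod.fst Y),
        fderiv ℂ (fun Y => ratio i' (pushDir w w' i F Y)) X Y) := fun Y => by rw [hD]; rfl
  -- The linear map induced by `dF` on coframe components is injective: the image lies in the
  -- distribution, where components determine the vector.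
  have hLinj : ∀ θ, coframe m k w' (fderiv ℂ F (Prod.fst X) (frame m k w (Prod.fst X) θ)) = 0 →
      θ = 0 := by
    intro θ hθ
    have h1 := frame_coframe_of_mem_range (h.distr θ)
    rw [hθ, map_zero] at h1
    have h2 := h.injective (h1.symm.trans (map_zero _).symm)
    exact frame_injective w _ (h2.trans (map_zero _).symm)
  refine ⟨hA, ?_, ?_⟩
  · rw [injective_iff_map_eq_zero]
    intro Y hY
    rw [hDa] at hY
    obtain ⟨a, b⟩ := Y
    obtain ⟨x, u⟩ := X
    have hY1 : fderiv ℂ F x a = 0 := congrArg Prod.fst hY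
    have hY2 : fderiv ℂ (fun Y => ratio i' (pushDir w w' i F Y)) (x, u) (a, b) = 0 :=
      congrArg Prod.snd hY
    have ha : a = 0 := h.injective (hY1.trans (map_zero _).symm)
    subst ha
    -- Moving `u` along `b` moves the normalized direction vector along `B`, whose `i`-th component
    -- is `0`.
    set B : Fin (m + 1) → ℂ := i.insertNth (α := fun _ => ℂ) (0 : ℂ) b with hB
    let L : (Fin (m + 1) → ℂ) →ₗ[ℂ] (Fin (m + 1) → ℂ) :=
      coframeL m k w' ∘ₗ (fderiv ℂ F x : Coord m k →ₗ[ℂ] Coord m k) ∘ₗ frame m k w x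
    have hU : ∀ s : ℂ, unitAt i (u + s • b) = unitAt i u + s • B := by
      intro s
      funext c
      rcases Fin.eq_self_or_eq_succAbove i c with rfl | ⟨j, rfl⟩
      · simp [hB]
      · simp [hB]
    have hP : ∀ s : ℂ, pushDir w w' i F (x, u + s • b) = L (unitAt i u) + s • L B := by
      intro s
      rw [← map_smul, ← map_add, ← hU]
      rfl
    have hline : HasDerivAt (fun s : ℂ => ((x, u + s • b) : Coord m (k + 1)))
        ((0, b) : Coord m (k + 1)) 0 := by
      have h2 : HasDerivAt (fun s : ℂ => u + s • b) b 0 := by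
        simpa using ((hasDerivAt_id (0 : ℂ)).smul_const b).const_add u
      exact HasDerivAt.prodMk (F := Coord m k) (G := Fin m → ℂ) (hasDerivAt_const (0 : ℂ) x) h2
    have hx0 : ((x, u + (0 : ℂ) • b) : Coord m (k + 1)) = (x, u) := by simp
    have hR : HasDerivAt (fun s : ℂ => ratio i' (L (unitAt i u) + s • L B)) 0 0 := by
      have h3 : HasFDerivAt (fun Y => ratio i' (pushDir w w' i F Y))
          (fderiv ℂ (fun Y => ratio i' (pushDir w w' i F Y)) (x, u))
          ((x, u + (0 : ℂ) • b) : Coord m (k + 1)) := by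
        rw [hx0]
        exact hG.differentiableAt.hasFDerivAt
      have h4 := h3.comp_hasDerivAt (0 : ℂ) hline
      have h4 : HasDerivAt ((fun Y => ratio i' (pushDir w w' i F Y)) ∘
          fun s : ℂ => ((x, u + s • b) : Coord m (k + 1))) 0 0 := hY2 ▸ h4
      refine h4.congr_of_eventuallyEq (Eventually.of_forall fun s => ?_)
      exact congrArg (ratio i') (hP s).symm
    have hPi : L (unitAt i u) i' ≠ 0 := by
      have h5 := hP 0
      rw [hx0, zero_smul, add_zero] at h5
      rw [← h5]
      exact h0
    have hlin : ∀ c, HasDerivAt (fun s : ℂ => (L (unitAt i u) + s • L B) c) (L B c) 0 := by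
      intro c
      simpa using ((hasDerivAt_id (0 : ℂ)).mul_const (L B c)).const_add (L (unitAt i u) c)
    have hne : ∀ᶠ s in 𝓝 (0 : ℂ), (L (unitAt i u) + s • L B) i' ≠ 0 := by
      refine (hlin i').continuousAt.eventually_ne ?_
      simpa using hPi
    -- The ratios of `L (unitAt i u) + s • L B` are stationary at `s = 0`, so the velocity `L B` is
    -- parallel to `L (unitAt i u)`.
    have hLB : L B = (L B i' / L (unitAt i u) i') • L (unitAt i u) := by
      funext c
      rcases Fin.eq_self_or_eq_succAbove i' c with rfl | ⟨j, rfl⟩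
      · simp [div_mul_cancel₀ _ hPi]
      · have h6 : HasDerivAt (fun s : ℂ => ratio i' (L (unitAt i u) + s • L B) j) 0 0 :=
          (hasDerivAt_pi.1 hR) j
        have h7 := h6.mul (hlin i')
        have h8 := (hlin (i'.succAbove j)).unique (h7.congr_of_eventuallyEq (by
          filter_upwards [hne] with s hs
          simp only [Pi.mul_apply, ratio]
          rw [div_mul_cancel₀ _ hs]))
        rw [h8]
        simp [ratio]
        field_simp
    have hB0 : B - (L B i' / L (unitAt i u) i') • unitAt i u = 0 := by
      apply hLinj
      change L _ = 0
      rw [map_sub, map_smul, ← hLB, sub_self]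
    -- At index `i` the vector `B` is `0` and `unitAt i u` is `1`, so the factor of proportionality
    -- vanishes.
    have hc := congrFun hB0 i
    simp only [hB, Pi.sub_apply, Fin.insertNth_apply_same, Pi.smul_apply, unitAt_self, smul_eq_mul,
      mul_one, zero_sub, neg_eq_zero, Pi.zero_apply] at hc
    rw [hc, zero_smul, sub_zero] at hB0
    have hb : b = 0 := by
      funext j
      have := congrFun hB0 (i.succAbove j)
      simpa [hB] using this
    rw [hb]
    rfl
  · intro θ
    obtain ⟨x, u⟩ := X
    set G' := fderiv ℂ (fun Y => ratio i' (pushDir w w' i F Y)) (x, u)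
    set P := pushDir w w' i F (x, u) with hPdef
    set b' : Fin m → ℂ := G' (θ i • frame m k w x (unitAt i u), fun j => θ (i.succAbove j))
    -- The component kept by the new coframe is that of the pushed direction scaled by `θ i`; the
    -- others are the derivatives of the new coordinates.
    refine ⟨i'.insertNth (α := fun _ => ℂ) (θ i * P i') b', ?_⟩
    refine Eq.trans ?_ (hDa _).symm
    change frame m (k + 1) (w', i') (F x, ratio i' P) _ =
      (fderiv ℂ F x (θ i • frame m k w x (unitAt i u)), b')
    rw [frame_succ]
    refine Prod.ext ?_ ?_
    · change (_ : ℂ) • _ = _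
      rw [Fin.insertNth_apply_same, mul_smul, ← map_smul, smul_unitAt_ratio h0, map_smul]
      congr 1
      exact frame_coframe_of_mem_range (h.distr (unitAt i u))
    · funext j
      simp

end

/-! ### Prolongation of an analytic atlas with a distribution. -/

section

namespace Stage

variable {m k : ℕ} {S : Stage m k}

/-- The charts of a stage are an analytic atlas, each chart is onto, and the distribution is
given in the charts by the frames. -/
structure Charted (S : Stage m k) : Prop where
  mem_idx : ∀ p, p ∈ S.src (S.idx p)
  inj : ∀ w, Set.InjOn (S.coord w) (S.src w)
  surj : ∀ w x, ∃ p ∈ S.src w, S.coord w p = x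
  sym : ∀ w w' p, p ∈ S.src w → p ∈ S.src w' → SymAt w w' (S.localRep id w w') (S.coord w p)
  overlap : ∀ w w', IsOpen (S.coord w '' (S.src w ∩ S.src w'))
  distr : ∀ p, S.distr p = LinearMap.range (frame m k (S.idx p) (S.coord (S.idx p) p))

/-- The coframe components, in the chart `w`, of a direction vector of the line of `P`. -/
def dir (w : ChartIndex m k) (P : S.prolong.Pt) : Fin (m + 1) → ℂ :=
  coframe m k w (S.inChart P.1 w P.2.rep)

theorem line_eq_span (P : S.prolong.Pt) :
    line P = Submodule.span ℂ {((P.2.rep : S.distr P.1) : Coord m k)} := by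
  unfold line
  rw [← Projectivization.mk_rep P.2, Projectivization.submodule_mk, Submodule.map_span]
  simp

theorem src_fst {w : ChartIndex m k} {i : Fin (m + 1)} {P : S.prolong.Pt}
    (hP : P ∈ S.prolong.src (w, i)) : P.1 ∈ S.src w := hP.1

theorem src_dir {w : ChartIndex m k} {i : Fin (m + 1)} {P : S.prolong.Pt}
    (hP : P ∈ S.prolong.src (w, i)) : dir w P i ≠ 0 := hP.2

theorem coord_prolong (w : ChartIndex m k) (i : Fin (m + 1)) (P : S.prolong.Pt) :
    S.prolong.coord (w, i) P = (S.coord w P.1, ratio i (dir w P)) := rfl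

theorem eq_of_line_eq {P Q : S.prolong.Pt} (h1 : P.1 = Q.1) (h2 : line P = line Q) : P = Q := by
  obtain ⟨p, ℓ⟩ := P
  obtain ⟨q, ℓ'⟩ := Q
  obtain rfl : p = q := h1
  have h3 : ℓ.submodule = ℓ'.submodule :=
    Submodule.map_injective_of_injective (Submodule.injective_subtype _) h2
  rw [Projectivization.submodule_injective h3]

namespace Charted

variable (hS : S.Charted)
include hS

/-- `localRep` is a `Function.extend`; injectivity of the chart on its source makes the extension
well determined on coordinates of actual points. -/
theorem localRep_apply (Φ : S.Pt → S.Pt) {w : ChartIndex m k} (w' : ChartIndex m k) {p : S.Pt}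
    (hp : p ∈ S.src w) : S.localRep Φ w w' (S.coord w p) = S.coord w' (Φ p) := by
  have hi : Function.Injective (fun q : S.src w => S.coord w q) :=
    fun a b hab => Subtype.ext (hS.inj w a.2 b.2 hab)
  exact hi.extend_apply (fun q : S.src w => S.coord w' (Φ q)) 0 ⟨p, hp⟩

theorem trans_apply {w : ChartIndex m k} (w' : ChartIndex m k) {p : S.Pt} (hp : p ∈ S.src w) :
    S.localRep id w w' (S.coord w p) = S.coord w' p := hS.localRep_apply id w' hp

theorem overlap_mem_nhds {w w' : ChartIndex m k} {p : S.Pt} (hp : p ∈ S.src w)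
    (hp' : p ∈ S.src w') : S.coord w '' (S.src w ∩ S.src w') ∈ 𝓝 (S.coord w p) :=
  (hS.overlap w w').mem_nhds ⟨p, ⟨hp, hp'⟩, rfl⟩

theorem fderiv_trans_comp {w w' : ChartIndex m k} (w'' : ChartIndex m k) {p : S.Pt}
    (hp : p ∈ S.src w) (hp' : p ∈ S.src w') (hp'' : p ∈ S.src w'') (v : Coord m k) :
    fderiv ℂ (S.localRep id w w'') (S.coord w p) v =
      fderiv ℂ (S.localRep id w' w'') (S.coord w' p)
        (fderiv ℂ (S.localRep id w w') (S.coord w p) v) := by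
  have h1 : S.localRep id w w'' =ᶠ[𝓝 (S.coord w p)]
      S.localRep id w' w'' ∘ S.localRep id w w' := by
    filter_upwards [hS.overlap_mem_nhds hp hp'] with y hy
    obtain ⟨q, ⟨hq, hq'⟩, rfl⟩ := hy
    rw [Function.comp_apply, hS.trans_apply _ hq, hS.trans_apply _ hq, hS.trans_apply _ hq']
  have h2 : HasFDerivAt (S.localRep id w' w'') (fderiv ℂ (S.localRep id w' w'') (S.coord w' p))
      (S.localRep id w w' (S.coord w p)) := by
    rw [hS.trans_apply _ hp]
    exact (hS.sym w' w'' p hp' hp'').analytic.differentiableAt.hasFDerivAt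
  have h3 := (h2.comp _ (hS.sym w w' p hp hp').analytic.differentiableAt.hasFDerivAt)
  rw [h1.fderiv_eq, h3.fderiv]
  rfl

theorem fderiv_trans_self {w : ChartIndex m k} (x v : Coord m k) :
    fderiv ℂ (S.localRep id w w) x v = v := by
  have h1 : S.localRep id w w = id := by
    funext y
    obtain ⟨q, hq, rfl⟩ := hS.surj w y
    rw [hS.trans_apply _ hq, id]
  rw [h1, fderiv_id]
  rfl

theorem inChart_trans {w w' : ChartIndex m k} {p : S.Pt}
    (hp : p ∈ S.src w) (hp' : p ∈ S.src w') (v : Coord m k) :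
    S.inChart p w' v = fderiv ℂ (S.localRep id w w') (S.coord w p) (S.inChart p w v) :=
  hS.fderiv_trans_comp w' (hS.mem_idx p) hp hp' v

theorem inChart_idx (p : S.Pt) (v : Coord m k) : S.inChart p (S.idx p) v = v :=
  hS.fderiv_trans_self _ _

theorem fderiv_trans_inChart {w : ChartIndex m k} {p : S.Pt} (hp : p ∈ S.src w)
    (v : Coord m k) :
    fderiv ℂ (S.localRep id w (S.idx p)) (S.coord w p) (S.inChart p w v) = v := by
  rw [← hS.inChart_trans hp (hS.mem_idx p), hS.inChart_idx]

theorem inChart_fderiv_trans {w : ChartIndex m k} {p : S.Pt} (hp : p ∈ S.src w)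
    (v : Coord m k) :
    S.inChart p w (fderiv ℂ (S.localRep id w (S.idx p)) (S.coord w p) v) = v := by
  unfold inChart
  rw [← hS.fderiv_trans_comp w hp (hS.mem_idx p) hp, hS.fderiv_trans_self]

omit hS in
theorem inChart_smul (p : S.Pt) (w : ChartIndex m k) (c : ℂ) (v : Coord m k) :
    S.inChart p w (c • v) = c • S.inChart p w v := map_smul _ c v

omit hS in
theorem inChart_zero (p : S.Pt) (w : ChartIndex m k) : S.inChart p w 0 = 0 :=
  map_zero (fderiv ℂ (S.localRep id (S.idx p) w) (S.coord (S.idx p) p))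

theorem inChart_injective {w : ChartIndex m k} {p : S.Pt} (hp : p ∈ S.src w) :
    Function.Injective (S.inChart p w) :=
  Function.LeftInverse.injective (hS.fderiv_trans_inChart hp)

/-- `Charted.distr` describes the distribution only in the preferred chart. Transitions in both
directions respect the frames, so the description is valid in every chart around `p`. -/
theorem mem_distr_iff {w : ChartIndex m k} {p : S.Pt} (hp : p ∈ S.src w) {v : Coord m k} :
    v ∈ S.distr p ↔ S.inChart p w v ∈ LinearMap.range (frame m k w (S.coord w p)) := by
  rw [hS.distr p]
  constructor
  · rintro ⟨θ, rfl⟩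
    have h := (hS.sym (S.idx p) w p (hS.mem_idx p) hp).distr θ
    rwa [hS.trans_apply _ (hS.mem_idx p)] at h
  · rintro ⟨θ, h⟩
    have h1 := (hS.sym w (S.idx p) p hp (hS.mem_idx p)).distr θ
    rwa [hS.trans_apply _ hp, h, hS.fderiv_trans_inChart hp] at h1

theorem frame_dir {w : ChartIndex m k} {P : S.prolong.Pt} (hP : P.1 ∈ S.src w) :
    frame m k w (S.coord w P.1) (dir w P) = S.inChart P.1 w P.2.rep :=
  frame_coframe_of_mem_range ((hS.mem_distr_iff hP).1 P.2.rep.2)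

theorem dir_ne_zero {w : ChartIndex m k} {P : S.prolong.Pt} (hP : P.1 ∈ S.src w) :
    dir w P ≠ 0 := by
  intro h
  have h1 := hS.frame_dir hP
  rw [h, map_zero] at h1
  have h2 := hS.inChart_injective hP (h1.symm.trans (inChart_zero _ _).symm)
  exact P.2.rep_nonzero (Subtype.ext h2)

theorem dir_trans {w w' : ChartIndex m k} {P : S.prolong.Pt} (hP : P.1 ∈ S.src w)
    (hP' : P.1 ∈ S.src w') : dir w' P = coframe m k w'
      (fderiv ℂ (S.localRep id w w') (S.coord w P.1)
        (frame m k w (S.coord w P.1) (dir w P))) := by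
  rw [hS.frame_dir hP, ← hS.inChart_trans hP hP']
  rfl

-- `P.2.rep` is an arbitrarily chosen representative of the line. All computations with `dir` are
-- therefore up to a nonzero factor, which the ratios do not see.
omit hS in
theorem exists_dir_of_span {w : ChartIndex m k} {P : S.prolong.Pt} {v : Coord m k}
    (hv : line P = Submodule.span ℂ {v}) :
    ∃ c : ℂ, c ≠ 0 ∧ coframe m k w (S.inChart P.1 w v) = c • dir w P := by
  have h1 : v ∈ line P := by
    rw [hv]
    exact Submodule.mem_span_singleton_self v
  rw [line_eq_span, Submodule.mem_span_singleton] at h1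
  obtain ⟨c, rfl⟩ := h1
  refine ⟨c, ?_, ?_⟩
  · rintro rfl
    rw [line_eq_span, zero_smul, Submodule.span_zero_singleton,
      Submodule.span_singleton_eq_bot] at hv
    exact P.2.rep_nonzero (Subtype.ext hv)
  · rw [inChart_smul, coframe_smul]
    rfl

theorem eq_of_dir_eq {w : ChartIndex m k} {P Q : S.prolong.Pt} (h1 : P.1 = Q.1)
    (hP : P.1 ∈ S.src w) {c : ℂ} (hc : c ≠ 0) (h : dir w P = c • dir w Q) : P = Q := by
  refine eq_of_line_eq h1 ?_
  have hQ : Q.1 ∈ S.src w := h1 ▸ hP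
  have h2 : ((P.2.rep : S.distr P.1) : Coord m k) = c • ((Q.2.rep : S.distr Q.1) : Coord m k) := by
    apply hS.inChart_injective hP
    rw [← hS.frame_dir hP, h, inChart_smul]
    rw [h1, ← hS.frame_dir hQ, map_smul]
  rw [line_eq_span, line_eq_span, h2]
  exact Submodule.span_singleton_smul_eq (IsUnit.mk0 c hc) _

/-- The point over `p` whose line has coframe components proportional to `θ`. -/
theorem exists_point_over {w : ChartIndex m k} {p : S.Pt} (hp : p ∈ S.src w)
    {θ : Fin (m + 1) → ℂ} (hθ : θ ≠ 0) :
    ∃ P : S.prolong.Pt, P.1 = p ∧ ∃ c : ℂ, c ≠ 0 ∧ θ = c • dir w P := by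
  set v := fderiv ℂ (S.localRep id w (S.idx p)) (S.coord w p) (frame m k w (S.coord w p) θ)
    with hv
  have hin : S.inChart p w v = frame m k w (S.coord w p) θ := hS.inChart_fderiv_trans hp _
  have hvD : v ∈ S.distr p := (hS.mem_distr_iff hp).2 ⟨θ, hin.symm⟩
  have hv0 : v ≠ 0 := by
    intro h0
    rw [h0, inChart_zero] at hin
    exact hθ (frame_injective w _ (hin.symm.trans (map_zero _).symm))
  have hv0' : (⟨v, hvD⟩ : S.distr p) ≠ 0 := fun h => hv0 (congrArg Subtype.val h)
  let P : S.prolong.Pt := ⟨p, Projectivization.mk ℂ (⟨v, hvD⟩ : S.distr p) hv0'⟩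
  have hl : line P = Submodule.span ℂ {v} := by
    unfold line
    rw [Projectivization.submodule_mk, Submodule.map_span]
    simp
  obtain ⟨c, hc, h⟩ := exists_dir_of_span (w := w) hl
  refine ⟨P, rfl, c, hc, ?_⟩
  rw [← h]
  change θ = coframe m k w (S.inChart p w v)
  rw [hin, coframe_frame]

theorem dir_eq_smul_pushDir {w w' : ChartIndex m k} {i : Fin (m + 1)} {P : S.prolong.Pt}
    (hP : P ∈ S.prolong.src (w, i)) (hP' : P.1 ∈ S.src w') :
    dir w' P = dir w P i •
      pushDir w w' i (S.localRep id w w') (S.prolong.coord (w, i) P) := by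
  rw [hS.dir_trans (src_fst hP) hP']
  conv_lhs => rw [← smul_unitAt_ratio (src_dir hP), map_smul, map_smul, coframe_smul]
  rfl

/-- In charts, transitions of the prolongation are prolongations of transitions. -/
theorem coord_prolong_eq {w w' : ChartIndex m k} (i i' : Fin (m + 1)) {P : S.prolong.Pt}
    (hP : P ∈ S.prolong.src (w, i)) (hP' : P.1 ∈ S.src w') :
    S.prolong.coord (w', i') P =
      prolongRep w w' i i' (S.localRep id w w') (S.prolong.coord (w, i) P) := by
  have h1 := hS.dir_eq_smul_pushDir hP hP'
  rw [coord_prolong, prolongRep]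
  refine Prod.ext ?_ ?_
  · exact (hS.trans_apply w' (src_fst hP)).symm
  · change ratio i' (dir w' P) = ratio i' _
    rw [h1]
    exact ratio_smul _ (src_dir hP) _

theorem dir_ne_zero_iff {w w' : ChartIndex m k} {i i' : Fin (m + 1)} {P : S.prolong.Pt}
    (hP : P ∈ S.prolong.src (w, i)) (hP' : P.1 ∈ S.src w') :
    dir w' P i' ≠ 0 ↔
      pushDir w w' i (S.localRep id w w') (S.prolong.coord (w, i) P) i' ≠ 0 := by
  have h1 := hS.dir_eq_smul_pushDir hP hP'
  have h2 := src_dir hP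
  rw [h1]
  simp [h2]

theorem prolong_inj (w : ChartIndex m k) (i : Fin (m + 1)) :
    Set.InjOn (S.prolong.coord (w, i)) (S.prolong.src (w, i)) := by
  intro P hP Q hQ h
  have h1 : S.coord w P.1 = S.coord w Q.1 := congrArg Prod.fst h
  have h2 : ratio i (dir w P) = ratio i (dir w Q) := congrArg Prod.snd h
  have h3 := hS.inj w (src_fst hP) (src_fst hQ) h1
  refine hS.eq_of_dir_eq h3 (src_fst hP) (c := dir w P i / dir w Q i) (div_ne_zero (src_dir hP) (src_dir hQ)) ?_
  rw [← smul_unitAt_ratio (src_dir hP), ← smul_unitAt_ratio (src_dir hQ), h2, smul_smul]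
  have hQ2 : dir w Q i ≠ 0 := (src_dir hQ)
  simp [div_mul_cancel₀ _ hQ2]

theorem prolong_surj (w : ChartIndex m k) (i : Fin (m + 1)) (X : Coord m (k + 1)) :
    ∃ P ∈ S.prolong.src (w, i), S.prolong.coord (w, i) P = X := by
  obtain ⟨x, u⟩ := X
  obtain ⟨p, hp, rfl⟩ := hS.surj w x
  obtain ⟨P, rfl, c, hc, h⟩ := hS.exists_point_over hp (unitAt_ne_zero i u)
  refine ⟨P, ⟨hp, ?_⟩, ?_⟩
  · intro h0
    have h1 := congrFun h i
    rw [unitAt_self, Pi.smul_apply] at h1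
    change dir w P i = 0 at h0
    simp [h0] at h1
  · rw [coord_prolong, ← ratio_smul i hc, ← h, ratio_unitAt]

/-- In the first chart the overlap is cut out by two open conditions: the base point lies in the
overlap below, and the transported direction has nonzero `i'`-th component. -/
theorem isOpen_overlap_prolong (w w' : ChartIndex m k) (i i' : Fin (m + 1)) :
    IsOpen (S.prolong.coord (w, i) '' (S.prolong.src (w, i) ∩ S.prolong.src (w', i'))) := by
  rw [isOpen_iff_mem_nhds]
  rintro _ ⟨P, ⟨hP, hP'⟩, rfl⟩
  have hs := hS.sym w w' P.1 (src_fst hP) (src_fst hP')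
  have h1 := (analyticAt_pushDir w w' i (X := S.prolong.coord (w, i) P) hs.analytic).continuousAt
  have h2 := ((hS.dir_ne_zero_iff hP (src_fst hP')).1 (src_dir hP'))
  have h3 : ∀ᶠ Y in 𝓝 (S.prolong.coord (w, i) P),
      pushDir w w' i (S.localRep id w w') Y i' ≠ 0 :=
    ((continuous_apply i').continuousAt.comp h1).eventually_ne h2
  have h4 : ∀ᶠ Y : Coord m (k + 1) in 𝓝 (S.prolong.coord (w, i) P),
      Prod.fst Y ∈ S.coord w '' (S.src w ∩ S.src w') :=
    (analyticAt_fst (S.prolong.coord (w, i) P)).continuousAt.eventually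
      (hS.overlap_mem_nhds (src_fst hP) (src_fst hP'))
  filter_upwards [h3, h4] with Y hY hY'
  obtain ⟨Q, hQ, rfl⟩ := hS.prolong_surj w i Y
  obtain ⟨q, ⟨hq, hq'⟩, hqc⟩ := hY'
  have hq1 : q = Q.1 := hS.inj w hq (src_fst hQ) hqc
  subst hq1
  exact ⟨Q, ⟨hQ, hq', (hS.dir_ne_zero_iff hQ hq').2 hY⟩, rfl⟩

end Charted

theorem localRep_prolong_eventuallyEq (hS : S.Charted) {w w' : ChartIndex m k}
    {i i' : Fin (m + 1)} {P : S.prolong.Pt}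
    (hP : P ∈ S.prolong.src (w, i)) (hP' : P ∈ S.prolong.src (w', i')) :
    S.prolong.localRep id (w, i) (w', i') =ᶠ[𝓝 (S.prolong.coord (w, i) P)]
      prolongRep w w' i i' (S.localRep id w w') := by
  filter_upwards [(hS.isOpen_overlap_prolong w w' i i').mem_nhds ⟨P, ⟨hP, hP'⟩, rfl⟩] with Y hY
  obtain ⟨Q, ⟨hQ, hQ'⟩, rfl⟩ := hY
  have hi : Function.Injective (fun q : S.prolong.src (w, i) => S.prolong.coord (w, i) q) :=
    fun a b hab => Subtype.ext (hS.prolong_inj w i a.2 b.2 hab)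
  refine Eq.trans ?_ (hS.coord_prolong_eq i i' hQ (src_fst hQ'))
  exact hi.extend_apply (fun q : S.prolong.src (w, i) => S.prolong.coord (w', i') (id q.1)) 0 ⟨Q, hQ⟩

theorem _root_.MonsterTower.SymAt.congr {w w' : ChartIndex m k} {F G : Coord m k → Coord m k}
    {x : Coord m k} (h : SymAt w w' F x) (hFG : G =ᶠ[𝓝 x] F) : SymAt w w' G x := by
  refine ⟨h.analytic.congr hFG.symm, ?_, ?_⟩
  · rw [hFG.fderiv_eq]
    exact h.injective
  · rw [hFG.fderiv_eq, hFG.eq_of_nhds]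
    exact h.distr

theorem Charted.prolong (hS : S.Charted) : S.prolong.Charted where
  mem_idx P := by
    refine ⟨hS.mem_idx P.1, ?_⟩
    have h1 : ∃ i, coframe m k (S.idx P.1) P.2.rep i ≠ 0 := by
      by_contra! h
      refine hS.dir_ne_zero (hS.mem_idx P.1) (P := P) ?_
      funext i
      rw [dir, hS.inChart_idx]
      exact h i
    have h2 := Classical.epsilon_spec h1
    change coframe m k (S.idx P.1) (S.inChart P.1 (S.idx P.1) P.2.rep) _ ≠ 0
    rw [hS.inChart_idx]
    exact h2
  inj := fun w => hS.prolong_inj w.1 w.2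
  surj := fun w => hS.prolong_surj w.1 w.2
  sym := by
    rintro ⟨w, i⟩ ⟨w', i'⟩ P hP hP'
    exact (SymAt.prolong (X := S.prolong.coord (w, i) P) (hS.sym w w' P.1 (src_fst hP) (src_fst hP'))
      ((hS.dir_ne_zero_iff hP (src_fst hP')).1 (src_dir hP'))).congr (localRep_prolong_eventuallyEq hS hP hP')
  overlap := fun w w' => hS.isOpen_overlap_prolong w.1 w'.1 w.2 w'.2
  distr := by
    intro P
    set w := S.idx P.1 with hw
    obtain ⟨i, hi⟩ : ∃ i, S.prolong.idx P = (w, i) := ⟨_, rfl⟩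
    have hdir : dir w P i ≠ 0 := by
      have h1 : ∃ i, coframe m k (S.idx P.1) P.2.rep i ≠ 0 := by
        by_contra! h
        refine hS.dir_ne_zero (hS.mem_idx P.1) (P := P) ?_
        funext i
        rw [dir, hS.inChart_idx]
        exact h i
      have h2 := Classical.epsilon_spec h1
      rw [dir, hS.inChart_idx]
      have h3 : i = Classical.epsilon fun i => coframe m k (S.idx P.1) P.2.rep i ≠ 0 :=
        (congrArg Prod.snd hi).symm
      rw [h3]
      exact h2
    rw [hi, coord_prolong]
    -- The frame vector with the ratios of `P` spans the line of `P`; hence the preimage of the line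
    -- under `dπ` is the range of the new frame.
    have hfr : frame m k w (S.coord w P.1) (unitAt i (ratio i (dir w P))) =
        (dir w P i)⁻¹ • ((P.2.rep : S.distr P.1) : Coord m k) := by
      have h4 := hS.frame_dir (hS.mem_idx P.1)
      rw [hS.inChart_idx, ← hw] at h4
      rw [← h4, ← map_smul]
      congr 1
      rw [eq_inv_smul_iff₀ hdir, smul_unitAt_ratio hdir]
    change (line P).comap (LinearMap.fst ℂ (Coord m k) (Fin m → ℂ)) = _
    rw [line_eq_span]
    ext ⟨a, b⟩
    rw [Submodule.mem_comap]
    change a ∈ _ ↔ _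
    rw [Submodule.mem_span_singleton]
    constructor
    · rintro ⟨c, rfl⟩
      refine ⟨i.insertNth (α := fun _ => ℂ) (c * dir w P i) b, ?_⟩
      rw [frame_succ, hfr]
      refine Prod.ext ?_ ?_
      · change (_ : ℂ) • _ = _
        rw [Fin.insertNth_apply_same, smul_smul, mul_assoc, mul_inv_cancel₀ hdir, mul_one]
      · funext j
        simp
    · rintro ⟨θ, hθ⟩
      rw [frame_succ, hfr] at hθ
      have h5 : θ i • (dir w P i)⁻¹ • ((P.2.rep : S.distr P.1) : Coord m k) = a :=
        congrArg Prod.fst hθ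
      exact ⟨θ i * (dir w P i)⁻¹, by rw [← h5, smul_smul]⟩

end Stage

end

/-! ### Convergence, analytic curves and prolonged curves in charts. -/

section

namespace Stage

variable {m k : ℕ} {S : Stage m k}

namespace Charted

variable (hS : S.Charted)
include hS

/-- The point with given coordinates in a given chart. -/
def point (w : ChartIndex m k) (x : Coord m k) : S.Pt := (hS.surj w x).choose

theorem point_mem (w : ChartIndex m k) (x : Coord m k) : hS.point w x ∈ S.src w :=
  (hS.surj w x).choose_spec.1

theorem coord_point (w : ChartIndex m k) (x : Coord m k) : S.coord w (hS.point w x) = x :=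
  (hS.surj w x).choose_spec.2

theorem point_coord {w : ChartIndex m k} {p : S.Pt} (hp : p ∈ S.src w) :
    hS.point w (S.coord w p) = p :=
  hS.inj w (hS.point_mem w _) hp (hS.coord_point w _)

theorem point_prolong_fst (w : ChartIndex m k) (i : Fin (m + 1)) (X : Coord m (k + 1)) :
    (hS.prolong.point (w, i) X).1 = hS.point w (Prod.fst X) := by
  have h := hS.prolong.point_mem (w, i) X
  rw [← hS.point_coord (src_fst h)]
  congr 1
  exact congrArg Prod.fst (hS.prolong.coord_point (w, i) X)

omit hS in
theorem tendsto_of_tendsto_nhds {α : Type*} {l : Filter α} {f : α → S.Pt} {p : S.Pt}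
    {w : ChartIndex m k} (hp : p ∈ S.src w) (h : Tendsto f l (𝓝 p)) :
    (∀ᶠ a in l, f a ∈ S.src w) ∧ Tendsto (fun a => S.coord w (f a)) l (𝓝 (S.coord w p)) := by
  have key : ∀ O : Set (Coord m k), IsOpen O → S.coord w p ∈ O →
      ∀ᶠ a in l, f a ∈ S.src w ∩ S.coord w ⁻¹' O := fun O hO hpO =>
    h (IsOpen.mem_nhds (TopologicalSpace.isOpen_generateFrom_of_mem ⟨w, O, hO, rfl⟩) ⟨hp, hpO⟩)
  refine ⟨(key Set.univ isOpen_univ trivial).mono fun a ha => ha.1, ?_⟩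
  rw [tendsto_nhds]
  intro O hO hpO
  exact (key O hO hpO).mono fun a ha => ha.2

/-- The topology is generated by the neighbourhoods of all charts at once; open overlaps and
continuous transitions reduce convergence to a single chart around the limit. -/
theorem tendsto_nhds_iff {α : Type*} {l : Filter α} {f : α → S.Pt} {p : S.Pt}
    {w : ChartIndex m k} (hp : p ∈ S.src w) : Tendsto f l (𝓝 p) ↔
      (∀ᶠ a in l, f a ∈ S.src w) ∧
        Tendsto (fun a => S.coord w (f a)) l (𝓝 (S.coord w p)) := by
  refine ⟨tendsto_of_tendsto_nhds hp, ?_⟩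
  rintro ⟨h1, h2⟩
  rw [TopologicalSpace.tendsto_nhds_generateFrom_iff]
  rintro _ ⟨w', O, hO, rfl⟩ ⟨hp', hpO⟩
  have h3 := h2.eventually (hS.overlap_mem_nhds hp hp')
  have h4 : Tendsto (S.localRep id w w') (𝓝 (S.coord w p)) (𝓝 (S.coord w' p)) := by
    have := (hS.sym w w' p hp hp').analytic.continuousAt.tendsto
    rwa [hS.trans_apply w' hp] at this
  have h5 := (h4.comp h2).eventually (hO.mem_nhds hpO)
  change ∀ᶠ a in l, f a ∈ _
  filter_upwards [h1, h3, h5] with a ha1 ha3 ha5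
  obtain ⟨q, ⟨hq, hq'⟩, hqa⟩ := ha3
  have hqa' := hS.inj w hq ha1 hqa
  subst hqa'
  refine ⟨hq', ?_⟩
  rw [Function.comp_apply, hS.trans_apply w' ha1] at ha5
  exact ha5

theorem tendsto_point (w : ChartIndex m k) (x : Coord m k) :
    Tendsto (hS.point w) (𝓝 x) (𝓝 (hS.point w x)) := by
  rw [hS.tendsto_nhds_iff (hS.point_mem w x)]
  refine ⟨Eventually.of_forall (hS.point_mem w), ?_⟩
  simp only [hS.coord_point]
  exact tendsto_id

omit hS in
theorem isOpen_src_inter (w : ChartIndex m k) {O : Set (Coord m k)} (hO : IsOpen O) :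
    IsOpen (S.src w ∩ S.coord w ⁻¹' O) :=
  TopologicalSpace.isOpen_generateFrom_of_mem ⟨w, O, hO, rfl⟩

/-! ### Curves in charts -/

theorem deriv_coord_trans {c : ℂ → S.Pt} {w w' : ChartIndex m k} {t : ℂ}
    (hc : ∀ᶠ s in 𝓝 t, c s ∈ S.src w) (hd : DifferentiableAt ℂ (fun s => S.coord w (c s)) t)
    (hw' : c t ∈ S.src w') :
    HasDerivAt (fun s => S.coord w' (c s))
      (fderiv ℂ (S.localRep id w w') (S.coord w (c t)) (deriv (fun s => S.coord w (c s)) t)) t := by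
  have h1 := (hS.sym w w' (c t) hc.self_of_nhds hw').analytic.differentiableAt.hasFDerivAt
  have h2 := h1.comp_hasDerivAt t hd.hasDerivAt
  refine h2.congr_of_eventuallyEq ?_
  filter_upwards [hc] with s hs
  exact (hS.trans_apply w' hs).symm

theorem inChart_velocity {c : ℂ → S.Pt} {w : ChartIndex m k} {t : ℂ}
    (hc : ∀ᶠ s in 𝓝 t, c s ∈ S.src w) (hd : DifferentiableAt ℂ (fun s => S.coord w (c s)) t) :
    S.inChart (c t) w (S.velocity c t) = deriv (fun s => S.coord w (c s)) t := by
  unfold velocity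
  rw [(hS.deriv_coord_trans hc hd (hS.mem_idx (c t))).deriv]
  exact hS.inChart_fderiv_trans hc.self_of_nhds _

end Charted

/-- Near `t = 0` the curve `c` stays in the chart `w` and is analytic there. -/
def AnalyticIn (w : ChartIndex m k) (c : ℂ → S.Pt) : Prop :=
  (∀ᶠ t in 𝓝 0, c t ∈ S.src w) ∧ AnalyticAt ℂ (fun t => S.coord w (c t)) 0

theorem AnalyticIn.mem {w : ChartIndex m k} {c : ℂ → S.Pt} (h : AnalyticIn w c) :
    c 0 ∈ S.src w := h.1.self_of_nhds

theorem AnalyticIn.inChart_velocity (hS : S.Charted) {w : ChartIndex m k} {c : ℂ → S.Pt}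
    (h : AnalyticIn w c) : ∀ᶠ t in 𝓝 0,
      S.inChart (c t) w (S.velocity c t) = deriv (fun s => S.coord w (c s)) t := by
  filter_upwards [h.1.eventually_nhds, h.2.eventually_analyticAt] with t h1 h2
  exact hS.inChart_velocity h1 h2.differentiableAt

theorem AnalyticIn.trans (hS : S.Charted) {w w' : ChartIndex m k} {c : ℂ → S.Pt}
    (h : AnalyticIn w c) (hw' : c 0 ∈ S.src w') : AnalyticIn w' c := by
  have h1 := h.2.continuousAt.eventually (hS.overlap_mem_nhds h.mem hw')
  refine ⟨?_, ?_⟩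
  · filter_upwards [h1, h.1] with t ht ht'
    obtain ⟨q, ⟨hq, hq'⟩, hqa⟩ := ht
    rwa [← hS.inj w hq ht' hqa]
  · have h2 := AnalyticAt.fun_comp (f := fun t => S.coord w (c t))
      (hS.sym w w' (c 0) h.mem hw').analytic h.2
    refine h2.congr ?_
    filter_upwards [h.1] with t ht
    exact hS.trans_apply w' ht

theorem eventually_nhdsNE_of_nhds {p : ℂ → Prop} (h : ∀ᶠ t in 𝓝 (0 : ℂ), p t) :
    ∀ᶠ t in 𝓝[≠] (0 : ℂ), p t := h.filter_mono nhdsWithin_le_nhds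

theorem eventually_eventually_nhdsNE {p : ℂ → Prop} (h : ∀ᶠ t in 𝓝[≠] (0 : ℂ), p t) :
    ∀ᶠ t in 𝓝[≠] (0 : ℂ), ∀ᶠ s in 𝓝 t, p s := by
  rw [← eventually_eventually_nhdsWithin] at h
  filter_upwards [h, self_mem_nhdsWithin] with t ht ht0
  rwa [(isOpen_compl_singleton (x := (0 : ℂ))).nhdsWithin_eq ht0] at ht

/-- The velocity of `X` in the chart `w` has the ratios prescribed by `u`, away from `t = 0`. -/
def IsLiftOf (w : ChartIndex m k) (i : Fin (m + 1)) (X : ℂ → Coord m k) (u : ℂ → Fin m → ℂ) :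
    Prop :=
  ∀ᶠ t in 𝓝[≠] (0 : ℂ), coframe m k w (deriv X t) i ≠ 0 ∧
    coframe m k w (deriv X t) = coframe m k w (deriv X t) i • unitAt i (u t)

/-- Off `t = 0` the new coordinates are ratios of analytic velocity components. The prolonged curve
has a limit at `0` by definition, so the singularity of the ratios is removable. -/
theorem IsProlongationOf.analyticIn (hS : S.Charted) {w : ChartIndex m k} {i : Fin (m + 1)}
    {c : ℂ → S.Pt} {c' : ℂ → S.prolong.Pt} (hc : AnalyticIn w c) (h : IsProlongationOf c c')
    (h0 : c' 0 ∈ S.prolong.src (w, i)) :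
    AnalyticIn (S := S.prolong) (w, i) c' ∧
      IsLiftOf w i (fun t => S.coord w (c t))
        (fun t => (Prod.snd (S.prolong.coord (w, i) (c' t)) : Fin m → ℂ)) := by
  obtain ⟨h1, h2, h3⟩ := h
  obtain ⟨h4, h5⟩ := Charted.tendsto_of_tendsto_nhds h0 h3
  set X : ℂ → Coord m k := fun t => S.coord w (c t) with hX
  have hlift : IsLiftOf w i X
      (fun t => (Prod.snd (S.prolong.coord (w, i) (c' t)) : Fin m → ℂ)) := by
    filter_upwards [h4, h2, eventually_nhdsNE_of_nhds h1,
      eventually_nhdsNE_of_nhds (hc.inChart_velocity hS)] with t ht4 ht2 ht1 htv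
    obtain ⟨a, ha, hav⟩ := Charted.exists_dir_of_span (w := w) ht2
    rw [ht1, htv] at hav
    rw [hav]
    have hd := src_dir ht4
    refine ⟨by simp [ha, hd], ?_⟩
    change _ = _ • unitAt i (ratio i (dir w (c' t)))
    rw [Pi.smul_apply, smul_eq_mul, mul_smul, smul_unitAt_ratio hd]
  refine ⟨⟨?_, ?_⟩, hlift⟩
  · rw [← nhdsNE_sup_pure (0 : ℂ), eventually_sup]
    exact ⟨h4, h0⟩
  · have hX1 : AnalyticAt ℂ (fun t => (Prod.fst (S.prolong.coord (w, i) (c' t)) : Coord m k)) 0 := by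
      refine hc.2.congr ?_
      filter_upwards [h1] with t ht
      rw [coord_prolong, ht]
    have hX2 : AnalyticAt ℂ
        (fun t => (Prod.snd (S.prolong.coord (w, i) (c' t)) : Fin m → ℂ)) 0 := by
      refine Complex.analyticAt_of_differentiable_on_punctured_nhds_of_continuousAt ?_ ?_
      · have hXa : ∀ᶠ t in 𝓝[≠] (0 : ℂ), AnalyticAt ℂ X t :=
          eventually_nhdsNE_of_nhds hc.2.eventually_analyticAt
        filter_upwards [eventually_eventually_nhdsNE hlift, hXa] with t ht hta
        have hθ : AnalyticAt ℂ (fun s => coframe m k w (deriv X s)) t :=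
          ((coframeCLM m k w).analyticAt _).comp hta.deriv
        have hr := AnalyticAt.fun_comp (f := fun s => coframe m k w (deriv X s))
          (analyticAt_ratio ht.self_of_nhds.1) hθ
        refine (hr.congr ?_).differentiableAt
        filter_upwards [ht] with s hs
        rw [hs.2, ratio_smul _ hs.1, ratio_unitAt]
      · have h6 : Tendsto (fun t => (Prod.snd (S.prolong.coord (w, i) (c' t)) : Fin m → ℂ))
            (𝓝[≠] 0) (𝓝 (Prod.snd (S.prolong.coord (w, i) (c' 0)))) :=
          ((analyticAt_snd _).continuousAt.tendsto).comp h5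
        rw [continuousAt_iff_punctured_nhds]
        exact h6
    exact AnalyticAt.prod (F := Coord m k) (G := Fin m → ℂ) hX1 hX2

/-- Equal ratios give equal lines only for vectors in the distribution, whence the hypothesis `hD`
on the velocity. -/
theorem isProlongationOf_of_isLiftOf (hS : S.Charted) {w : ChartIndex m k} {i : Fin (m + 1)}
    {c : ℂ → S.Pt} {c' : ℂ → S.prolong.Pt} (hc : AnalyticIn w c)
    (hc' : AnalyticIn (S := S.prolong) (w, i) c') (h1 : ∀ᶠ t in 𝓝 0, (c' t).1 = c t)
    (hD : ∀ᶠ t in 𝓝[≠] 0, deriv (fun t => S.coord w (c t)) t ∈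
      LinearMap.range (frame m k w (S.coord w (c t))))
    (hl : IsLiftOf w i (fun t => S.coord w (c t))
        (fun t => (Prod.snd (S.prolong.coord (w, i) (c' t)) : Fin m → ℂ))) :
    IsProlongationOf c c' := by
  refine ⟨h1, ?_, ?_⟩
  · filter_upwards [hl, eventually_nhdsNE_of_nhds h1, eventually_nhdsNE_of_nhds hc'.1,
      eventually_nhdsNE_of_nhds (hc.inChart_velocity hS),
      eventually_nhdsNE_of_nhds hc.1, hD] with t ht ht1 hts htv htc htD
    have hd := src_dir hts
    change _ ∧ _ = _ • unitAt i (ratio i (dir w (c' t))) at ht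
    obtain ⟨hta, htb⟩ := ht
    set θ := coframe m k w (deriv (fun t => S.coord w (c t)) t) with hθ
    obtain ⟨a, ha, hθd⟩ : ∃ a : ℂ, a ≠ 0 ∧ θ = a • dir w (c' t) := by
      refine ⟨θ i * (dir w (c' t) i)⁻¹, mul_ne_zero hta (inv_ne_zero hd), ?_⟩
      conv_lhs => rw [htb]
      rw [mul_smul]
      congr 1
      rw [eq_inv_smul_iff₀ hd, smul_unitAt_ratio hd]
    have hv : S.velocity c t = a • (((c' t).2.rep : S.distr (c' t).1) : Coord m k) := by
      apply hS.inChart_injective htc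
      rw [htv, Charted.inChart_smul, ← frame_coframe_of_mem_range htD, ← hθ, hθd, map_smul]
      congr 1
      rw [← ht1, hS.frame_dir (src_fst hts)]
    rw [line_eq_span, hv]
    exact (Submodule.span_singleton_smul_eq (IsUnit.mk0 _ ha) _).symm
  · have h2 := hc'.2.continuousAt.tendsto
    exact (hS.prolong.tendsto_nhds_iff hc'.mem).2
      ⟨eventually_nhdsNE_of_nhds hc'.1, h2.mono_left nhdsWithin_le_nhds⟩

/-- Off `0` the lines are spanned by the same velocity. At `0` the values are limits of the same
curve; instead of invoking a Hausdorff property, both values are placed in a common chart, where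
limits are unique. -/
theorem IsProlongationOf.eventuallyEq (hS : S.Charted) {c d : ℂ → S.Pt}
    {c' d' : ℂ → S.prolong.Pt} (hc : IsProlongationOf c c') (hd : IsProlongationOf d d')
    (hcd : c =ᶠ[𝓝 0] d) : c' =ᶠ[𝓝 0] d' := by
  have hne : ∀ᶠ t in 𝓝[≠] (0 : ℂ), c' t = d' t := by
    filter_upwards [eventually_nhdsNE_of_nhds hc.1, eventually_nhdsNE_of_nhds hd.1,
      eventually_nhdsNE_of_nhds hcd.eventually_nhds, hc.2.1, hd.2.1] with t h1 h2 h3 h4 h5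
    refine eq_of_line_eq (h1.trans (h3.self_of_nhds.trans h2.symm)) ?_
    have h3' : S.velocity c t = S.velocity d t := by
      unfold velocity
      rw [h3.self_of_nhds]
      refine Filter.EventuallyEq.deriv_eq ?_
      filter_upwards [h3] with s hs
      rw [hs]
    rw [h4, h5, h3']
  have h0 : c' 0 = d' 0 := by
    obtain ⟨w, i, hP⟩ : ∃ w i, c' 0 ∈ S.prolong.src (w, i) := ⟨_, _, hS.prolong.mem_idx (c' 0)⟩
    have hbase : (c' 0).1 = (d' 0).1 :=
      hc.1.self_of_nhds.trans (hcd.self_of_nhds.trans hd.1.self_of_nhds.symm)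
    have hw : (d' 0).1 ∈ S.src w := hbase ▸ src_fst hP
    obtain ⟨j, hj⟩ : ∃ j, dir w (d' 0) j ≠ 0 := by
      by_contra! h
      exact hS.dir_ne_zero hw (funext h)
    have hQ : d' 0 ∈ S.prolong.src (w, j) := ⟨hw, hj⟩
    obtain ⟨hP1, hP2⟩ := Charted.tendsto_of_tendsto_nhds hP hc.2.2
    obtain ⟨hQ1, hQ2⟩ := Charted.tendsto_of_tendsto_nhds hQ hd.2.2
    have hcomp : ∀ (i : Fin (m + 1)) (P : S.prolong.Pt),
        Tendsto (fun Y : Coord m (k + 1) => unitAt i (Prod.snd Y)) (𝓝 (S.prolong.coord (w, i) P))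
          (𝓝 (unitAt i (ratio i (dir w P)))) := fun i P =>
      ((analyticAt_unitAt i _).fun_comp (analyticAt_snd _)).continuousAt
    have hP3 := ((continuous_apply j).tendsto _).comp ((hcomp i _).comp hP2)
    have hQ3 := ((continuous_apply i).tendsto _).comp ((hcomp j _).comp hQ2)
    -- Off `0` the ratio of component `j` to component `i` and the inverse ratio multiply to `1`.
    -- The limit `1` of the product shows that component `j` of the line `c' 0` is nonzero.
    have hprod := (hP3.mul hQ3).congr' (f₂ := fun _ => (1 : ℂ)) (by
      filter_upwards [hP1, hQ1, hne] with t ht1 ht2 ht3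
      change unitAt i (ratio i (dir w (c' t))) j * unitAt j (ratio j (dir w (d' t))) i = 1
      rw [← ht3] at ht2 ⊢
      have e1 := src_dir ht1
      have e2 := src_dir ht2
      have e3 : ∀ (a b : Fin (m + 1)), dir w (c' t) a ≠ 0 →
          unitAt a (ratio a (dir w (c' t))) b = dir w (c' t) b / dir w (c' t) a := by
        intro a b ha
        rw [eq_div_iff ha, mul_comm]
        exact congrFun (smul_unitAt_ratio ha) b
      rw [e3 _ _ e1, e3 _ _ e2]
      field_simp)
    have h1 := tendsto_nhds_unique hprod tendsto_const_nhds
    have hPj : c' 0 ∈ S.prolong.src (w, j) := by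
      refine ⟨src_fst hP, fun h => ?_⟩
      have h2 : unitAt i (ratio i (dir w (c' 0))) j = 0 := by
        have := congrFun (smul_unitAt_ratio (src_dir hP)) j
        rw [Pi.smul_apply, smul_eq_mul] at this
        exact (mul_eq_zero.1 (this.trans h)).resolve_left (src_dir hP)
      rw [h2, zero_mul] at h1
      exact zero_ne_one h1
    obtain ⟨hP1, hP2⟩ := Charted.tendsto_of_tendsto_nhds hPj hc.2.2
    refine hS.prolong.inj (w, j) hPj hQ (tendsto_nhds_unique (hP2.congr' ?_) hQ2)
    filter_upwards [hne] with t ht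
    rw [ht]
  rw [EventuallyEq, ← nhdsNE_sup_pure (0 : ℂ), eventually_sup]
  exact ⟨hne, h0⟩

end Stage

open Stage

theorem tower_charted (m : ℕ) : ∀ k, (tower m k).Charted
  | k + 1 => (tower_charted m k).prolong
  | 0 => by
    have hrep : ∀ w w', (tower m 0).localRep id w w' = id := by
      intro w w'
      funext y
      have hi : Function.Injective (fun q : (tower m 0).src w => (tower m 0).coord w q) :=
        fun a b hab => Subtype.ext hab
      exact hi.extend_apply (fun q : (tower m 0).src w => (tower m 0).coord w' (id q.1)) 0
        ⟨y, trivial⟩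
    refine ⟨fun p => trivial, fun w p _ q _ h => h, fun w x => ⟨x, trivial, rfl⟩, ?_, ?_, ?_⟩
    · intro w w' p _ _
      rw [hrep]
      refine ⟨analyticAt_id, ?_, ?_⟩
      · rw [fderiv_id]
        exact Function.injective_id
      · intro θ
        rw [fderiv_id]
        exact ⟨θ, rfl⟩
    · intro w w'
      convert isOpen_univ
      ext y
      exact ⟨fun _ => trivial, fun _ => ⟨y, ⟨trivial, trivial⟩, rfl⟩⟩
    · intro p
      exact (LinearMap.range_id).symm

end

section

open Stage

/-! ## Critical hyperplanes in charts -/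

/-- The indices `a` for which `θ_a = 0` is a critical hyperplane at the point with coordinates
`x` in the chart `w`. -/
def crit (m : ℕ) : ∀ k, ChartIndex m k → Coord m k → Set (Fin (m + 1))
  | 0, _, _ => ∅
  | k + 1, (w, j), (x, u) => {a | a = j ∨ a ∈ crit m k w x ∧ unitAt j u a = 0}

theorem mem_crit_succ {m k : ℕ} {w : ChartIndex m k} {j : Fin (m + 1)} {X : Coord m (k + 1)}
    {a : Fin (m + 1)} : a ∈ crit m (k + 1) (w, j) X ↔
      a = j ∨ a ∈ crit m k w (Prod.fst X) ∧ unitAt j (Prod.snd X) a = 0 := Iff.rfl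

/-- In the chart `w` the set `N` is, if not empty, an affine subspace with direction `M`; it meets
the distribution in the hyperplane `θ_i = 0`. -/
structure FlatIn {m k : ℕ} (w : ChartIndex m k) (N : Set (Point m k))
    (M : Submodule ℂ (Coord m k)) (i : Fin (m + 1)) : Prop where
  diff : ∀ p ∈ (tower m k).src w, ∀ q ∈ (tower m k).src w, p ∈ N →
    (q ∈ N ↔ (tower m k).coord w q - (tower m k).coord w p ∈ M)
  mem_crit : ∀ p ∈ (tower m k).src w, p ∈ N → i ∈ crit m k w ((tower m k).coord w p)
  frame_mem : ∀ p ∈ (tower m k).src w, p ∈ N → ∀ θ,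
    frame m k w ((tower m k).coord w p) θ ∈ M ↔ θ i = 0

variable {m k : ℕ}

theorem fst_mem_src {w : ChartIndex m k} {j : Fin (m + 1)} {P : Point m (k + 1)}
    (hP : P ∈ (tower m (k + 1)).src (w, j)) : proj P ∈ (tower m k).src w := hP.1

/-- Difference quotients of a curve in an affine subspace lie in its direction `M`, which is closed;
conversely a vector of `M` is the velocity of a straight line in the chart. -/
theorem FlatIn.mem_tangentsTo {w : ChartIndex m k} {N : Set (Point m k)}
    {M : Submodule ℂ (Coord m k)} {i : Fin (m + 1)} (h : FlatIn w N M i) {p : Point m k}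
    (hp : p ∈ (tower m k).src w) (hpN : p ∈ N) {v : Coord m k} :
    v ∈ (tower m k).tangentsTo N p ↔ (tower m k).inChart p w v ∈ M := by
  have hT := tower_charted m k
  constructor
  · rintro ⟨c, rfl, hc, hca, rfl⟩
    have hA : AnalyticIn (S := tower m k) ((tower m k).idx (c 0)) c :=
      ⟨hc.mono fun t ht => ht.2, hca⟩
    have hB := hA.trans hT hp
    rw [hT.inChart_velocity hB.1 hB.2.differentiableAt]
    have hd := hB.2.differentiableAt.hasDerivAt
    rw [hasDerivAt_iff_tendsto_slope] at hd
    have hM : IsClosed (M : Set (Coord m k)) := M.closed_of_finiteDimensional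
    refine hM.mem_of_tendsto hd ?_
    filter_upwards [eventually_nhdsNE_of_nhds hB.1, eventually_nhdsNE_of_nhds hc] with t ht ht'
    rw [slope_def_module]
    exact M.smul_mem _ ((h.diff _ hp _ ht hpN).1 ht'.1)
  · intro hv
    set x := (tower m k).coord w p with hx
    set V := (tower m k).inChart p w v with hV
    let c : ℂ → Point m k := fun t => hT.point w (x + t • V)
    have hc0 : c 0 = p := by
      simp only [c, zero_smul, add_zero]
      exact hT.point_coord hp
    have hlin : HasDerivAt (fun t : ℂ => x + t • V) V 0 := by
      simpa using ((hasDerivAt_id (0 : ℂ)).smul_const V).const_add x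
    have hcw : (fun t => (tower m k).coord w (c t)) = fun t : ℂ => x + t • V := by
      funext t
      exact hT.coord_point w _
    have hA : AnalyticIn (S := tower m k) w c := by
      refine ⟨Eventually.of_forall fun t => hT.point_mem w _, ?_⟩
      rw [hcw]
      exact analyticAt_const.add (analyticAt_id.smul analyticAt_const)
    have hB := hA.trans hT (w' := (tower m k).idx p) (hc0 ▸ hT.mem_idx p)
    refine ⟨c, hc0, ?_, hB.2, ?_⟩
    · filter_upwards [hB.1] with t ht
      refine ⟨?_, ht⟩
      rw [h.diff p hp _ (hT.point_mem w _) hpN, hT.coord_point]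
      rw [← hx, add_sub_cancel_left]
      exact M.smul_mem t hv
    · have h1 := hT.inChart_velocity (t := 0) hA.1 hA.2.differentiableAt
      rw [hcw, hlin.deriv, hV, hc0] at h1
      exact hT.inChart_injective hp h1

theorem FlatIn.mem_tangentsTo_of_mem_distr {w : ChartIndex m k} {N : Set (Point m k)}
    {M : Submodule ℂ (Coord m k)} {i : Fin (m + 1)} (h : FlatIn w N M i) {p : Point m k}
    (hp : p ∈ (tower m k).src w) (hpN : p ∈ N) {v : Coord m k} (hv : v ∈ (tower m k).distr p) :
    v ∈ (tower m k).tangentsTo N p ↔ coframe m k w ((tower m k).inChart p w v) i = 0 := by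
  have hT := tower_charted m k
  rw [h.mem_tangentsTo hp hpN, ← h.frame_mem p hp hpN,
    frame_coframe_of_mem_range ((hT.mem_distr_iff hp).1 hv)]

theorem line_subset_iff {P : Point m (k + 1)} {w : ChartIndex m k} {i : Fin (m + 1)}
    {H : Set (Coord m k)} (hH : ∀ v ∈ (tower m k).distr (proj P), v ∈ H ↔
      coframe m k w ((tower m k).inChart (proj P) w v) i = 0) :
    (lineOf P : Set (Coord m k)) ⊆ H ↔ dir (S := tower m k) w P i = 0 := by
  have hr : (lineOf P : Set (Coord m k)) =
      Submodule.span ℂ {((P.2.rep : (tower m k).distr P.1) : Coord m k)} :=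
    congrArg _ (line_eq_span (S := tower m k) P)
  rw [hr]
  constructor
  · intro h
    exact (hH _ P.2.rep.2).1 (h (Submodule.mem_span_singleton_self _))
  · rintro h v hv
    obtain ⟨c, rfl⟩ := Submodule.mem_span_singleton.1 hv
    refine (hH _ (Submodule.smul_mem _ c P.2.rep.2)).2 ?_
    rw [Charted.inChart_smul, coframe_smul, Pi.smul_apply]
    change c • dir (S := tower m k) w P i = 0
    rw [h, smul_zero]

/-- The direction of the prolongation of an affine subspace with direction `M`. -/
def prolongDirection (j i : Fin (m + 1)) (M : Submodule ℂ (Coord m k)) :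
    Submodule ℂ (Coord m (k + 1)) where
  carrier := {X | Prod.fst X ∈ M ∧
    (j.insertNth (α := fun _ => ℂ) (0 : ℂ) (Prod.snd X : Fin m → ℂ) : Fin (m + 1) → ℂ) i = 0}
  zero_mem' := by
    refine ⟨M.zero_mem, ?_⟩
    change (j.insertNth (α := fun _ => ℂ) (0 : ℂ) (0 : Fin m → ℂ) : Fin (m + 1) → ℂ) i = 0
    rcases Fin.eq_self_or_eq_succAbove j i with rfl | ⟨l, rfl⟩ <;> simp
  add_mem' := by
    rintro ⟨a, b⟩ ⟨a', b'⟩ ⟨h1, h2⟩ ⟨h3, h4⟩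
    refine ⟨M.add_mem h1 h3, ?_⟩
    change (j.insertNth (α := fun _ => ℂ) (0 : ℂ) (b + b' : Fin m → ℂ) : Fin (m + 1) → ℂ) i = 0
    rcases Fin.eq_self_or_eq_succAbove j i with rfl | ⟨l, rfl⟩
    · simp
    · simp only [Fin.insertNth_apply_succAbove] at h2 h4
      simp [h2, h4]
  smul_mem' := by
    rintro c ⟨a, b⟩ ⟨h1, h2⟩
    refine ⟨M.smul_mem c h1, ?_⟩
    change (j.insertNth (α := fun _ => ℂ) (0 : ℂ) (c • b : Fin m → ℂ) : Fin (m + 1) → ℂ) i = 0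
    rcases Fin.eq_self_or_eq_succAbove j i with rfl | ⟨l, rfl⟩
    · simp
    · simp only [Fin.insertNth_apply_succAbove] at h2
      simp [h2]

theorem mem_prolongDirection {j i : Fin (m + 1)} {M : Submodule ℂ (Coord m k)}
    {a : Coord m k} {b : Fin m → ℂ} : ((a, b) : Coord m (k + 1)) ∈ prolongDirection j i M ↔
      a ∈ M ∧ (j.insertNth (α := fun _ => ℂ) (0 : ℂ) b : Fin (m + 1) → ℂ) i = 0 := Iff.rfl

theorem insertNth_zero_sub (j : Fin (m + 1)) (u u' : Fin m → ℂ) (i : Fin (m + 1)) :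
    (j.insertNth (α := fun _ => ℂ) (0 : ℂ) (u - u') : Fin (m + 1) → ℂ) i =
      unitAt j u i - unitAt j u' i := by
  rcases Fin.eq_self_or_eq_succAbove j i with rfl | ⟨l, rfl⟩ <;> simp

theorem FlatIn.mem_prolongSet {w : ChartIndex m k} {N : Set (Point m k)}
    {M : Submodule ℂ (Coord m k)} {i : Fin (m + 1)} (h : FlatIn w N M i) {j : Fin (m + 1)}
    {P : Point m (k + 1)} (hP : P ∈ (tower m (k + 1)).src (w, j)) :
    P ∈ prolongSet (S := tower m k) N ↔
      proj P ∈ N ∧ unitAt j (ratio j (dir (S := tower m k) w P)) i = 0 := by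
  have hd : dir (S := tower m k) w P j ≠ 0 := src_dir (S := tower m k) hP
  have hp : proj P ∈ (tower m k).src w := fst_mem_src hP
  refine and_congr_right fun hN => ?_
  refine (line_subset_iff (w := w) (i := i) fun v hv =>
    h.mem_tangentsTo_of_mem_distr hp hN hv).trans ?_
  have h1 := congrFun (smul_unitAt_ratio hd) i
  rw [Pi.smul_apply, smul_eq_mul] at h1
  rw [← h1, mul_eq_zero, or_iff_right hd]

/-- A line of the distribution is tangent to `N` exactly when its `i`-th component is `0`, so
prolongation adds one linear equation on the new coordinates. A vector of the new distribution
projects into a line that is already tangent to `N`, so only the condition on its `i`-th component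
remains. -/
theorem FlatIn.prolong {w : ChartIndex m k} {N : Set (Point m k)}
    {M : Submodule ℂ (Coord m k)} {i : Fin (m + 1)} (h : FlatIn w N M i) (j : Fin (m + 1)) :
    FlatIn (m := m) (k := k + 1) (w, j) (prolongSet (S := tower m k) N)
      (prolongDirection j i M) i := by
  refine ⟨?_, ?_, ?_⟩
  · intro P hP Q hQ hPN
    replace hPN := (h.mem_prolongSet hP).1 hPN
    refine (h.mem_prolongSet hQ).trans ?_
    change _ ↔ (((tower m k).coord w (proj Q), ratio j (dir (S := tower m k) w Q)) :
        Coord m (k + 1)) - ((tower m k).coord w (proj P), ratio j (dir (S := tower m k) w P)) ∈ _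
    change _ ↔ (((tower m k).coord w (proj Q) - (tower m k).coord w (proj P),
      ratio j (dir (S := tower m k) w Q) - ratio j (dir (S := tower m k) w P)) :
        Coord m (k + 1)) ∈ _
    rw [mem_prolongDirection, insertNth_zero_sub, hPN.2, sub_zero,
      h.diff _ (fst_mem_src hP) _ (fst_mem_src hQ) hPN.1]
  · intro P hP hPN
    replace hPN := (h.mem_prolongSet hP).1 hPN
    exact Or.inr ⟨h.mem_crit _ (fst_mem_src hP) hPN.1, hPN.2⟩
  · intro P hP hPN θ
    replace hPN := (h.mem_prolongSet hP).1 hPN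
    change ((θ j • frame m k w ((tower m k).coord w (proj P))
      (unitAt j (ratio j (dir (S := tower m k) w P))), fun l => θ (j.succAbove l)) :
        Coord m (k + 1)) ∈ _ ↔ _
    rw [mem_prolongDirection]
    have h1 := (h.frame_mem _ (fst_mem_src hP) hPN.1 _).2 hPN.2
    rw [and_iff_right (M.smul_mem _ h1)]
    -- For `i = j` the normalized component is `1`: the prolonged set does not meet this chart.
    rcases Fin.eq_self_or_eq_succAbove j i with rfl | ⟨l, rfl⟩
    · have := hPN.2
      simp at this
    · simp

/-- The vertical direction. -/
def verticalDirection (m k : ℕ) : Submodule ℂ (Coord m (k + 1)) :=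
  LinearMap.ker (LinearMap.fst ℂ (Coord m k) (Fin m → ℂ))

theorem flatIn_fiber (q : Point m k) (w : ChartIndex m k) (j : Fin (m + 1)) :
    FlatIn (m := m) (k := k + 1) (w, j) {P | proj P = q} (verticalDirection m k) j := by
  have hT := tower_charted m k
  refine ⟨?_, ?_, ?_⟩
  · intro P hP Q hQ hPq
    change proj Q = q ↔ (tower m k).coord w (proj Q) - (tower m k).coord w (proj P) = 0
    rw [sub_eq_zero, (hT.inj w).eq_iff (fst_mem_src hQ) (fst_mem_src hP),
      show proj P = q from hPq]
  · intro P hP _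
    exact Or.inl rfl
  · intro P hP hPq θ
    change θ j • frame m k w ((tower m k).coord w (proj P))
      (unitAt j (ratio j (dir (S := tower m k) w P))) = 0 ↔ _
    rw [smul_eq_zero, or_iff_left]
    intro h0
    exact unitAt_ne_zero j _ (frame_injective w _ (h0.trans (map_zero _).symm))

theorem IsBabyMonster.exists_flatIn {N : Set (Point m k)} (hN : IsBabyMonster N)
    (w : ChartIndex m k) : ∃ M i, FlatIn w N M i := by
  induction hN with
  | fiber q => exact ⟨_, _, flatIn_fiber q w.1 w.2⟩
  | prolong N _ ih =>
    obtain ⟨M, i, h⟩ := ih w.1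
    exact ⟨_, _, h.prolong w.2⟩

/-- The recursion of `crit` mirrors that of `IsBabyMonster`: the new letter comes from the fibre
through the point, an old index from prolonging a set that the line is tangent to. -/
theorem exists_isBabyMonster : ∀ {k : ℕ} {w : ChartIndex m k} {p : Point m k} {i : Fin (m + 1)},
    p ∈ (tower m k).src w → i ∈ crit m k w ((tower m k).coord w p) →
    ∃ N M, IsBabyMonster N ∧ p ∈ N ∧ FlatIn w N M i
  | 0, _, _, _, _, h => h.elim
  | k + 1, (w, j), P, i, hP, hi => by
    rcases hi with rfl | ⟨hi, hu⟩
    · exact ⟨_, _, IsBabyMonster.fiber (proj P), rfl, flatIn_fiber _ w i⟩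
    · obtain ⟨N, M, h1, h2, h3⟩ := exists_isBabyMonster (fst_mem_src hP) hi
      exact ⟨_, _, h1.prolong, (h3.mem_prolongSet hP).2 ⟨h2, hu⟩, h3.prolong j⟩

theorem mem_criticalHyperplanes {w : ChartIndex m k} {p : Point m k}
    (hp : p ∈ (tower m k).src w) {H : Set (Coord m k)} :
    H ∈ criticalHyperplanes p ↔ ∃ i ∈ crit m k w ((tower m k).coord w p),
      H = {v | v ∈ (tower m k).distr p ∧ coframe m k w ((tower m k).inChart p w v) i = 0} := by
  constructor
  · rintro ⟨N, hN, hpN, rfl⟩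
    obtain ⟨M, i, h⟩ := hN.exists_flatIn w
    refine ⟨i, h.mem_crit p hp hpN, ?_⟩
    ext v
    exact and_congr_right fun hv => h.mem_tangentsTo_of_mem_distr hp hpN hv
  · rintro ⟨i, hi, rfl⟩
    obtain ⟨N, M, h1, h2, h3⟩ := exists_isBabyMonster hp hi
    refine ⟨N, h1, h2, ?_⟩
    ext v
    exact and_congr_right fun hv => (h3.mem_tangentsTo_of_mem_distr hp h2 hv).symm

theorem isCriticalDirection_span_iff {w : ChartIndex m k} {p : Point m k}
    (hp : p ∈ (tower m k).src w) {v : Coord m k} (hv : v ∈ (tower m k).distr p) :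
    IsCriticalDirection p (Submodule.span ℂ {v}) ↔
      ∃ i ∈ crit m k w ((tower m k).coord w p),
        coframe m k w ((tower m k).inChart p w v) i = 0 := by
  constructor
  · rintro ⟨H, hH, hvH⟩
    obtain ⟨i, hi, rfl⟩ := (mem_criticalHyperplanes hp).1 hH
    exact ⟨i, hi, (hvH (Submodule.mem_span_singleton_self v)).2⟩
  · rintro ⟨i, hi, h⟩
    refine ⟨_, (mem_criticalHyperplanes hp).2 ⟨i, hi, rfl⟩, ?_⟩
    intro v' hv'
    obtain ⟨c, rfl⟩ := Submodule.mem_span_singleton.1 hv'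
    refine ⟨Submodule.smul_mem _ c hv, ?_⟩
    rw [Charted.inChart_smul, coframe_smul, Pi.smul_apply, h, smul_zero]

theorem isCritical_iff {w : ChartIndex m k} {P : Point m (k + 1)}
    (hp : proj P ∈ (tower m k).src w) :
    IsCritical P ↔ ∃ i ∈ crit m k w ((tower m k).coord w (proj P)),
      dir (S := tower m k) w P i = 0 := by
  constructor
  · rintro ⟨H, hH, hvH⟩
    obtain ⟨i, hi, rfl⟩ := (mem_criticalHyperplanes hp).1 hH
    exact ⟨i, hi, (line_subset_iff (w := w) (i := i) fun v hv => and_iff_right hv).1 hvH⟩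
  · rintro ⟨i, hi, h⟩
    exact ⟨_, (mem_criticalHyperplanes hp).2 ⟨i, hi, rfl⟩,
      (line_subset_iff (w := w) (i := i) fun v hv => and_iff_right hv).2 h⟩

theorem mem_verticalSpace_iff {w : ChartIndex m k} {j : Fin (m + 1)} {p : Point m (k + 1)}
    (hp : p ∈ (tower m (k + 1)).src (w, j)) {v : Coord m (k + 1)}
    (hv : v ∈ (tower m (k + 1)).distr p) :
    v ∈ verticalSpace p ↔
      coframe m (k + 1) (w, j) ((tower m (k + 1)).inChart p (w, j) v) j = 0 := by
  have hT := tower_charted m (k + 1)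
  rw [← (flatIn_fiber (proj p) w j).mem_tangentsTo_of_mem_distr hp rfl hv]
  have h1 := (flatIn_fiber (proj p) ((tower m (k + 1)).idx p).1
    ((tower m (k + 1)).idx p).2).mem_tangentsTo (p := p) (v := v) (hT.mem_idx p) rfl
  rw [h1]
  have h2 : (tower m (k + 1)).inChart p
      (((tower m (k + 1)).idx p).1, ((tower m (k + 1)).idx p).2) v = v := hT.inChart_idx p v
  rw [h2]
  rfl

theorem verticalSpace_le_distr (p : Point m (k + 1)) :
    verticalSpace p ≤ (tower m (k + 1)).distr p := by
  intro v hv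
  change Prod.fst v ∈ Stage.line (S := tower m k) p
  have h0 : Prod.fst v = 0 := hv
  rw [h0]
  exact Submodule.zero_mem _

theorem isVertical_iff {w : ChartIndex m k} {j : Fin (m + 1)} {P : Point m (k + 2)}
    (hp : proj P ∈ (tower m (k + 1)).src (w, j)) :
    IsVertical P ↔ dir (S := tower m (k + 1)) (w, j) P j = 0 :=
  line_subset_iff (H := (verticalSpace (proj P) : Set (Coord m (k + 1))))
    (k := k + 1) (w := (w, j)) (i := j)
    fun _ hv => mem_verticalSpace_iff hp hv

theorem isL_iff {w : ChartIndex m k} {j : Fin (m + 1)} {P : Point m (k + 2)}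
    (hp : proj P ∈ (tower m (k + 1)).src (w, j)) :
    IsL P ↔ dir (S := tower m (k + 1)) (w, j) P j = 0 ∧
      ∃ i ∈ crit m (k + 1) (w, j) ((tower m (k + 1)).coord (w, j) (proj P)), i ≠ j ∧
        dir (S := tower m (k + 1)) (w, j) P i = 0 := by
  have hT := tower_charted m (k + 1)
  refine and_congr (isVertical_iff hp) ?_
  have hV : (verticalSpace (proj P) : Set (Coord m (k + 1))) =
      {v | v ∈ (tower m (k + 1)).distr (proj P) ∧
        coframe m (k + 1) (w, j) ((tower m (k + 1)).inChart (proj P) (w, j) v) j = 0} := by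
    ext v
    refine ⟨fun hv => ?_, fun hv => (mem_verticalSpace_iff hp hv.1).2 hv.2⟩
    have hvd := verticalSpace_le_distr _ hv
    exact ⟨hvd, (mem_verticalSpace_iff hp hvd).1 hv⟩
  constructor
  · rintro ⟨H, hH, hne, hvH⟩
    obtain ⟨i, hi, rfl⟩ := (mem_criticalHyperplanes hp).1 hH
    refine ⟨i, hi, ?_,
      (line_subset_iff (k := k + 1) (w := (w, j)) (i := i) fun v hv => and_iff_right hv).1 hvH⟩
    rintro rfl
    exact hne hV.symm
  · rintro ⟨i, hi, hij, h⟩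
    refine ⟨_, (mem_criticalHyperplanes hp).2 ⟨i, hi, rfl⟩, ?_,
      (line_subset_iff (k := k + 1) (w := (w, j)) (i := i) fun v hv => and_iff_right hv).2 h⟩
    rw [hV]
    intro heq
    -- The distribution vector with components `Pi.single j 1` satisfies `θ_i = 0` but is not
    -- vertical, which separates the two hyperplanes.
    set θ : Fin (m + 1) → ℂ := Pi.single j 1
    set v := fderiv ℂ ((tower m (k + 1)).localRep id (w, j) ((tower m (k + 1)).idx (proj P)))
      ((tower m (k + 1)).coord (w, j) (proj P))
      (frame m (k + 1) (w, j) ((tower m (k + 1)).coord (w, j) (proj P)) θ)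
    have hv : (tower m (k + 1)).inChart (proj P) (w, j) v =
        frame m (k + 1) (w, j) ((tower m (k + 1)).coord (w, j) (proj P)) θ :=
      hT.inChart_fderiv_trans hp _
    have hvd : v ∈ (tower m (k + 1)).distr (proj P) := (hT.mem_distr_iff hp).2 ⟨θ, hv.symm⟩
    have hcf : ∀ a, coframe m (k + 1) (w, j) ((tower m (k + 1)).inChart (proj P) (w, j) v) a =
        θ a := fun a => (congrFun (congrArg _ hv) a).trans
      (congrFun (coframe_frame m (k + 1) (w, j) _ θ) a)
    have h1 : v ∈ {v | v ∈ (tower m (k + 1)).distr (proj P) ∧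
        coframe m (k + 1) (w, j) ((tower m (k + 1)).inChart (proj P) (w, j) v) i = 0} :=
      ⟨hvd, (hcf i).trans (Pi.single_eq_of_ne hij 1)⟩
    rw [heq] at h1
    have h2 := (hcf j).symm.trans h1.2
    simp [θ] at h2

theorem not_isVertical_one (P : Point m 1) : ¬ IsVertical P := by
  intro h
  have h1 : lineOf P = ⊥ := le_bot_iff.1 h
  have h2 : lineOf P = Submodule.span ℂ {((P.2.rep : (tower m 0).distr P.1) : Coord m 0)} :=
    line_eq_span (S := tower m 0) P
  rw [h2, Submodule.span_singleton_eq_bot] at h1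
  exact P.2.rep_nonzero (Subtype.ext h1)

theorem not_isCritical_one (P : Point m 1) : ¬ IsCritical P := by
  rw [isCritical_iff (w := ()) (k := 0) trivial]
  rintro ⟨i, hi, -⟩
  exact hi

end

section

open Stage

namespace Stage

variable {m k : ℕ} {S : Stage m k}

/-! ## Prolongation of symmetries -/

/-- On the open set `Ω` the map `Φ` is an analytic immersion that respects the distribution. -/
structure SymOn (hS : S.Charted) (Φ : S.Pt → S.Pt) (Ω : Set S.Pt) : Prop where
  sym : ∀ p ∈ Ω, ∀ w w', p ∈ S.src w → Φ p ∈ S.src w' →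
    SymAt w w' (S.localRep Φ w w') (S.coord w p)
  maps : ∀ p ∈ Ω, ∀ w w', p ∈ S.src w → Φ p ∈ S.src w' →
    ∀ᶠ y in 𝓝 (S.coord w p), hS.point w y ∈ Ω ∧ Φ (hS.point w y) ∈ S.src w'

namespace SymOn

variable {hS : S.Charted} {Φ : S.Pt → S.Pt} {Ω : Set S.Pt} (h : SymOn hS Φ Ω)
include h

/-- `tangentMap` is formed in the preferred charts. The representation from the preferred chart at
`p` to `w'` factors through `w` and also through the preferred chart at `Φ p`; the two chain rules
agree. -/
theorem inChart_tangentMap {p : S.Pt} (hp : p ∈ Ω) {w w' : ChartIndex m k} (hw : p ∈ S.src w)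
    (hw' : Φ p ∈ S.src w') (v : Coord m k) :
    S.inChart (Φ p) w' (S.tangentMap Φ p v) =
      fderiv ℂ (S.localRep Φ w w') (S.coord w p) (S.inChart p w v) := by
  have h1 : S.localRep Φ (S.idx p) w' =ᶠ[𝓝 (S.coord (S.idx p) p)]
      S.localRep Φ w w' ∘ S.localRep id (S.idx p) w := by
    filter_upwards [hS.overlap_mem_nhds (hS.mem_idx p) hw] with y hy
    obtain ⟨q, ⟨hq, hq'⟩, rfl⟩ := hy
    rw [Function.comp_apply, hS.trans_apply _ hq, hS.localRep_apply _ _ hq,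
      hS.localRep_apply _ _ hq']
  have h2 : S.localRep Φ (S.idx p) w' =ᶠ[𝓝 (S.coord (S.idx p) p)]
      S.localRep id (S.idx (Φ p)) w' ∘ S.localRep Φ (S.idx p) (S.idx (Φ p)) := by
    filter_upwards [h.maps p hp _ _ (hS.mem_idx p) (hS.mem_idx (Φ p))] with y hy
    have h3 := hS.point_mem (S.idx p) y
    rw [← hS.coord_point (S.idx p) y, Function.comp_apply, hS.localRep_apply _ _ h3,
      hS.localRep_apply _ _ h3, hS.trans_apply _ hy.2]
  have e1 : HasFDerivAt (S.localRep Φ w w') (fderiv ℂ (S.localRep Φ w w') (S.coord w p))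
      (S.localRep id (S.idx p) w (S.coord (S.idx p) p)) := by
    rw [hS.trans_apply _ (hS.mem_idx p)]
    exact (h.sym p hp w w' hw hw').analytic.differentiableAt.hasFDerivAt
  have e2 := e1.comp _
    (hS.sym (S.idx p) w p (hS.mem_idx p) hw).analytic.differentiableAt.hasFDerivAt
  have e3 : HasFDerivAt (S.localRep id (S.idx (Φ p)) w')
      (fderiv ℂ (S.localRep id (S.idx (Φ p)) w') (S.coord (S.idx (Φ p)) (Φ p)))
      (S.localRep Φ (S.idx p) (S.idx (Φ p)) (S.coord (S.idx p) p)) := by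
    rw [hS.localRep_apply _ _ (hS.mem_idx p)]
    exact (hS.sym _ _ _ (hS.mem_idx (Φ p)) hw').analytic.differentiableAt.hasFDerivAt
  have e4 := e3.comp _ (h.sym p hp _ _ (hS.mem_idx p)
    (hS.mem_idx (Φ p))).analytic.differentiableAt.hasFDerivAt
  have e5 := (e4.congr_of_eventuallyEq h2).unique (e2.congr_of_eventuallyEq h1)
  exact DFunLike.congr_fun e5 v

/-- Over `Ω` the image of the line is a line of the distribution, so the condition in `prolongMap`
holds and its default value is never taken. -/
theorem prolongMap_spec {P : S.prolong.Pt} (hP : P.1 ∈ Ω) :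
    (prolongMap Φ P).1 = Φ P.1 ∧
      line (prolongMap Φ P) = Submodule.span ℂ {S.tangentMap Φ P.1 P.2.rep} := by
  have hs := h.sym P.1 hP _ _ (hS.mem_idx _) (hS.mem_idx _)
  have hD : S.tangentMap Φ P.1 P.2.rep ∈ S.distr (Φ P.1) := by
    have h1 : ((P.2.rep : S.distr P.1) : Coord m k) ∈
        LinearMap.range (frame m k (S.idx P.1) (S.coord (S.idx P.1) P.1)) := by
      rw [← hS.distr]
      exact P.2.rep.2
    obtain ⟨θ, hθ⟩ := h1
    rw [hS.distr, ← hS.localRep_apply Φ _ (hS.mem_idx P.1), ← hθ]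
    exact hs.distr θ
  have h0 : S.tangentMap Φ P.1 P.2.rep ≠ 0 := by
    intro h0
    exact P.2.rep_nonzero (Subtype.ext (hs.injective (h0.trans (map_zero _).symm)))
  have hmap : (line P).map (S.tangentMap Φ P.1 : Coord m k →ₗ[ℂ] Coord m k) =
      Submodule.span ℂ {S.tangentMap Φ P.1 P.2.rep} := by
    rw [line_eq_span, Submodule.map_span, Set.image_singleton]
    rfl
  have hex : ∃ ℓ' : ℙ ℂ (S.distr (Φ P.1)), ℓ'.submodule.map (S.distr (Φ P.1)).subtype =
      (line P).map (S.tangentMap Φ P.1 : Coord m k →ₗ[ℂ] Coord m k) := by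
    refine ⟨Projectivization.mk ℂ (⟨_, hD⟩ : S.distr (Φ P.1))
      (fun h => h0 (congrArg Subtype.val h)), ?_⟩
    rw [Projectivization.submodule_mk, Submodule.map_span, hmap]
    simp
  have hval : prolongMap Φ P = ⟨Φ P.1, hex.choose⟩ := dif_pos hex
  rw [hval]
  exact ⟨rfl, hex.choose_spec.trans hmap⟩

theorem dir_prolongMap {P : S.prolong.Pt} (hP : P.1 ∈ Ω) {w w' : ChartIndex m k}
    {i : Fin (m + 1)} (hw : P ∈ S.prolong.src (w, i)) (hw' : Φ P.1 ∈ S.src w') :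
    ∃ a : ℂ, a ≠ 0 ∧ pushDir w w' i (S.localRep Φ w w') (S.prolong.coord (w, i) P) =
      a • dir w' (prolongMap Φ P) := by
  obtain ⟨h1, h2⟩ := h.prolongMap_spec hP
  obtain ⟨c, hc, h3⟩ := Charted.exists_dir_of_span (w := w') h2
  rw [h1, h.inChart_tangentMap hP (src_fst hw) hw', ← hS.frame_dir (src_fst hw)] at h3
  have hd := src_dir hw
  refine ⟨(dir w P i)⁻¹ * c, mul_ne_zero (inv_ne_zero hd) hc, ?_⟩
  rw [mul_smul, ← h3, eq_inv_smul_iff₀ hd]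
  conv_rhs => rw [← smul_unitAt_ratio hd, map_smul, map_smul, coframe_smul]
  rfl

theorem coord_prolongMap {P : S.prolong.Pt} (hP : P.1 ∈ Ω) {w w' : ChartIndex m k}
    {i : Fin (m + 1)} (i' : Fin (m + 1)) (hw : P ∈ S.prolong.src (w, i))
    (hw' : Φ P.1 ∈ S.src w') :
    S.prolong.coord (w', i') (prolongMap Φ P) =
      prolongRep w w' i i' (S.localRep Φ w w') (S.prolong.coord (w, i) P) := by
  obtain ⟨a, ha, h1⟩ := h.dir_prolongMap hP hw hw'
  refine Prod.ext ?_ ?_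
  · change S.coord w' (prolongMap Φ P).1 = S.localRep Φ w w' (S.coord w P.1)
    rw [(h.prolongMap_spec hP).1, hS.localRep_apply _ _ (src_fst hw)]
  · change ratio i' (dir w' (prolongMap Φ P)) = ratio i' _
    rw [h1, ratio_smul _ ha]

theorem eventually_prolong {P : S.prolong.Pt} (hP : P.1 ∈ Ω) {w w' : ChartIndex m k}
    {i i' : Fin (m + 1)} (hw : P ∈ S.prolong.src (w, i))
    (hw' : prolongMap Φ P ∈ S.prolong.src (w', i')) :
    pushDir w w' i (S.localRep Φ w w') (S.prolong.coord (w, i) P) i' ≠ 0 ∧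
    ∀ᶠ Y in 𝓝 (S.prolong.coord (w, i) P), (hS.prolong.point (w, i) Y).1 ∈ Ω ∧
      Φ (hS.prolong.point (w, i) Y).1 ∈ S.src w' ∧
      pushDir w w' i (S.localRep Φ w w') Y i' ≠ 0 := by
  have h1 : Φ P.1 ∈ S.src w' := by
    rw [← (h.prolongMap_spec hP).1]
    exact src_fst hw'
  have hs := h.sym P.1 hP w w' (src_fst hw) h1
  have hne : pushDir w w' i (S.localRep Φ w w') (S.prolong.coord (w, i) P) i' ≠ 0 := by
    obtain ⟨a, ha, h2⟩ := h.dir_prolongMap hP hw h1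
    rw [h2, Pi.smul_apply, smul_eq_mul]
    exact mul_ne_zero ha (src_dir hw')
  refine ⟨hne, ?_⟩
  have hcont := (analyticAt_pushDir w w' i (X := S.prolong.coord (w, i) P)
    hs.analytic).continuousAt
  have h3 : ∀ᶠ Y in 𝓝 (S.prolong.coord (w, i) P),
      pushDir w w' i (S.localRep Φ w w') Y i' ≠ 0 :=
    ((continuous_apply i').continuousAt.comp hcont).eventually_ne hne
  have h4 : ∀ᶠ Y : Coord m (k + 1) in 𝓝 (S.prolong.coord (w, i) P),
      hS.point w (Prod.fst Y) ∈ Ω ∧ Φ (hS.point w (Prod.fst Y)) ∈ S.src w' :=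
    (analyticAt_fst (S.prolong.coord (w, i) P)).continuousAt.eventually
      (h.maps P.1 hP w w' (src_fst hw) h1)
  filter_upwards [h3, h4] with Y hY hY'
  rw [hS.point_prolong_fst]
  exact ⟨hY'.1, hY'.2, hY⟩

theorem prolong : SymOn hS.prolong (prolongMap Φ) {P | P.1 ∈ Ω} where
  sym := by
    rintro P hP ⟨w, i⟩ ⟨w', i'⟩ hw hw'
    obtain ⟨h1, h2⟩ := h.eventually_prolong hP hw hw'
    have h3 : Φ P.1 ∈ S.src w' := by
      rw [← (h.prolongMap_spec hP).1]
      exact src_fst hw'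
    refine (SymAt.prolong (X := S.prolong.coord (w, i) P)
      (h.sym P.1 hP w w' (src_fst hw) h3) h1).congr ?_
    filter_upwards [h2] with Y hY
    have h4 := hS.prolong.point_mem (w, i) Y
    refine Eq.trans (congrArg _ (hS.prolong.coord_point (w, i) Y).symm) ?_
    refine (hS.prolong.localRep_apply _ _ h4).trans ((h.coord_prolongMap hY.1 i' h4 hY.2.1).trans ?_)
    exact congrArg _ (hS.prolong.coord_point (w, i) Y)
  maps := by
    rintro P hP ⟨w, i⟩ ⟨w', i'⟩ hw hw'
    obtain ⟨h1, h2⟩ := h.eventually_prolong hP hw hw'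
    filter_upwards [h2] with Y hY
    have h4 := hS.prolong.point_mem (w, i) Y
    refine ⟨hY.1, ?_, ?_⟩
    · change (prolongMap Φ (hS.prolong.point (w, i) Y)).1 ∈ S.src w'
      rw [(h.prolongMap_spec hY.1).1]
      exact hY.2.1
    · change dir w' (prolongMap Φ (hS.prolong.point (w, i) Y)) i' ≠ 0
      obtain ⟨a, ha, h5⟩ := h.dir_prolongMap hY.1 h4 hY.2.1
      have h6 := hY.2.2
      intro h7
      rw [← hS.prolong.coord_point (w, i) Y, h5, Pi.smul_apply, h7, smul_zero] at h6
      exact h6 rfl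

theorem analyticIn_comp {c : ℂ → S.Pt} {w w' : ChartIndex m k} (hc : AnalyticIn w c)
    (h0 : c 0 ∈ Ω) (hw' : Φ (c 0) ∈ S.src w') :
    AnalyticIn w' (fun t => Φ (c t)) ∧ ∀ᶠ t in 𝓝 0, c t ∈ Ω := by
  have h1 := hc.2.continuousAt.eventually (h.maps _ h0 w w' hc.mem hw')
  refine ⟨⟨?_, ?_⟩, ?_⟩
  · filter_upwards [h1, hc.1] with t ht ht'
    rw [hS.point_coord ht'] at ht
    exact ht.2
  · have h2 := AnalyticAt.fun_comp (f := fun t => S.coord w (c t))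
      (h.sym _ h0 w w' hc.mem hw').analytic hc.2
    refine h2.congr ?_
    filter_upwards [hc.1] with t ht
    exact hS.localRep_apply Φ w' ht
  · filter_upwards [h1, hc.1] with t ht ht'
    rw [hS.point_coord ht'] at ht
    exact ht.1

/-- The image curve has velocity `dΦ` of the old velocity, which matches the lines off `0`. The
limit at `0` exists because `prolongMap Φ` is itself analytic in charts. -/
theorem isProlongationOf_comp {c : ℂ → S.Pt} {c' : ℂ → S.prolong.Pt} {w : ChartIndex m k}
    (hc : AnalyticIn w c) (h0 : c 0 ∈ Ω) (hcc : IsProlongationOf c c') :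
    IsProlongationOf (fun t => Φ (c t)) (fun t => prolongMap Φ (c' t)) := by
  have hw' := hS.mem_idx (Φ (c 0))
  obtain ⟨hA, hΩ⟩ := h.analyticIn_comp hc h0 hw'
  have hc0 : (c' 0).1 = c 0 := hcc.1.self_of_nhds
  obtain ⟨i, hi⟩ : ∃ i, dir w (c' 0) i ≠ 0 := by
    by_contra! h
    exact hS.dir_ne_zero (P := c' 0) (hc0 ▸ hc.mem) (funext h)
  have hc' := (hcc.analyticIn hS (i := i) hc ⟨hc0 ▸ hc.mem, hi⟩).1
  refine ⟨?_, ?_, ?_⟩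
  · filter_upwards [hcc.1, hΩ] with t ht hΩt
    rw [(h.prolongMap_spec (P := c' t) (ht ▸ hΩt)).1, ht]
  · filter_upwards [eventually_nhdsNE_of_nhds hcc.1, eventually_nhdsNE_of_nhds hΩ, hcc.2.1,
      eventually_nhdsNE_of_nhds hc.1.eventually_nhds,
      eventually_nhdsNE_of_nhds hc.2.eventually_analyticAt,
      eventually_nhdsNE_of_nhds (hA.inChart_velocity hS),
      eventually_nhdsNE_of_nhds hA.1] with t h1 h2 h3 h4 h5 h6 h7
    have h8 : line (prolongMap Φ (c' t)) =
        (line (c' t)).map (S.tangentMap Φ (c' t).1 : Coord m k →ₗ[ℂ] Coord m k) := by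
      rw [(h.prolongMap_spec (P := c' t) (h1 ▸ h2)).2, line_eq_span, Submodule.map_span,
        Set.image_singleton]
      rfl
    rw [h8, h3, Submodule.map_span, Set.image_singleton]
    congr 2
    change S.tangentMap Φ (c' t).1 (S.velocity c t) = _
    rw [h1]
    apply hS.inChart_injective h7
    rw [h6, h.inChart_tangentMap h2 h4.self_of_nhds h7,
      hS.inChart_velocity h4 h5.differentiableAt]
    have e1 := (h.sym _ h2 w _ h4.self_of_nhds h7).analytic.differentiableAt.hasFDerivAt
    have e2 := HasFDerivAt.comp_hasDerivAt (f := fun s => S.coord w (c s)) t e1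
      h5.differentiableAt.hasDerivAt
    refine (HasDerivAt.deriv (e2.congr_of_eventuallyEq ?_)).symm
    filter_upwards [h4] with s hs
    exact (hS.localRep_apply Φ _ hs).symm
  · have hB := (h.prolong.analyticIn_comp hc' (show (c' 0).1 ∈ Ω from hc0 ▸ h0)
      (hS.prolong.mem_idx _)).1
    have h2 := hB.2.continuousAt.tendsto
    exact (hS.prolong.tendsto_nhds_iff hB.mem).2
      ⟨eventually_nhdsNE_of_nhds hB.1, h2.mono_left nhdsWithin_le_nhds⟩

end SymOn

end Stage

variable {m k : ℕ}

theorem IsAnalyticDiffeo.fderiv_injective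
    {φ : OpenPartialHomeomorph (Fin (m + 1) → ℂ) (Fin (m + 1) → ℂ)} (hφ : IsAnalyticDiffeo φ)
    {x : Fin (m + 1) → ℂ} (hx : x ∈ φ.source) : Function.Injective (fderiv ℂ φ x) := by
  have h1 : (φ.symm ∘ φ) =ᶠ[𝓝 x] id := by
    filter_upwards [φ.open_source.mem_nhds hx] with y hy
    exact φ.left_inv hy
  have h2 : HasFDerivAt φ.symm (fderiv ℂ φ.symm (φ x)) (φ x) :=
    (hφ.2 _ (φ.map_source hx)).differentiableAt.hasFDerivAt
  have h3 : HasFDerivAt φ (fderiv ℂ φ x) x := (hφ.1 x hx).differentiableAt.hasFDerivAt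
  have h4 := ((h2.comp x h3).congr_of_eventuallyEq h1.symm).unique (hasFDerivAt_id x)
  intro a b hab
  have h5 := congrArg (fderiv ℂ φ.symm (φ x)) hab
  have h6 := fun v => DFunLike.congr_fun h4 v
  simpa using (h6 a).symm.trans (h5.trans (h6 b))

theorem symOn_prolongation {φ : OpenPartialHomeomorph (Fin (m + 1) → ℂ) (Fin (m + 1) → ℂ)}
    (hφ : IsAnalyticDiffeo φ) : ∀ k, SymOn (tower_charted m k) (prolongation φ k)
      {p : Point m k | base p ∈ φ.source}
  | k + 1 => (symOn_prolongation hφ k).prolong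
  | 0 => by
    have hrep : ∀ w w', (tower m 0).localRep φ w w' = φ := by
      intro w w'
      funext y
      exact (tower_charted m 0).localRep_apply φ w' (w := w) (p := y) trivial
    refine ⟨fun p hp w w' _ _ => ?_, fun p hp w w' _ _ => ?_⟩
    · change SymAt w w' ((tower m 0).localRep φ w w') p
      rw [hrep]
      refine ⟨hφ.1 p hp, ?_, fun θ => ⟨_, rfl⟩⟩
      exact hφ.fderiv_injective hp
    · have hpt : ∀ y : Coord m 0, (tower_charted m 0).point w y = y :=
        fun y => (tower_charted m 0).point_coord (w := w) (p := y) trivial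
      have hs : φ.source ∈ 𝓝 ((tower m 0).coord w p : Coord m 0) :=
        φ.open_source.mem_nhds hp
      filter_upwards [hs] with y hy
      exact ⟨by rw [hpt]; exact hy, trivial⟩

/-- The `k`-th prolongation of the curve germ `γ` passes through `p` at `t = 0`. -/
def PassesThrough (γ : ℂ → Fin (m + 1) → ℂ) (p : Point m k) : Prop :=
  AnalyticAt ℂ γ 0 ∧ ∃ c : ∀ j, ℂ → Point m j, c 0 = γ ∧
    (∀ j < k, IsProlongationOf (S := tower m j) (c j) (c (j + 1))) ∧ c k 0 = p

theorem exists_analyticIn {γ : ℂ → Fin (m + 1) → ℂ} (hγ : AnalyticAt ℂ γ 0)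
    {c : ∀ j, ℂ → Point m j} (h0 : c 0 = γ) :
    ∀ {k : ℕ}, (∀ j < k, IsProlongationOf (S := tower m j) (c j) (c (j + 1))) →
      ∃ w, AnalyticIn (S := tower m k) w (c k)
  | 0, _ => ⟨(), Eventually.of_forall fun _ => trivial, by subst h0; exact hγ⟩
  | k + 1, h => by
    obtain ⟨w, hw⟩ := exists_analyticIn hγ h0 fun j hj => h j (hj.trans (Nat.lt_succ_self k))
    have hT := tower_charted m k
    have hcc := h k (Nat.lt_succ_self k)
    have hm : proj (c (k + 1) 0) ∈ (tower m k).src w := by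
      have h2 : proj (c (k + 1) 0) = c k 0 := hcc.1.self_of_nhds
      rw [h2]
      exact hw.mem
    obtain ⟨i, hi⟩ : ∃ i, dir (S := tower m k) w (c (k + 1) 0) i ≠ 0 := by
      by_contra! h
      exact hT.dir_ne_zero hm (funext h)
    exact ⟨(w, i), (hcc.analyticIn hT (i := i) hw ⟨hm, hi⟩).1⟩

/-- This allows points to be identified through a germ they share; the orbit statements rest on it.
-/
theorem PassesThrough.unique {γ : ℂ → Fin (m + 1) → ℂ} {p q : Point m k}
    (hp : PassesThrough γ p) (hq : PassesThrough γ q) : p = q := by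
  obtain ⟨-, c, hc0, hc, rfl⟩ := hp
  obtain ⟨-, d, hd0, hd, rfl⟩ := hq
  have key : ∀ j ≤ k, c j =ᶠ[𝓝 0] d j := by
    intro j
    induction j with
    | zero =>
      intro _
      rw [hc0, hd0]
      exact EventuallyEq.rfl
    | succ j ih =>
      intro hj
      exact (hc j hj).eventuallyEq (tower_charted m j) (hd j hj) (ih (Nat.le_of_succ_le hj))
  exact (key k le_rfl).self_of_nhds

theorem base_eq_of_isProlongationOf {c : ∀ j, ℂ → Point m j} :
    ∀ {k : ℕ}, (∀ j < k, IsProlongationOf (S := tower m j) (c j) (c (j + 1))) →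
      base (c k 0) = c 0 0
  | 0, _ => rfl
  | k + 1, h => by
    have h1 : proj (c (k + 1) 0) = c k 0 := (h k (Nat.lt_succ_self k)).1.self_of_nhds
    change base (proj (c (k + 1) 0)) = _
    rw [h1, base_eq_of_isProlongationOf fun j hj => h j (hj.trans (Nat.lt_succ_self k))]

theorem PassesThrough.base_eq {γ : ℂ → Fin (m + 1) → ℂ} {p : Point m k}
    (hp : PassesThrough γ p) : base p = γ 0 := by
  obtain ⟨-, c, rfl, hc, rfl⟩ := hp
  exact base_eq_of_isProlongationOf hc

theorem PassesThrough.map {γ : ℂ → Fin (m + 1) → ℂ} {p : Point m k}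
    (hp : PassesThrough γ p) {φ : OpenPartialHomeomorph (Fin (m + 1) → ℂ) (Fin (m + 1) → ℂ)}
    (hφ : IsAnalyticDiffeo φ) (h0 : γ 0 ∈ φ.source) :
    PassesThrough (fun t => φ (γ t)) (prolongation φ k p) := by
  obtain ⟨hγ, c, rfl, hc, rfl⟩ := hp
  refine ⟨(hφ.1 _ h0).fun_comp hγ, fun j t => prolongation φ j (c j t), rfl, ?_, rfl⟩
  intro j hj
  have hcj : ∀ i < j, IsProlongationOf (S := tower m i) (c i) (c (i + 1)) :=
    fun i hi => hc i (hi.trans hj)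
  obtain ⟨w, hw⟩ := exists_analyticIn hγ rfl hcj
  refine (symOn_prolongation hφ j).isProlongationOf_comp hw ?_ (hc j hj)
  change base (c j 0) ∈ φ.source
  rw [base_eq_of_isProlongationOf hcj]
  exact h0

end

section

open Stage

variable {m k : ℕ}

/-! ## Prolonged curves in charts -/

/-- The curve `X` in the chart `w` is the prolongation of `γ`. -/
def IsLift (γ : ℂ → Fin (m + 1) → ℂ) : ∀ k, ChartIndex m k → (ℂ → Coord m k) → Prop
  | 0, _, X => ∀ᶠ t in 𝓝 0, X t = γ t
  | k + 1, (w, i), X => IsLift γ k w (fun t => Prod.fst (X t)) ∧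
      IsLiftOf w i (fun t => Prod.fst (X t)) (fun t => Prod.snd (X t))

theorem IsLiftOf.congr {w : ChartIndex m k} {i : Fin (m + 1)} {X Y : ℂ → Coord m k}
    {u v : ℂ → Fin m → ℂ} (h : IsLiftOf w i X u) (hXY : ∀ᶠ t in 𝓝 0, X t = Y t)
    (huv : ∀ᶠ t in 𝓝 0, u t = v t) : IsLiftOf w i Y v := by
  filter_upwards [h, eventually_nhdsNE_of_nhds hXY.eventually_nhds,
    eventually_nhdsNE_of_nhds huv] with t h1 h2 h3
  rwa [EventuallyEq.deriv_eq h2, h3] at h1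

theorem IsLift.congr {γ : ℂ → Fin (m + 1) → ℂ} : ∀ {k : ℕ} {w : ChartIndex m k}
    {X Y : ℂ → Coord m k}, IsLift γ k w X → (∀ᶠ t in 𝓝 0, X t = Y t) → IsLift γ k w Y
  | 0, _, _, _, h, hXY => by
    filter_upwards [h, hXY] with t h1 h2
    exact h2.symm.trans h1
  | k + 1, (w, i), X, Y, h, hXY =>
    ⟨h.1.congr (hXY.mono fun t ht => congrArg Prod.fst ht),
      IsLiftOf.congr h.2 (hXY.mono fun t ht => congrArg Prod.fst ht)
        (hXY.mono fun t ht => congrArg Prod.snd ht)⟩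

theorem analyticAt_fst_comp {X : ℂ → Coord m (k + 1)} {t : ℂ} (h : AnalyticAt ℂ X t) :
    AnalyticAt ℂ (fun s => (Prod.fst (X s) : Coord m k)) t :=
  AnalyticAt.fun_comp (g := fun Y : Coord m (k + 1) => (Prod.fst Y : Coord m k))
    (analyticAt_fst _) h

theorem analyticAt_snd_comp {X : ℂ → Coord m (k + 1)} {t : ℂ} (h : AnalyticAt ℂ X t) :
    AnalyticAt ℂ (fun s => (Prod.snd (X s) : Fin m → ℂ)) t :=
  AnalyticAt.fun_comp (g := fun Y : Coord m (k + 1) => (Prod.snd Y : Fin m → ℂ))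
    (analyticAt_snd _) h

theorem deriv_coord_succ {X : ℂ → Coord m (k + 1)} {t : ℂ} (h : AnalyticAt ℂ X t) :
    deriv X t = (deriv (fun s => (Prod.fst (X s) : Coord m k)) t,
      deriv (fun s => (Prod.snd (X s) : Fin m → ℂ)) t) :=
  HasDerivAt.deriv (HasDerivAt.prodMk (F := Coord m k) (G := Fin m → ℂ)
    (analyticAt_fst_comp h).differentiableAt.hasDerivAt
    (analyticAt_snd_comp h).differentiableAt.hasDerivAt)

theorem IsLiftOf.eventually_eq {w : ChartIndex m k} {i : Fin (m + 1)} {X : ℂ → Coord m k}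
    {u : ℂ → Fin m → ℂ} (h : IsLiftOf w i X u) (hX : AnalyticAt ℂ X 0) (hu : AnalyticAt ℂ u 0) :
    ∀ᶠ t in 𝓝 0, coframe m k w (deriv X t) = coframe m k w (deriv X t) i • unitAt i (u t) := by
  have h1 : AnalyticAt ℂ (fun t => coframe m k w (deriv X t)) 0 :=
    ((coframeCLM m k w).analyticAt _).fun_comp hX.deriv
  have h2 : AnalyticAt ℂ (fun t => coframe m k w (deriv X t) i) 0 := (analyticAt_pi_iff.1 h1) i
  have h3 : AnalyticAt ℂ (fun t => unitAt i (u t)) 0 := (analyticAt_unitAt i _).fun_comp hu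
  have h4 : (fun t => coframe m k w (deriv X t)) =ᶠ[𝓝[≠] 0]
      fun t => coframe m k w (deriv X t) i • unitAt i (u t) := h.mono fun t ht => ht.2
  exact (ContinuousAt.eventuallyEq_nhds_iff_eventuallyEq_nhdsNE h1.continuousAt
    (h2.smul h3).continuousAt).1 h4

/-- By induction the velocity of the projected curve lies in the distribution, so it equals the
frame vector of its components; these are a multiple of the direction recorded by the new
coordinates. -/
theorem IsLift.deriv_mem {γ : ℂ → Fin (m + 1) → ℂ} : ∀ {k : ℕ} {w : ChartIndex m k}
    {X : ℂ → Coord m k}, IsLift γ k w X → AnalyticAt ℂ X 0 →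
    ∀ᶠ t in 𝓝 0, deriv X t ∈ LinearMap.range (frame m k w (X t))
  | 0, _, _, _, _ => Eventually.of_forall fun _ => ⟨_, rfl⟩
  | k + 1, (w, i), X, h, hX => by
    filter_upwards [h.1.deriv_mem (analyticAt_fst_comp hX), hX.eventually_analyticAt,
      IsLiftOf.eventually_eq h.2 (analyticAt_fst_comp hX) (analyticAt_snd_comp hX)] with t h1 h2 h3
    rw [deriv_coord_succ h2]
    set a := deriv (fun s => (Prod.fst (X s) : Coord m k)) t
    set b := deriv (fun s => (Prod.snd (X s) : Fin m → ℂ)) t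
    refine ⟨i.insertNth (α := fun _ => ℂ) (coframe m k w a i) b, ?_⟩
    refine Prod.ext ?_ ?_
    · change (i.insertNth (α := fun _ => ℂ) (coframe m k w a i) b : Fin (m + 1) → ℂ) i •
        frame m k w (Prod.fst (X t)) (unitAt i (Prod.snd (X t))) = a
      rw [Fin.insertNth_apply_same, ← map_smul, ← h3, frame_coframe_of_mem_range h1]
    · funext j
      change (i.insertNth (α := fun _ => ℂ) (coframe m k w a i) b : Fin (m + 1) → ℂ)
        (i.succAbove j) = b j
      rw [Fin.insertNth_apply_succAbove]

theorem isLift_of_prolongations {γ : ℂ → Fin (m + 1) → ℂ} (hγ : AnalyticAt ℂ γ 0)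
    {c : ∀ j, ℂ → Point m j} (h0 : c 0 = γ) : ∀ {k : ℕ} {w : ChartIndex m k},
    (∀ j < k, IsProlongationOf (S := tower m j) (c j) (c (j + 1))) →
    c k 0 ∈ (tower m k).src w →
    AnalyticIn (S := tower m k) w (c k) ∧ IsLift γ k w (fun t => (tower m k).coord w (c k t))
  | 0, _, _, _ => by
    subst h0
    exact ⟨⟨Eventually.of_forall fun _ => trivial, hγ⟩, Eventually.of_forall fun _ => rfl⟩
  | k + 1, (w, i), h, hm => by
    have hcc := h k (Nat.lt_succ_self k)
    have h2 : proj (c (k + 1) 0) = c k 0 := hcc.1.self_of_nhds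
    have hm1 : c k 0 ∈ (tower m k).src w := h2 ▸ fst_mem_src hm
    obtain ⟨h3, h4⟩ := isLift_of_prolongations hγ h0
      (fun j hj => h j (hj.trans (Nat.lt_succ_self k))) hm1
    obtain ⟨h5, h6⟩ := hcc.analyticIn (tower_charted m k) h3 hm
    have h7 : ∀ᶠ t in 𝓝 0, (tower m k).coord w (c k t) =
        Prod.fst ((tower m (k + 1)).coord (w, i) (c (k + 1) t)) := by
      filter_upwards [hcc.1] with t ht
      rw [← ht]
      rfl
    exact ⟨h5, h4.congr h7, IsLiftOf.congr h6 h7 (Eventually.of_forall fun _ => rfl)⟩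

/-- The word `0 … 0`. -/
def zeroWord (m : ℕ) : ∀ k, ChartIndex m k
  | 0 => ()
  | k + 1 => (zeroWord m k, 0)

theorem exists_prolongations {γ : ℂ → Fin (m + 1) → ℂ} : ∀ {k : ℕ} {w : ChartIndex m k}
    {X : ℂ → Coord m k}, AnalyticAt ℂ X 0 → IsLift γ k w X →
    ∃ c : ∀ j, ℂ → Point m j, c 0 = γ ∧
      (∀ j < k, IsProlongationOf (S := tower m j) (c j) (c (j + 1))) ∧
      ∀ᶠ t in 𝓝 0, c k t = (tower_charted m k).point w (X t)
  | 0, w, X, _, h => by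
    -- Only the value at level `0` matters. The family is indexed by all levels, so the higher ones
    -- are filled with constant curves.
    refine ⟨fun j => Nat.rec (motive := fun j => ℂ → Point m j) γ
      (fun j _ _ => (tower_charted m (j + 1)).point (zeroWord m (j + 1)) 0) j, rfl,
      fun j hj => absurd hj (Nat.not_lt_zero j), ?_⟩
    filter_upwards [h] with t ht
    have h1 := (tower_charted m 0).point_coord (w := w) (p := X t) trivial
    exact ht.symm.trans h1.symm
  | k + 1, (w, i), X, hX, h => by
    have hT := tower_charted m k
    have hX1 := analyticAt_fst_comp hX
    obtain ⟨c, hc0, hc, hck⟩ := exists_prolongations hX1 h.1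
    obtain ⟨D, hD⟩ : ∃ D : ℂ → Point m (k + 1),
      ∀ t, D t = hT.prolong.point (w, i) (X t) := ⟨_, fun _ => rfl⟩
    -- The family for level `k` has arbitrary entries above `k`; the one at `k + 1` is replaced by
    -- the lift.
    refine ⟨Function.update c (k + 1) D, ?_, ?_, ?_⟩
    · rw [Function.update_of_ne (Nat.succ_ne_zero k).symm, hc0]
    · intro j hj
      rw [Function.update_of_ne (Nat.ne_of_lt hj)]
      rcases (Nat.lt_succ_iff_lt_or_eq.1 hj) with hj | rfl
      · rw [Function.update_of_ne (by omega)]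
        exact hc j hj
      · rw [Function.update_self]
        have e1 : ∀ᶠ t in 𝓝 0, (Prod.fst (X t) : Coord m j) = (tower m j).coord w (c j t) := by
          filter_upwards [hck] with t ht
          rw [ht, hT.coord_point]
        have e2 : ∀ t, (tower m j).prolong.coord (w, i) (D t) = X t := fun t =>
          (congrArg _ (hD t)).trans (hT.prolong.coord_point (w, i) (X t))
        refine isProlongationOf_of_isLiftOf hT (w := w) (i := i) ⟨?_, hX1.congr e1⟩
          ⟨Eventually.of_forall fun t => hD t ▸ hT.prolong.point_mem (w, i) (X t), ?_⟩ ?_ ?_ ?_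
        · filter_upwards [hck] with t ht
          rw [ht]
          exact hT.point_mem _ _
        · exact hX.congr (Eventually.of_forall fun t => (e2 t).symm)
        · filter_upwards [hck] with t ht
          rw [hD, hT.point_prolong_fst, ht]
        · exact eventually_nhdsNE_of_nhds
            ((h.1.congr e1).deriv_mem (hX1.congr e1))
        · exact IsLiftOf.congr h.2 e1 (Eventually.of_forall fun t => congrArg Prod.snd (e2 t).symm)
    · rw [Function.update_self]
      exact Eventually.of_forall fun t => hD t

theorem germAt_subset {γ : ℂ → Fin (m + 1) → ℂ} {p : Point m k} (h : γ ∈ GermAt p) :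
    PassesThrough γ p := by
  obtain ⟨hγ, c, h0, hc, hp, -⟩ := h
  exact ⟨hγ, c, h0, hc, hp⟩

/-- A curve germ realizes `p` if its prolongation in a chart passes through `p` and all critical
components of the velocity are nonzero. -/
theorem mem_germAt_iff {γ : ℂ → Fin (m + 1) → ℂ} {w : ChartIndex m k} {p : Point m k}
    (hp : p ∈ (tower m k).src w) : γ ∈ GermAt p ↔ AnalyticAt ℂ γ 0 ∧
      ∃ X : ℂ → Coord m k, AnalyticAt ℂ X 0 ∧ IsLift γ k w X ∧
        X 0 = (tower m k).coord w p ∧ deriv X 0 ≠ 0 ∧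
        ∀ a ∈ crit m k w (X 0), coframe m k w (deriv X 0) a ≠ 0 := by
  have hT := tower_charted m k
  have key : ∀ c : ℂ → Point m k, AnalyticIn (S := tower m k) w c →
      IsLift γ k w (fun t => (tower m k).coord w (c t)) → c 0 = p →
      (((tower m k).velocity c 0 ≠ 0 ∧
        ¬ IsCriticalDirection p (Submodule.span ℂ {(tower m k).velocity c 0})) ↔
      (deriv (fun t => (tower m k).coord w (c t)) 0 ≠ 0 ∧
        ∀ a ∈ crit m k w ((tower m k).coord w p),
          coframe m k w (deriv (fun t => (tower m k).coord w (c t)) 0) a ≠ 0)) := by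
    rintro c hc hl rfl
    have hv := hT.inChart_velocity hc.1 hc.2.differentiableAt
    have hd := (hl.deriv_mem hc.2).self_of_nhds
    rw [← hv] at hd
    rw [isCriticalDirection_span_iff hp ((hT.mem_distr_iff hp).2 hd), hv]
    refine and_congr ?_ ?_
    · rw [← hv, not_iff_not]
      constructor
      · intro h
        rw [h, Charted.inChart_zero]
      · intro h
        exact hT.inChart_injective hp (h.trans (Charted.inChart_zero _ _).symm)
    · push Not
      exact Iff.rfl
  constructor
  · rintro ⟨hγ, c, h0, hc, hcp, hreg⟩
    obtain ⟨h1, h2⟩ := isLift_of_prolongations hγ h0 hc (w := w) (hcp ▸ hp)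
    have h3 := (key _ h1 h2 hcp).1 hreg
    subst hcp
    exact ⟨hγ, _, h1.2, h2, rfl, h3⟩
  · rintro ⟨hγ, X, hX, hl, hX0, hreg⟩
    obtain ⟨c, hc0, hc, hck⟩ := exists_prolongations hX hl
    have hcp : c k 0 = p := by rw [hck.self_of_nhds, hX0, hT.point_coord hp]
    have e1 : ∀ᶠ t in 𝓝 0, X t = (tower m k).coord w (c k t) := by
      filter_upwards [hck] with t ht
      rw [ht, hT.coord_point]
    have hA : AnalyticIn (S := tower m k) w (c k) := by
      refine ⟨?_, hX.congr e1⟩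
      filter_upwards [hck] with t ht
      rw [ht]
      exact hT.point_mem _ _
    refine ⟨hγ, c, hc0, hc, hcp, (key _ hA (hl.congr e1) hcp).2 ?_⟩
    have e2 : deriv (fun t => (tower m k).coord w (c k t)) 0 = deriv X 0 :=
      EventuallyEq.deriv_eq (e1.mono fun t ht => ht.symm)
    rw [e2, ← hX0]
    exact hreg

end

section

open Stage

variable {m k : ℕ}

/-! ## Level three in coordinates -/

/-- The vector of the ratios of the components of the line of `P`, normalized at `i`. -/
def lastVec (w : ChartIndex m k) (i : Fin (m + 1)) (P : Point m (k + 1)) : Fin (m + 1) → ℂ :=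
  unitAt i (Prod.snd ((tower m (k + 1)).coord (w, i) P))

theorem lastVec_self (w : ChartIndex m k) (i : Fin (m + 1)) (P : Point m (k + 1)) :
    lastVec w i P i = 1 := unitAt_self _ _

theorem dir_eq_smul_lastVec {w : ChartIndex m k} {i : Fin (m + 1)} {P : Point m (k + 1)}
    (hP : P ∈ (tower m (k + 1)).src (w, i)) :
    dir (S := tower m k) w P = dir (S := tower m k) w P i • lastVec w i P :=
  (smul_unitAt_ratio (src_dir (S := tower m k) hP)).symm

theorem dir_eq_zero_iff {w : ChartIndex m k} {i a : Fin (m + 1)} {P : Point m (k + 1)}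
    (hP : P ∈ (tower m (k + 1)).src (w, i)) :
    dir (S := tower m k) w P a = 0 ↔ lastVec w i P a = 0 := by
  have h1 := congrFun (dir_eq_smul_lastVec hP) a
  have h2 : dir (S := tower m k) w P i ≠ 0 := src_dir (S := tower m k) hP
  rw [h1, Pi.smul_apply, smul_eq_mul, mul_eq_zero, or_iff_right h2]

theorem mem_src_of_lastVec_ne_zero {w : ChartIndex m k} {i a : Fin (m + 1)} {P : Point m (k + 1)}
    (hP : P ∈ (tower m (k + 1)).src (w, i)) (ha : lastVec w i P a ≠ 0) :
    P ∈ (tower m (k + 1)).src (w, a) :=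
  ⟨fst_mem_src hP, fun h => ha ((dir_eq_zero_iff hP).1 h)⟩

theorem lastVec_change {w : ChartIndex m k} {i a : Fin (m + 1)} {P : Point m (k + 1)}
    (hP : P ∈ (tower m (k + 1)).src (w, i)) (hP' : P ∈ (tower m (k + 1)).src (w, a))
    (b : Fin (m + 1)) : lastVec w i P b = 0 ↔ lastVec w a P b = 0 := by
  rw [← dir_eq_zero_iff hP, ← dir_eq_zero_iff hP']

theorem exists_mem_src_of_proj {w : ChartIndex m k} {P : Point m (k + 1)}
    (hP : proj P ∈ (tower m k).src w) : ∃ i, P ∈ (tower m (k + 1)).src (w, i) := by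
  by_contra! h
  refine (tower_charted m k).dir_ne_zero (P := P) hP (funext fun i => ?_)
  by_contra hi
  exact h i ⟨hP, hi⟩

/-- Names of charts at level one. -/
def word1 (i : Fin (m + 1)) : ChartIndex m 1 := ((), i)
/-- Names of charts at level two. -/
def word2 (i j : Fin (m + 1)) : ChartIndex m 2 := (word1 i, j)
/-- Names of charts at level three. -/
def word3 (i j l : Fin (m + 1)) : ChartIndex m 3 := (word2 i j, l)

theorem mem_crit_word1 {i a : Fin (m + 1)} {X : Coord m 1} :
    a ∈ crit m 1 (word1 i) X ↔ a = i :=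
  ⟨fun h => h.resolve_right fun h => h.1.elim, Or.inl⟩

theorem mem_crit_word2 {i j a : Fin (m + 1)} {X : Coord m 2} :
    a ∈ crit m 2 (word2 i j) X ↔ a = j ∨ a = i ∧ unitAt j (Prod.snd X) a = 0 :=
  or_congr_right (and_congr_left fun _ => mem_crit_word1)

theorem mem_crit_word3 {i j l a : Fin (m + 1)} {X : Coord m 3} :
    a ∈ crit m 3 (word3 i j l) X ↔ a = l ∨
      (a = j ∨ a = i ∧ unitAt j (Prod.snd (Prod.fst X : Coord m 2)) a = 0) ∧
        unitAt l (Prod.snd X) a = 0 :=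
  or_congr_right (and_congr_left fun _ => mem_crit_word2)

theorem isVertical_two_iff {i j : Fin (m + 1)} {P : Point m 2}
    (hP : P ∈ (tower m 2).src (word2 i j)) : IsVertical P ↔ lastVec (word1 i) j P i = 0 :=
  (isVertical_iff (k := 0) (w := ()) (j := i) (fst_mem_src hP)).trans (dir_eq_zero_iff hP)

theorem isCritical_two_iff {i j : Fin (m + 1)} {P : Point m 2}
    (hP : P ∈ (tower m 2).src (word2 i j)) : IsCritical P ↔ lastVec (word1 i) j P i = 0 := by
  rw [isCritical_iff (fst_mem_src hP)]
  simp only [mem_crit_word1, exists_eq_left]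
  exact dir_eq_zero_iff hP

theorem isVertical_three_iff {i j l : Fin (m + 1)} {P : Point m 3}
    (hP : P ∈ (tower m 3).src (word3 i j l)) : IsVertical P ↔ lastVec (word2 i j) l P j = 0 :=
  (isVertical_iff (w := word1 i) (j := j) (fst_mem_src hP)).trans (dir_eq_zero_iff hP)

theorem mem_crit_proj {i j a : Fin (m + 1)} (P : Point m 3) :
    a ∈ crit m 2 (word2 i j) ((tower m 2).coord (word2 i j) (proj P)) ↔
      a = j ∨ a = i ∧ lastVec (word1 i) j (proj P) i = 0 := by
  rw [mem_crit_word2]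
  refine or_congr_right (and_congr_right ?_)
  rintro rfl
  exact Iff.rfl

theorem isCritical_three_iff {i j l : Fin (m + 1)} {P : Point m 3}
    (hP : P ∈ (tower m 3).src (word3 i j l)) : IsCritical P ↔ lastVec (word2 i j) l P j = 0 ∨
      lastVec (word1 i) j (proj P) i = 0 ∧ lastVec (word2 i j) l P i = 0 := by
  rw [isCritical_iff (fst_mem_src hP)]
  simp only [mem_crit_proj, dir_eq_zero_iff hP]
  constructor
  · rintro ⟨a, rfl | ⟨rfl, h1⟩, h2⟩
    · exact Or.inl h2
    · exact Or.inr ⟨h1, h2⟩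
  · rintro (h | ⟨h1, h2⟩)
    · exact ⟨j, Or.inl rfl, h⟩
    · exact ⟨i, Or.inr ⟨rfl, h1⟩, h2⟩

theorem lastLetter_one (P : Point m 1) : lastLetter P = Letter.R := by
  simp [lastLetter, not_isVertical_one, not_isCritical_one]

theorem lastLetter_two {i j : Fin (m + 1)} {P : Point m 2}
    (hP : P ∈ (tower m 2).src (word2 i j)) :
    lastLetter P = Letter.V ↔ lastVec (word1 i) j P i = 0 := by
  unfold lastLetter
  rw [isVertical_two_iff hP, isCritical_two_iff hP]
  split_ifs <;> simp_all

theorem code_three (P : Point m 3) :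
    code P = [Letter.R, lastLetter (proj P), lastLetter P] := by
  change (([] ++ [lastLetter (proj (proj P))]) ++ [lastLetter (proj P)]) ++ [lastLetter P] = _
  rw [lastLetter_one]
  rfl

/-- At level three the critical hyperplanes are `θ_j = 0`, the vertical one, and `θ_i = 0`, which
comes from the fibre one level lower and is present only when the second letter is V. The letter T
means lying in the latter but not in the former. -/
theorem mem_RVT_iff {i j l : Fin (m + 1)} {P : Point m 3}
    (hP : P ∈ (tower m 3).src (word3 i j l)) : P ∈ RVT m ↔
      lastVec (word1 i) j (proj P) i = 0 ∧ lastVec (word2 i j) l P j ≠ 0 ∧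
        lastVec (word2 i j) l P i = 0 := by
  have h1 : lastLetter P = Letter.T ↔ ¬ IsVertical P ∧ IsCritical P := by
    unfold lastLetter
    split_ifs <;> simp_all
  change code P = _ ↔ _
  rw [code_three]
  simp only [List.cons.injEq, true_and, and_true, lastLetter_two (fst_mem_src hP), h1,
    isVertical_three_iff hP, isCritical_three_iff hP]
  tauto

theorem mem_RVL_iff {i j l : Fin (m + 1)} {P : Point m 3}
    (hP : P ∈ (tower m 3).src (word3 i j l)) : P ∈ RVL m ↔
      lastVec (word1 i) j (proj P) i = 0 ∧ lastVec (word2 i j) l P j = 0 ∧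
        lastVec (word2 i j) l P i = 0 := by
  have h1 : lastLetter P = Letter.V ↔ IsVertical P := by
    unfold lastLetter
    split_ifs <;> simp_all
  change code P = _ ∧ _ ↔ _
  rw [code_three, isL_iff (w := word1 i) (j := j) (fst_mem_src hP)]
  simp only [List.cons.injEq, true_and, and_true, lastLetter_two (fst_mem_src hP), h1,
    isVertical_three_iff hP]
  constructor
  · rintro ⟨⟨h2, h3⟩, -, a, ha, haj, h4⟩
    obtain ⟨rfl, h5⟩ := ((mem_crit_proj P).1 ha).resolve_left haj
    exact ⟨h2, h3, (dir_eq_zero_iff hP).1 h4⟩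
  · rintro ⟨h2, h3, h4⟩
    refine ⟨⟨h2, h3⟩, (dir_eq_zero_iff hP).2 h3, i, (mem_crit_proj P).2 (Or.inr ⟨rfl, h2⟩), ?_,
      (dir_eq_zero_iff hP).2 h4⟩
    rintro rfl
    rw [lastVec_self] at h2
    exact one_ne_zero h2

/-! ## Lifts as systems of scalar equations -/

/-- The vector function `u`, normalized at `i`, is the vector of the ratios of the derivatives of
the components of `g`. -/
structure RatioOf (i : Fin (m + 1)) (g u : ℂ → Fin (m + 1) → ℂ) : Prop where
  analytic : AnalyticAt ℂ u 0
  self : ∀ t, u t i = 1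
  ne_zero : ∀ᶠ t in 𝓝[≠] (0 : ℂ), deriv (fun s => g s i) t ≠ 0
  eq : ∀ a, ∀ᶠ t in 𝓝[≠] (0 : ℂ), deriv (fun s => g s a) t = deriv (fun s => g s i) t * u t a

/-- Replace the `i`-th component of `u` by that of `g`. -/
def keep (i : Fin (m + 1)) (g u : ℂ → Fin (m + 1) → ℂ) : ℂ → Fin (m + 1) → ℂ :=
  fun t a => if a = i then g t i else u t a

/-- The coframe is evaluated here on the coordinates and not on a velocity. Each of its forms is the
differential of a coordinate, so this extracts the `m + 1` coordinates whose derivatives enter the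
next ratios. -/
theorem coframe_succ_eq_keep (w : ChartIndex m k) (i : Fin (m + 1)) (X : ℂ → Coord m (k + 1)) :
    (fun t => coframe m (k + 1) (w, i) (X t)) =
      keep i (fun t => coframe m k w (Prod.fst (X t))) (fun t => unitAt i (Prod.snd (X t))) := by
  funext t a
  simp only [keep]
  generalize X t = Y
  obtain ⟨x, u⟩ := Y
  rcases Fin.eq_self_or_eq_succAbove i a with rfl | ⟨j, rfl⟩
  · rw [coframe_succ_self, if_pos rfl]
  · rw [coframe_succ_succAbove, if_neg (Fin.succAbove_ne _ _), unitAt_succAbove]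

theorem coframe_deriv {w : ChartIndex m k} {X : ℂ → Coord m k} {t : ℂ} (hX : AnalyticAt ℂ X t)
    (a : Fin (m + 1)) : coframe m k w (deriv X t) a = deriv (fun s => coframe m k w (X s) a) t := by
  have h1 := (coframeCLM m k w).hasFDerivAt.comp_hasDerivAt t hX.differentiableAt.hasDerivAt
  exact ((hasDerivAt_pi.1 h1) a).deriv.symm

theorem isLiftOf_iff {w : ChartIndex m k} {i : Fin (m + 1)} {X : ℂ → Coord m k}
    {u : ℂ → Fin m → ℂ} (hX : AnalyticAt ℂ X 0) (hu : AnalyticAt ℂ u 0) :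
    IsLiftOf w i X u ↔
      RatioOf i (fun t => coframe m k w (X t)) (fun t => unitAt i (u t)) := by
  have hXe := eventually_nhdsNE_of_nhds hX.eventually_analyticAt
  constructor
  · intro h
    refine ⟨(analyticAt_unitAt i _).fun_comp hu, fun t => unitAt_self _ _, ?_, fun a => ?_⟩
    · filter_upwards [h, hXe] with t ht hXt
      rw [← coframe_deriv hXt]
      exact ht.1
    · filter_upwards [h, hXe] with t ht hXt
      rw [← coframe_deriv hXt, ← coframe_deriv hXt]
      exact congrFun ht.2 a
  · rintro ⟨-, -, h1, h2⟩
    filter_upwards [h1, eventually_all.2 h2, hXe] with t ht1 ht2 hXt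
    refine ⟨by rwa [coframe_deriv hXt], funext fun a => ?_⟩
    rw [Pi.smul_apply, smul_eq_mul, coframe_deriv hXt, coframe_deriv hXt]
    exact ht2 a

end

/-! ### Germs realizing a point of level three as solutions of scalar equations. -/

section

open Stage

variable {m : ℕ}

theorem keep_congr {i : Fin (m + 1)} {g g' : ℂ → Fin (m + 1) → ℂ} (u : ℂ → Fin (m + 1) → ℂ)
    (h : ∀ᶠ t in 𝓝 0, g t = g' t) : ∀ᶠ t in 𝓝 0, keep i g u t = keep i g' u t := by
  filter_upwards [h] with t ht
  funext a
  simp only [keep, ht]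

theorem deriv_apply_congr {g g' : ℂ → Fin (m + 1) → ℂ} {t : ℂ} (h : ∀ᶠ s in 𝓝 t, g s = g' s)
    (a : Fin (m + 1)) : deriv (fun s => g s a) t = deriv (fun s => g' s a) t :=
  EventuallyEq.deriv_eq (h.mono fun _ hs => congrFun hs a)

theorem RatioOf.congr {i : Fin (m + 1)} {g g' u : ℂ → Fin (m + 1) → ℂ} (h : RatioOf i g u)
    (hg : ∀ᶠ t in 𝓝 0, g t = g' t) : RatioOf i g' u := by
  have hg' := eventually_nhdsNE_of_nhds hg.eventually_nhds
  refine ⟨h.analytic, h.self, ?_, fun a => ?_⟩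
  · filter_upwards [h.ne_zero, hg'] with t h1 h2
    rwa [← deriv_apply_congr h2]
  · filter_upwards [h.eq a, hg'] with t h1 h2
    rwa [← deriv_apply_congr h2, ← deriv_apply_congr h2]

theorem unitAt_ratio_of_eq_one {i : Fin (m + 1)} {θ : Fin (m + 1) → ℂ} (h : θ i = 1) :
    unitAt i (ratio i θ) = θ := by
  have h1 := smul_unitAt_ratio (i := i) (θ := θ) (by rw [h]; exact one_ne_zero)
  rwa [h, one_smul] at h1

theorem analyticAt_ratio_comp {i : Fin (m + 1)} {u : ℂ → Fin (m + 1) → ℂ}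
    (hu : AnalyticAt ℂ u 0) (h : ∀ t, u t i = 1) : AnalyticAt ℂ (fun t => ratio i (u t)) 0 :=
  (analyticAt_ratio (by rw [h]; exact one_ne_zero)).fun_comp hu

theorem analyticAt_coord_mk {k : ℕ} {X : ℂ → Coord m k} {u : ℂ → Fin m → ℂ}
    (hX : AnalyticAt ℂ X 0) (hu : AnalyticAt ℂ u 0) :
    AnalyticAt ℂ (fun t => ((X t, u t) : Coord m (k + 1))) 0 :=
  AnalyticAt.prod (F := Coord m k) (G := Fin m → ℂ) hX hu

/-- `U`, `V`, `W` are the successive ratio vectors of a curve prolonged in the chart `i j l`. -/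
structure Lift3 (i j l : Fin (m + 1)) (γ U V W : ℂ → Fin (m + 1) → ℂ) : Prop where
  one : RatioOf i γ U
  two : RatioOf j (keep i γ U) V
  three : RatioOf l (keep j (keep i γ U) V) W

/-- The coordinates of the point `p` of level three in the chart `i j l`. -/
structure HasCoords (i j l : Fin (m + 1)) (p : Point m 3) (x U V W : Fin (m + 1) → ℂ) :
    Prop where
  mem : p ∈ (tower m 3).src (word3 i j l)
  base_eq : base p = x
  one : lastVec (k := 0) () i (proj (proj p)) = U
  two : lastVec (word1 i) j (proj p) = V
  three : lastVec (word2 i j) l p = W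

theorem exists_hasCoords (i j l : Fin (m + 1)) (x : Fin (m + 1) → ℂ) {U V W : Fin (m + 1) → ℂ}
    (hU : U i = 1) (hV : V j = 1) (hW : W l = 1) : ∃ p, HasCoords i j l p x U V W := by
  obtain ⟨p, hp, hc⟩ := (tower_charted m 3).surj (word3 i j l)
    (((x, ratio i U), ratio j V), ratio l W)
  refine ⟨p, hp, congrArg (fun X : Coord m 3 => X.1.1.1) hc, ?_, ?_, ?_⟩
  · exact (congrArg (fun X : Coord m 3 => unitAt i X.1.1.2) hc).trans (unitAt_ratio_of_eq_one hU)
  · exact (congrArg (fun X : Coord m 3 => unitAt j X.1.2) hc).trans (unitAt_ratio_of_eq_one hV)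
  · exact (congrArg (fun X : Coord m 3 => unitAt l X.2) hc).trans (unitAt_ratio_of_eq_one hW)

theorem hasCoords_self {i j l : Fin (m + 1)} {p : Point m 3}
    (hp : p ∈ (tower m 3).src (word3 i j l)) : HasCoords i j l p (base p)
      (lastVec (k := 0) () i (proj (proj p))) (lastVec (word1 i) j (proj p))
      (lastVec (word2 i j) l p) := ⟨hp, rfl, rfl, rfl, rfl⟩

/-- The critical indices in terms of the coordinates. -/
def IsCritIndex (i j l : Fin (m + 1)) (V W : Fin (m + 1) → ℂ) (a : Fin (m + 1)) : Prop :=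
  a = l ∨ (a = j ∨ a = i ∧ V a = 0) ∧ W a = 0

/-- With this criterion manifolds and lines disappear: realizing a point means solving three ratio
equations with prescribed values at `0` and nonzero derivatives at the critical indices. -/
theorem mem_germAt_three {i j l : Fin (m + 1)} {p : Point m 3}
    (hp : p ∈ (tower m 3).src (word3 i j l)) {γ : ℂ → Fin (m + 1) → ℂ} :
    γ ∈ GermAt p ↔ AnalyticAt ℂ γ 0 ∧ ∃ U V W, Lift3 i j l γ U V W ∧
      HasCoords i j l p (γ 0) (U 0) (V 0) (W 0) ∧
      ∀ a, IsCritIndex i j l (V 0) (W 0) a →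
        deriv (fun t => keep l (keep j (keep i γ U) V) W t a) 0 ≠ 0 := by
  rw [mem_germAt_iff hp]
  refine and_congr_right fun hγ => ?_
  constructor
  · rintro ⟨X, hX, ⟨⟨⟨h0, h1⟩, h2⟩, h3⟩, hXp, -, hreg⟩
    have hX2 := analyticAt_fst_comp (k := 2) hX
    have hX1 := analyticAt_fst_comp (k := 1) hX2
    have hX0 := analyticAt_fst_comp (k := 0) hX1
    set U : ℂ → Fin (m + 1) → ℂ := fun t => unitAt i (X t).1.1.2 with hU
    set V : ℂ → Fin (m + 1) → ℂ := fun t => unitAt j (X t).1.2 with hV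
    set W : ℂ → Fin (m + 1) → ℂ := fun t => unitAt l (X t).2 with hW
    have h1' := (isLiftOf_iff hX0 (analyticAt_snd_comp (k := 0) hX1)).1 h1
    have h2' := (isLiftOf_iff hX1 (analyticAt_snd_comp (k := 1) hX2)).1 h2
    have h3' := (isLiftOf_iff hX2 (analyticAt_snd_comp (k := 2) hX)).1 h3
    have e0 : ∀ᶠ t in 𝓝 0, (coframe m 0 () (X t).1.1.1) = γ t := h0
    have e1 : ∀ᶠ t in 𝓝 0, (coframe m 1 (word1 i) (X t).1.1) = keep i γ U t := by
      filter_upwards [keep_congr (i := i) U e0] with t ht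
      exact (congrFun (coframe_succ_eq_keep (k := 0) () i (fun t => (X t).1.1)) t).trans ht
    have e2 : ∀ᶠ t in 𝓝 0, (coframe m 2 (word2 i j) (X t).1) = keep j (keep i γ U) V t := by
      filter_upwards [keep_congr (i := j) V e1] with t ht
      exact (congrFun (coframe_succ_eq_keep (word1 i) j (fun t => (X t).1)) t).trans ht
    have e3 : ∀ᶠ t in 𝓝 0, (coframe m 3 (word3 i j l) (X t)) =
        keep l (keep j (keep i γ U) V) W t := by
      filter_upwards [keep_congr (i := l) W e2] with t ht
      exact (congrFun (coframe_succ_eq_keep (word2 i j) l X) t).trans ht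
    refine ⟨U, V, W, ⟨h1'.congr e0, h2'.congr e1, h3'.congr e2⟩, ⟨hp, ?_, ?_, ?_, ?_⟩, ?_⟩
    · exact (congrArg (fun X : Coord m 3 => X.1.1.1) hXp).symm.trans e0.self_of_nhds
    · exact (congrArg (fun X : Coord m 3 => unitAt i X.1.1.2) hXp).symm
    · exact (congrArg (fun X : Coord m 3 => unitAt j X.1.2) hXp).symm
    · exact (congrArg (fun X : Coord m 3 => unitAt l X.2) hXp).symm
    · intro a ha
      have h4 := hreg a (mem_crit_word3.2 ha)
      have h5 := coframe_deriv (w := word3 i j l) hX a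
      rw [← deriv_apply_congr e3]
      exact fun h => h4 (h5.trans h)
  · rintro ⟨U, V, W, ⟨h1, h2, h3⟩, hc, hreg⟩
    have hX0 : AnalyticAt ℂ (fun t => (γ t : Coord m 0)) 0 := hγ
    have hX1 := analyticAt_coord_mk (k := 0) hX0 (analyticAt_ratio_comp h1.analytic h1.self)
    have hX2 := analyticAt_coord_mk (k := 1) hX1 (analyticAt_ratio_comp h2.analytic h2.self)
    have hX3 := analyticAt_coord_mk (k := 2) hX2 (analyticAt_ratio_comp h3.analytic h3.self)
    have u1 : (fun t => unitAt i (ratio i (U t))) = U :=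
      funext fun t => unitAt_ratio_of_eq_one (h1.self t)
    have u2 : (fun t => unitAt j (ratio j (V t))) = V :=
      funext fun t => unitAt_ratio_of_eq_one (h2.self t)
    have u3 : (fun t => unitAt l (ratio l (W t))) = W :=
      funext fun t => unitAt_ratio_of_eq_one (h3.self t)
    have e1 : (fun t => coframe m 1 (word1 i) (γ t, ratio i (U t))) = keep i γ U := by
      refine (coframe_succ_eq_keep (k := 0) () i (fun t => (γ t, ratio i (U t)))).trans ?_
      exact congrArg (keep i γ) u1
    have e2 : (fun t => coframe m 2 (word2 i j) ((γ t, ratio i (U t)), ratio j (V t))) =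
        keep j (keep i γ U) V := by
      refine (coframe_succ_eq_keep (word1 i) j
        (fun t => ((γ t, ratio i (U t)), ratio j (V t)))).trans ?_
      exact congrArg₂ (keep j) e1 u2
    have e3 : (fun t => coframe m 3 (word3 i j l)
        (((γ t, ratio i (U t)), ratio j (V t)), ratio l (W t))) =
        keep l (keep j (keep i γ U) V) W := by
      refine (coframe_succ_eq_keep (word2 i j) l
        (fun t => (((γ t, ratio i (U t)), ratio j (V t)), ratio l (W t)))).trans ?_
      exact congrArg₂ (keep l) e2 u3
    have hl1 : IsLiftOf (m := m) (k := 0) () i γ (fun t => ratio i (U t)) := by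
      refine (isLiftOf_iff hX0 (analyticAt_ratio_comp h1.analytic h1.self)).2 ?_
      rw [u1]
      exact h1
    have hl2 : IsLiftOf (m := m) (k := 1) (word1 i) j (fun t => (γ t, ratio i (U t)))
        (fun t => ratio j (V t)) := by
      refine (isLiftOf_iff hX1 (analyticAt_ratio_comp h2.analytic h2.self)).2 ?_
      rw [u2, e1]
      exact h2
    have hl3 : IsLiftOf (m := m) (k := 2) (word2 i j) l
        (fun t => ((γ t, ratio i (U t)), ratio j (V t))) (fun t => ratio l (W t)) := by
      refine (isLiftOf_iff hX2 (analyticAt_ratio_comp h3.analytic h3.self)).2 ?_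
      rw [u3, e2]
      exact h3
    have hd : ∀ a, IsCritIndex i j l (V 0) (W 0) a → coframe m 3 (word3 i j l)
        (deriv (fun t => ((((γ t, ratio i (U t)), ratio j (V t)), ratio l (W t)) : Coord m 3)) 0) a
          ≠ 0 := by
      intro a ha
      have h5 := coframe_deriv (w := word3 i j l) hX3 a
      have h6 : (fun s => coframe m 3 (word3 i j l)
        (((γ s, ratio i (U s)), ratio j (V s)), ratio l (W s)) a) =
        fun s => keep l (keep j (keep i γ U) V) W s a := funext fun s => congrFun (congrFun e3 s) a
      intro h
      refine hreg a ha ?_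
      rw [← h6]
      exact h5.symm.trans h
    refine ⟨_, hX3, ⟨⟨⟨Eventually.of_forall fun t => rfl, hl1⟩, hl2⟩, hl3⟩, ?_, ?_, ?_⟩
    · refine Prod.ext (Prod.ext (Prod.ext hc.base_eq.symm ?_) ?_) ?_
      · exact (congrArg (ratio i) hc.one).symm.trans (ratio_unitAt i _)
      · exact (congrArg (ratio j) hc.two).symm.trans (ratio_unitAt j _)
      · exact (congrArg (ratio l) hc.three).symm.trans (ratio_unitAt l _)
    · intro h
      -- The index `l` is always critical, so a regular direction already has nonzero velocity.
      refine hd l (Or.inl rfl) ?_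
      rw [h]
      exact congrFun (map_zero (coframeL m 3 (word3 i j l))) l
    · intro a ha
      refine hd a ?_
      have h7 := mem_crit_word3.1 ha
      rwa [show unitAt j _ = V 0 from congrFun u2 0, show unitAt l _ = W 0 from congrFun u3 0] at h7

end

section

open Stage

/-! ## Permutations of the coordinates -/

variable {e : Equiv.Perm (Fin 3)}

/-- Permute the components of a vector function. -/
def permute (e : Equiv.Perm (Fin 3)) (g : ℂ → Fin 3 → ℂ) : ℂ → Fin 3 → ℂ :=
  fun t s => g t (e.symm s)

theorem permute_apply (g : ℂ → Fin 3 → ℂ) (t : ℂ) (a : Fin 3) : permute e g t (e a) = g t a := by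
  simp [permute]

theorem permute_permute (γ : ℂ → Fin 3 → ℂ) : permute e (permute e.symm γ) = γ := by
  funext t a
  simp [permute]

theorem keep_permute (i : Fin 3) (g u : ℂ → Fin 3 → ℂ) :
    keep (m := 2) (e i) (permute e g) (permute e u) = permute e (keep (m := 2) i g u) := by
  funext t a
  obtain ⟨a, rfl⟩ := e.surjective a
  simp [keep, permute]

theorem analyticAt_permute_iff {g : ℂ → Fin 3 → ℂ} {t : ℂ} :
    AnalyticAt ℂ (permute e g) t ↔ AnalyticAt ℂ g t := by
  constructor
  · intro h
    refine AnalyticAt.pi fun a => ?_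
    simpa [permute] using (analyticAt_pi_iff.1 h) (e a)
  · exact fun h => AnalyticAt.pi fun a => (analyticAt_pi_iff.1 h) (e.symm a)

theorem ratioOf_permute_iff {i : Fin 3} {g u : ℂ → Fin 3 → ℂ} :
    RatioOf (m := 2) (e i) (permute e g) (permute e u) ↔ RatioOf (m := 2) i g u := by
  constructor
  · rintro ⟨h1, h2, h3, h4⟩
    refine ⟨analyticAt_permute_iff.1 h1, fun t => by simpa [permute] using h2 t,
      by simpa [permute] using h3, fun a => by simpa [permute] using h4 (e a)⟩
  · rintro ⟨h1, h2, h3, h4⟩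
    refine ⟨analyticAt_permute_iff.2 h1, fun t => by simpa [permute] using h2 t,
      by simpa [permute] using h3, fun a => by simpa [permute] using h4 (e.symm a)⟩

theorem lift3_permute_iff {i j l : Fin 3} {g U V W : ℂ → Fin 3 → ℂ} :
    Lift3 (m := 2) (e i) (e j) (e l) (permute e g) (permute e U) (permute e V) (permute e W) ↔
      Lift3 (m := 2) i j l g U V W := by
  constructor
  · rintro ⟨h1, h2, h3⟩
    rw [keep_permute] at h2
    rw [keep_permute, keep_permute] at h3
    exact ⟨ratioOf_permute_iff.1 h1, ratioOf_permute_iff.1 h2, ratioOf_permute_iff.1 h3⟩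
  · rintro ⟨h1, h2, h3⟩
    refine ⟨ratioOf_permute_iff.2 h1, ?_, ?_⟩
    · rw [keep_permute]
      exact ratioOf_permute_iff.2 h2
    · rw [keep_permute, keep_permute]
      exact ratioOf_permute_iff.2 h3

/-- The coordinates of `p` in the chart `e i, e j, e l`, with components permuted by `e`. -/
def CoordsIn (e : Equiv.Perm (Fin 3)) (i j l : Fin 3) (p : Point 2 3) (x U V W : Fin 3 → ℂ) :
    Prop :=
  HasCoords (m := 2) (e i) (e j) (e l) p (x ∘ e.symm) (U ∘ e.symm) (V ∘ e.symm) (W ∘ e.symm)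

theorem exists_coordsIn_point (e : Equiv.Perm (Fin 3)) (i j l : Fin 3) (x : Fin 3 → ℂ)
    {U V W : Fin 3 → ℂ} (hU : U i = 1) (hV : V j = 1) (hW : W l = 1) :
    ∃ p, CoordsIn e i j l p x U V W :=
  exists_hasCoords (m := 2) (e i) (e j) (e l) _ (by simpa using hU) (by simpa using hV)
    (by simpa using hW)

theorem coordsIn_self {i j l : Fin 3} {p : Point 2 3}
    (hp : p ∈ (tower 2 3).src (word3 (e i) (e j) (e l))) :
    CoordsIn e i j l p (base p ∘ e) (lastVec (m := 2) (k := 0) () (e i) (proj (proj p)) ∘ e)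
      (lastVec (m := 2) (word1 (e i)) (e j) (proj p) ∘ e)
      (lastVec (m := 2) (word2 (e i) (e j)) (e l) p ∘ e) := by
  have h : ∀ f : Fin 3 → ℂ, (f ∘ e) ∘ e.symm = f := fun f => by
    funext a
    simp
  unfold CoordsIn
  rw [h, h, h, h]
  exact hasCoords_self hp

theorem CoordsIn.normalized {i j l : Fin 3} {p : Point 2 3} {x U V W : Fin 3 → ℂ}
    (h : CoordsIn e i j l p x U V W) : U i = 1 ∧ V j = 1 ∧ W l = 1 := by
  have h1 := (congrFun h.one (e i)).symm.trans (lastVec_self _ _ _)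
  have h2 := (congrFun h.two (e j)).symm.trans (lastVec_self _ _ _)
  have h3 := (congrFun h.three (e l)).symm.trans (lastVec_self _ _ _)
  simp only [Function.comp_apply, Equiv.symm_apply_apply] at h1 h2 h3
  exact ⟨h1, h2, h3⟩

theorem CoordsIn.mem_RVT_iff {i j l : Fin 3} {p : Point 2 3} {x U V W : Fin 3 → ℂ}
    (h : CoordsIn e i j l p x U V W) : p ∈ RVT 2 ↔ V i = 0 ∧ W j ≠ 0 ∧ W i = 0 := by
  rw [MonsterTower.mem_RVT_iff h.mem, h.two, h.three]
  simp

theorem CoordsIn.mem_RVL_iff {i j l : Fin 3} {p : Point 2 3} {x U V W : Fin 3 → ℂ}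
    (h : CoordsIn e i j l p x U V W) : p ∈ RVL 2 ↔ V i = 0 ∧ W j = 0 ∧ W i = 0 := by
  rw [MonsterTower.mem_RVL_iff h.mem, h.two, h.three]
  simp

theorem CoordsIn.isCritical_iff {i j l : Fin 3} {p : Point 2 3} {x U V W : Fin 3 → ℂ}
    (h : CoordsIn e i j l p x U V W) : IsCritical p ↔ W j = 0 ∨ V i = 0 ∧ W i = 0 := by
  rw [MonsterTower.isCritical_three_iff h.mem, h.two, h.three]
  simp

theorem CoordsIn.mem_germAt_iff {i j l : Fin 3} {p : Point 2 3} {x U V W : Fin 3 → ℂ}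
    (h : CoordsIn e i j l p x U V W) {γ : ℂ → Fin 3 → ℂ} :
    γ ∈ GermAt (m := 2) p ↔ AnalyticAt ℂ γ 0 ∧ ∃ g u v w, γ = permute e g ∧
      Lift3 (m := 2) i j l g u v w ∧ g 0 = x ∧ u 0 = U ∧ v 0 = V ∧ w 0 = W ∧
      ∀ a, IsCritIndex (m := 2) i j l V W a → deriv (fun t => keep (m := 2) l
        (keep (m := 2) j (keep (m := 2) i g u) v) w t a) 0 ≠ 0 := by
  have hcomp : ∀ {f f' : Fin 3 → ℂ}, f ∘ e.symm = f' ∘ e.symm → f = f' := fun {f f'} hf => by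
    funext a
    simpa using congrFun hf (e a)
  have hcrit : ∀ {V W : Fin 3 → ℂ} {a : Fin 3}, IsCritIndex (m := 2) (e i) (e j) (e l)
      (V ∘ e.symm) (W ∘ e.symm) (e a) ↔ IsCritIndex (m := 2) i j l V W a := by
    intro V W a
    simp [IsCritIndex]
  rw [mem_germAt_three h.mem]
  refine and_congr_right fun hγ => ⟨?_, ?_⟩
  · rintro ⟨u, v, w, hl, hc, hd⟩
    refine ⟨permute e.symm γ, permute e.symm u, permute e.symm v, permute e.symm w,
      (permute_permute γ).symm, ?_, ?_, ?_, ?_, ?_, ?_⟩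
    · rw [← lift3_permute_iff (e := e)]
      simpa only [permute_permute] using hl
    · exact hcomp ((congrFun (permute_permute (e := e) γ) 0).trans (hc.base_eq.symm.trans h.base_eq))
    · exact hcomp ((congrFun (permute_permute (e := e) u) 0).trans (hc.one.symm.trans h.one))
    · exact hcomp ((congrFun (permute_permute (e := e) v) 0).trans (hc.two.symm.trans h.two))
    · exact hcomp ((congrFun (permute_permute (e := e) w) 0).trans (hc.three.symm.trans h.three))
    · intro a ha
      have h1 := hd (e a) (by rwa [hc.two.symm.trans h.two, hc.three.symm.trans h.three, hcrit])
      rw [← permute_permute (e := e) γ, ← permute_permute (e := e) u, ← permute_permute (e := e) v,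
        ← permute_permute (e := e) w, keep_permute, keep_permute, keep_permute] at h1
      simpa only [permute_apply, permute_permute] using h1
  · rintro ⟨g, u, v, w, rfl, hl, rfl, rfl, rfl, rfl, hd⟩
    refine ⟨permute e u, permute e v, permute e w, lift3_permute_iff.2 hl, h, fun a ha => ?_⟩
    obtain ⟨a, rfl⟩ := e.surjective a
    rw [keep_permute, keep_permute, keep_permute]
    simp only [permute_apply]
    exact hd a (hcrit.1 ha)

theorem exists_perm (i : Fin 3) : ∃ e : Equiv.Perm (Fin 3), e 0 = i := by
  revert i
  decide

theorem exists_perm_pair {i j : Fin 3} (h : j ≠ i) :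
    ∃ e : Equiv.Perm (Fin 3), e 0 = i ∧ e 1 = j := by
  revert i j
  decide

theorem perm_eq {e : Equiv.Perm (Fin 3)} {s : Fin 3} (h0 : s ≠ e 0) (h1 : s ≠ e 1) : s = e 2 := by
  obtain ⟨a, rfl⟩ := e.surjective s
  fin_cases a
  · exact absurd rfl h0
  · exact absurd rfl h1
  · rfl

/-- Every point has one of five normal positions in a suitable chart. -/
theorem exists_coordsIn (p : Point 2 3) : ∃ (e : Equiv.Perm (Fin 3)) (x U V W : Fin 3 → ℂ),
    CoordsIn e 0 0 0 p x U V W ∨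
    (CoordsIn e 0 0 1 p x U V W ∧ W 0 = 0) ∨
    (CoordsIn e 0 1 1 p x U V W ∧ V 0 = 0) ∨
    (CoordsIn e 0 1 0 p x U V W ∧ V 0 = 0 ∧ W 1 = 0) ∨
    (CoordsIn e 0 1 2 p x U V W ∧ V 0 = 0 ∧ W 0 = 0 ∧ W 1 = 0) := by
  obtain ⟨i, hi⟩ := exists_mem_src_of_proj (m := 2) (k := 0) (w := ()) (P := proj (proj p)) trivial
  obtain ⟨j, hj⟩ := exists_mem_src_of_proj (w := word1 i) (P := proj p) hi
  obtain ⟨l, hl⟩ := exists_mem_src_of_proj (w := word2 i j) (P := p) hj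
  by_cases h2 : lastVec (word1 i) j (proj p) i = 0
  · have hij : j ≠ i := by
      rintro rfl
      rw [lastVec_self] at h2
      exact one_ne_zero h2
    obtain ⟨e, rfl, rfl⟩ := exists_perm_pair hij
    by_cases h3 : lastVec (word2 (e 0) (e 1)) l p (e 1) = 0
    · by_cases h4 : lastVec (word2 (e 0) (e 1)) l p (e 0) = 0
      · have hl' : l = e 2 := by
          refine perm_eq ?_ ?_ <;> rintro rfl
          · rw [lastVec_self] at h4
            exact one_ne_zero h4
          · rw [lastVec_self] at h3
            exact one_ne_zero h3
        subst hl'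
        exact ⟨e, _, _, _, _, Or.inr (Or.inr (Or.inr (Or.inr ⟨coordsIn_self hl, h2, h4, h3⟩)))⟩
      · have hl' := mem_src_of_lastVec_ne_zero hl h4
        exact ⟨e, _, _, _, _, Or.inr (Or.inr (Or.inr (Or.inl ⟨coordsIn_self hl', h2,
          (lastVec_change hl hl' _).1 h3⟩)))⟩
    · have hl' := mem_src_of_lastVec_ne_zero hl h3
      exact ⟨e, _, _, _, _, Or.inr (Or.inr (Or.inl ⟨coordsIn_self hl', h2⟩))⟩
  -- A nonvertical direction has nonzero `i`-th component, so the letter `i` can be repeated at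
  -- level two.
  · have hj' := mem_src_of_lastVec_ne_zero hj h2
    obtain ⟨l, hl⟩ := exists_mem_src_of_proj (w := word2 i i) (P := p) hj'
    by_cases h3 : lastVec (word2 i i) l p i = 0
    · have hli : l ≠ i := by
        rintro rfl
        rw [lastVec_self] at h3
        exact one_ne_zero h3
      obtain ⟨e, rfl, rfl⟩ := exists_perm_pair hli
      exact ⟨e, _, _, _, _, Or.inr (Or.inl ⟨coordsIn_self hl, h3⟩)⟩
    · obtain ⟨e, rfl⟩ := exists_perm i
      exact ⟨e, _, _, _, _, Or.inl (coordsIn_self (mem_src_of_lastVec_ne_zero hl h3))⟩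

end

section

open Stage

/-! ## Embedding dimension -/

theorem hasCodimAt_univ {E : Type*} [NormedAddCommGroup E] [NormedSpace ℂ E] (x : E) :
    HasCodimAt (Set.univ : Set E) x 0 :=
  ⟨0, analyticAt_const, fun _ => ⟨0, Subsingleton.elim _ _⟩,
    Eventually.of_forall fun _ => iff_of_true trivial (Subsingleton.elim _ _)⟩

theorem embDim_le {γ : ℂ → Fin 3 → ℂ} : embDim (m := 2) γ ≤ 3 :=
  Nat.sInf_le ⟨Set.univ, 0, rfl, fun x _ => hasCodimAt_univ x,
    Eventually.of_forall fun _ => trivial⟩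

variable {e : Equiv.Perm (Fin 3)}

/-- The germ lies on the graph of an entire function, a smooth hypersurface: the defining equation
has derivative `1` along the axis `e 2`. -/
theorem embDim_le_two_of_graph {g : ℂ → Fin 3 → ℂ} (F : ℂ × ℂ → ℂ) (hF : ContDiff ℂ ⊤ F)
    (h : ∀ t, g t 2 = F (g t 0, g t 1)) : embDim (m := 2) (permute e g) ≤ 2 := by
  refine Nat.sInf_le ⟨{q | q (e 2) = F (q (e 0), q (e 1))}, 1, rfl, fun x _ => ?_,
    Eventually.of_forall fun t => ?_⟩
  · have hG : AnalyticAt ℂ (fun q : Fin 3 → ℂ => fun _ : Fin 1 => q (e 2) - F (q (e 0), q (e 1)))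
        x := by
      have hp : ∀ a, AnalyticAt ℂ (fun q : Fin 3 → ℂ => q a) x := fun a =>
        (ContinuousLinearMap.proj (R := ℂ) (φ := fun _ : Fin 3 => ℂ) a).analyticAt x
      refine AnalyticAt.pi fun _ => (hp _).sub ?_
      exact hF.contDiffAt.analyticAt.fun_comp (f := fun q : Fin 3 → ℂ => (q (e 0), q (e 1))) ((hp _).prod (hp _))
    refine ⟨_, hG, ?_, Eventually.of_forall fun y => ?_⟩
    · have hv : fderiv ℂ (fun q : Fin 3 → ℂ => fun _ : Fin 1 => q (e 2) - F (q (e 0), q (e 1))) x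
          (Pi.single (e 2) 1) = fun _ => 1 := by
        have h1 := hG.differentiableAt.hasFDerivAt.comp_hasDerivAt_of_eq (0 : ℂ)
          (f := fun s : ℂ => x + s • Pi.single (e 2) (1 : ℂ))
          (((hasDerivAt_id (0 : ℂ)).smul_const (Pi.single (e 2) (1 : ℂ))).const_add x)
          (by simp)
        have h2 : HasDerivAt (fun s : ℂ => fun _ : Fin 1 => x (e 2) + s - F (x (e 0), x (e 1)))
            (fun _ => 1) 0 :=
          hasDerivAt_pi.2 fun _ => ((hasDerivAt_id (0 : ℂ)).const_add _).sub_const _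
        rw [one_smul] at h1
        refine h1.unique (h2.congr_of_eventuallyEq (Eventually.of_forall fun s => ?_))
        funext i
        simp
      intro y
      refine ⟨y 0 • Pi.single (e 2) 1, ?_⟩
      rw [map_smul, hv]
      funext i
      rw [Subsingleton.elim i 0]
      simp
    · simp [funext_iff, sub_eq_zero]
  · simpa only [Set.mem_ofPred_eq, permute_apply] using h t

/-! ## Explicit germs -/

/-- `f₁`, `f₂`, `f₃` are the derivatives of the denominators at the three steps, and `r` collects
the coframe components of the final velocity at `0`. For polynomial lifts everything reduces to
checking derivatives. -/
theorem CoordsIn.mem_germAt_of_formulas {i j l : Fin 3} {p : Point 2 3} {x U V W : Fin 3 → ℂ}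
    (h : CoordsIn e i j l p x U V W) (g u v w : ℂ → Fin 3 → ℂ) (f₁ f₂ f₃ : ℂ → ℂ)
    (r : Fin 3 → ℂ) (hg0 : g 0 = x) (hu0 : u 0 = U) (hv0 : v 0 = V) (hw0 : w 0 = W)
    (hg : ∀ a t, HasDerivAt (fun s => g s a) (f₁ t * u t a) t)
    (hu : ∀ a t, HasDerivAt (fun s => keep (m := 2) i g u s a) (f₂ t * v t a) t)
    (hv : ∀ a t, HasDerivAt (fun s => keep (m := 2) j (keep (m := 2) i g u) v s a)
      (f₃ t * w t a) t)
    (hw : ∀ a, HasDerivAt (fun s => keep (m := 2) l (keep (m := 2) j (keep (m := 2) i g u) v) w s a)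
      (r a) 0)
    (hud : ∀ a, Differentiable ℂ fun t => u t a) (hvd : ∀ a, Differentiable ℂ fun t => v t a)
    (hwd : ∀ a, Differentiable ℂ fun t => w t a)
    (hui : ∀ t, u t i = 1) (hvj : ∀ t, v t j = 1) (hwl : ∀ t, w t l = 1)
    (hf₁ : ∀ t, t ≠ 0 → f₁ t ≠ 0) (hf₂ : ∀ t, t ≠ 0 → f₂ t ≠ 0) (hf₃ : ∀ t, t ≠ 0 → f₃ t ≠ 0)
    (hr : ∀ a, IsCritIndex (m := 2) i j l V W a → r a ≠ 0) :
    permute e g ∈ GermAt (m := 2) p := by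
  have han : ∀ {f : ℂ → Fin 3 → ℂ}, (∀ a, Differentiable ℂ fun t => f t a) → AnalyticAt ℂ f 0 :=
    fun {f} hf => AnalyticAt.pi fun a => (hf a).analyticAt 0
  have hmk : ∀ {i : Fin 3} {g u : ℂ → Fin 3 → ℂ} {f : ℂ → ℂ}, (∀ t, u t i = 1) →
      (∀ a, Differentiable ℂ fun t => u t a) → (∀ t, t ≠ 0 → f t ≠ 0) →
      (∀ a t, HasDerivAt (fun s => g s a) (f t * u t a) t) → RatioOf (m := 2) i g u := by
    intro i g u f h1 h2 h3 h4
    have h5 : ∀ t, deriv (fun s => g s i) t = f t := fun t => by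
      rw [(h4 i t).deriv, h1, mul_one]
    refine ⟨han h2, h1, ?_, fun a => Eventually.of_forall fun t => ?_⟩
    · filter_upwards [self_mem_nhdsWithin] with t ht
      rw [h5]
      exact h3 t ht
    · rw [h5, (h4 a t).deriv]
  refine h.mem_germAt_iff.2 ⟨analyticAt_permute_iff.2
    (han fun a t => (hg a t).differentiableAt), g, u, v, w, rfl,
    ⟨hmk hui hud hf₁ hg, hmk hvj hvd hf₂ hu, hmk hwl hwd hf₃ hv⟩, hg0, hu0, hv0, hw0,
    fun a ha => ?_⟩
  rw [(hw a).deriv]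
  exact hr a ha

/-- RRR: with `w` constant and the first axis as parameter, three integrations give cubic
polynomials, so the third component is a function of the first. -/
theorem exists_planar_germ_of_first_first_first {p : Point 2 3} {x U V W : Fin 3 → ℂ}
    (h : CoordsIn e 0 0 0 p x U V W) :
    ∃ γ ∈ GermAt (m := 2) p, embDim (m := 2) γ ≤ 2 := by
  obtain ⟨hU, hV, hW⟩ := h.normalized
  refine ⟨_, h.mem_germAt_of_formulas
    (fun t => ![x 0 + t, x 1 + U 1 * t + V 1 * t ^ 2 / 2 + W 1 * t ^ 3 / 6,
      x 2 + U 2 * t + V 2 * t ^ 2 / 2 + W 2 * t ^ 3 / 6])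
    (fun t => ![1, U 1 + V 1 * t + W 1 * t ^ 2 / 2, U 2 + V 2 * t + W 2 * t ^ 2 / 2])
    (fun t => ![1, V 1 + W 1 * t, V 2 + W 2 * t]) (fun _ => ![1, W 1, W 2])
    (fun _ => 1) (fun _ => 1) (fun _ => 1) ![1, 0, 0]
    ?_ ?_ ?_ ?_ ?_ ?_ ?_ ?_ ?_ ?_ ?_ ?_ ?_ ?_ ?_ ?_ ?_ ?_, ?_⟩
  rotate_right
  · refine embDim_le_two_of_graph (fun q => x 2 + U 2 * (q.1 - x 0) + V 2 * (q.1 - x 0) ^ 2 / 2 +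
      W 2 * (q.1 - x 0) ^ 3 / 6) (by fun_prop) fun t => ?_
    simp
  iterate 4
    funext a
    fin_cases a <;> simp [hU, hV, hW]
  iterate 3
    intro a t
    fin_cases a <;>
    · simp only [keep]
      refine HasDerivAt.congr_deriv (DifferentiableAt.hasDerivAt (by simp; try fun_prop)) ?_
      simp (disch := fun_prop) [deriv_fun_add]
      try ring
  · intro a
    fin_cases a <;>
    · simp only [keep]
      refine HasDerivAt.congr_deriv (DifferentiableAt.hasDerivAt (by simp; try fun_prop)) ?_
      simp (disch := fun_prop)
  iterate 3
    intro a
    fin_cases a <;> (simp; try fun_prop)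
  iterate 3 simp
  iterate 3
    intro t ht
    simp
  · intro a
    fin_cases a <;> simp [IsCritIndex, hV]

/-- RRV: the first component is quadratic in the parameter. The only odd terms are multiples of `t ^
5`, and the one in the third component is eliminated through the second. -/
theorem exists_planar_germ_of_first_first_second {p : Point 2 3} {x U V W : Fin 3 → ℂ}
    (h : CoordsIn e 0 0 1 p x U V W) (h1 : W 0 = 0) :
    ∃ γ ∈ GermAt (m := 2) p, embDim (m := 2) γ ≤ 2 := by
  obtain ⟨hU, hV, hW⟩ := h.normalized
  refine ⟨_, h.mem_germAt_of_formulas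
    (fun t => ![x 0 + t ^ 2 / 2, x 1 + U 1 * t ^ 2 / 2 + V 1 * t ^ 4 / 8 + t ^ 5 / 15,
      x 2 + U 2 * t ^ 2 / 2 + V 2 * t ^ 4 / 8 + W 2 * t ^ 5 / 15])
    (fun t => ![1, U 1 + V 1 * t ^ 2 / 2 + t ^ 3 / 3, U 2 + V 2 * t ^ 2 / 2 + W 2 * t ^ 3 / 3])
    (fun t => ![1, V 1 + t, V 2 + W 2 * t]) (fun t => ![t, 1, W 2])
    (fun t => t) (fun t => t) (fun _ => 1) ![1, 1, 0]
    ?_ ?_ ?_ ?_ ?_ ?_ ?_ ?_ ?_ ?_ ?_ ?_ ?_ ?_ ?_ ?_ ?_ ?_, ?_⟩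
  rotate_right
  · refine embDim_le_two_of_graph (fun q => x 2 + U 2 * (q.1 - x 0) + V 2 * (q.1 - x 0) ^ 2 / 2 +
      W 2 * (q.2 - x 1 - U 1 * (q.1 - x 0) - V 1 * (q.1 - x 0) ^ 2 / 2)) (by fun_prop) fun t => ?_
    simp
    ring
  iterate 4
    funext a
    fin_cases a <;> simp [hU, hV, hW, h1]
  iterate 3
    intro a t
    fin_cases a <;>
    · simp only [keep]
      refine HasDerivAt.congr_deriv (DifferentiableAt.hasDerivAt (by simp; try fun_prop)) ?_
      simp (disch := fun_prop) [deriv_fun_add]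
      try ring
  · intro a
    fin_cases a <;>
    · simp only [keep]
      refine HasDerivAt.congr_deriv (DifferentiableAt.hasDerivAt (by simp; try fun_prop)) ?_
      simp (disch := fun_prop)
  iterate 3
    intro a
    fin_cases a <;> (simp; try fun_prop)
  iterate 3 simp
  iterate 3
    intro t ht
    simp [ht]
  · intro a
    fin_cases a <;> simp [IsCritIndex, hV, h1]

/-- RVR: triangular orders 2, 3, 4. The term `t ^ 4` is a multiple of the square of the first
component, which requires `W 0 ≠ 0`. -/
theorem exists_planar_germ_of_first_second_second {p : Point 2 3} {x U V W : Fin 3 → ℂ}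
    (h : CoordsIn e 0 1 1 p x U V W) (h1 : V 0 = 0) (h2 : W 0 ≠ 0) :
    ∃ γ ∈ GermAt (m := 2) p, embDim (m := 2) γ ≤ 2 := by
  obtain ⟨hU, hV, hW⟩ := h.normalized
  refine ⟨_, h.mem_germAt_of_formulas
    (fun t => ![x 0 + W 0 * t ^ 2 / 2, x 1 + U 1 * W 0 * t ^ 2 / 2 + W 0 * t ^ 3 / 3,
      x 2 + U 2 * W 0 * t ^ 2 / 2 + V 2 * W 0 * t ^ 3 / 3 + W 2 * W 0 * t ^ 4 / 8])
    (fun t => ![1, U 1 + t, U 2 + V 2 * t + W 2 * t ^ 2 / 2])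
    (fun t => ![W 0 * t, 1, V 2 + W 2 * t]) (fun _ => ![W 0, 1, W 2])
    (fun t => W 0 * t) (fun _ => 1) (fun _ => 1) ![0, 1, 0]
    ?_ ?_ ?_ ?_ ?_ ?_ ?_ ?_ ?_ ?_ ?_ ?_ ?_ ?_ ?_ ?_ ?_ ?_, ?_⟩
  rotate_right
  · refine embDim_le_two_of_graph (fun q => x 2 + U 2 * (q.1 - x 0) + V 2 * (q.2 - x 1 - U 1 * (q.1 - x 0)) +
      W 2 / (2 * W 0) * (q.1 - x 0) ^ 2) (by fun_prop) fun t => ?_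
    simp
    field_simp
    ring
  iterate 4
    funext a
    fin_cases a <;> simp [hU, hV, hW, h1]
  iterate 3
    intro a t
    fin_cases a <;>
    · simp only [keep]
      refine HasDerivAt.congr_deriv (DifferentiableAt.hasDerivAt (by simp; try fun_prop)) ?_
      simp (disch := fun_prop) [deriv_fun_add]
      try ring
  · intro a
    fin_cases a <;>
    · simp only [keep]
      refine HasDerivAt.congr_deriv (DifferentiableAt.hasDerivAt (by simp; try fun_prop)) ?_
      simp (disch := fun_prop)
  iterate 3
    intro a
    fin_cases a <;> (simp; try fun_prop)
  iterate 3 simp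
  iterate 3
    intro t ht
    simp [ht, h2]
  · intro a
    fin_cases a <;> simp [IsCritIndex, hV, h1, h2]

/-- RVT: terms of degrees 3, 4, 5. Since 5 is not in the semigroup generated by 3 and 4, the term `t
^ 5` cannot be absorbed; it is absent exactly when `W 2 = 0`. -/
theorem exists_germ_of_first_second_second {p : Point 2 3} {x U V W : Fin 3 → ℂ}
    (h : CoordsIn e 0 1 1 p x U V W) (h1 : V 0 = 0) (h2 : W 0 = 0) :
    ∃ γ ∈ GermAt (m := 2) p, (W 2 = 0 → embDim (m := 2) γ ≤ 2) := by
  obtain ⟨hU, hV, hW⟩ := h.normalized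
  refine ⟨_, h.mem_germAt_of_formulas
    (fun t => ![x 0 + t ^ 3 / 6, x 1 + U 1 * t ^ 3 / 6 + t ^ 4 / 8,
      x 2 + U 2 * t ^ 3 / 6 + V 2 * t ^ 4 / 8 + W 2 * t ^ 5 / 20])
    (fun t => ![1, U 1 + t, U 2 + V 2 * t + W 2 * t ^ 2 / 2])
    (fun t => ![t ^ 2 / 2, 1, V 2 + W 2 * t]) (fun t => ![t, 1, W 2])
    (fun t => t ^ 2 / 2) (fun _ => 1) (fun _ => 1) ![1, 1, 0]
    ?_ ?_ ?_ ?_ ?_ ?_ ?_ ?_ ?_ ?_ ?_ ?_ ?_ ?_ ?_ ?_ ?_ ?_, fun h3 => ?_⟩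
  rotate_right
  · refine embDim_le_two_of_graph (fun q => x 2 + U 2 * (q.1 - x 0) + V 2 * (q.2 - x 1 - U 1 * (q.1 - x 0))) (by fun_prop) fun t => ?_
    simp [h3]
    ring
  iterate 4
    funext a
    fin_cases a <;> simp [hU, hV, hW, h1, h2]
  iterate 3
    intro a t
    fin_cases a <;>
    · simp only [keep]
      refine HasDerivAt.congr_deriv (DifferentiableAt.hasDerivAt (by simp; try fun_prop)) ?_
      simp (disch := fun_prop) [deriv_fun_add]
      try ring
  · intro a
    fin_cases a <;>
    · simp only [keep]
      refine HasDerivAt.congr_deriv (DifferentiableAt.hasDerivAt (by simp; try fun_prop)) ?_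
      simp (disch := fun_prop)
  iterate 3
    intro a
    fin_cases a <;> (simp; try fun_prop)
  iterate 3 simp
  iterate 3
    intro t ht
    simp [ht]
  · intro a
    fin_cases a <;> simp [IsCritIndex, hV, h1, h2]

/-- RVV without L: terms of degrees 3, 5, 6, and `t ^ 6` is a multiple of the square of the first
component. -/
theorem exists_planar_germ_of_first_second_first {p : Point 2 3} {x U V W : Fin 3 → ℂ}
    (h : CoordsIn e 0 1 0 p x U V W) (h1 : V 0 = 0) (h2 : W 1 = 0) :
    ∃ γ ∈ GermAt (m := 2) p, embDim (m := 2) γ ≤ 2 := by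
  obtain ⟨hU, hV, hW⟩ := h.normalized
  refine ⟨_, h.mem_germAt_of_formulas
    (fun t => ![x 0 + t ^ 3 / 3, x 1 + U 1 * t ^ 3 / 3 + t ^ 5 / 10,
      x 2 + U 2 * t ^ 3 / 3 + V 2 * t ^ 5 / 10 + W 2 * t ^ 6 / 18])
    (fun t => ![1, U 1 + t ^ 2 / 2, U 2 + V 2 * t ^ 2 / 2 + W 2 * t ^ 3 / 3])
    (fun t => ![t, 1, V 2 + W 2 * t]) (fun t => ![1, t, W 2])
    (fun t => t ^ 2) (fun t => t) (fun _ => 1) ![1, 1, 0]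
    ?_ ?_ ?_ ?_ ?_ ?_ ?_ ?_ ?_ ?_ ?_ ?_ ?_ ?_ ?_ ?_ ?_ ?_, ?_⟩
  rotate_right
  · refine embDim_le_two_of_graph (fun q => x 2 + U 2 * (q.1 - x 0) + V 2 * (q.2 - x 1 - U 1 * (q.1 - x 0)) +
      W 2 * (q.1 - x 0) ^ 2 / 2) (by fun_prop) fun t => ?_
    simp
    ring
  iterate 4
    funext a
    fin_cases a <;> simp [hU, hV, hW, h1, h2]
  iterate 3
    intro a t
    fin_cases a <;>
    · simp only [keep]
      refine HasDerivAt.congr_deriv (DifferentiableAt.hasDerivAt (by simp; try fun_prop)) ?_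
      simp (disch := fun_prop) [deriv_fun_add]
      try ring
  · intro a
    fin_cases a <;>
    · simp only [keep]
      refine HasDerivAt.congr_deriv (DifferentiableAt.hasDerivAt (by simp; try fun_prop)) ?_
      simp (disch := fun_prop)
  iterate 3
    intro a
    fin_cases a <;> (simp; try fun_prop)
  iterate 3 simp
  iterate 3
    intro t ht
    simp [ht]
  · intro a
    fin_cases a <;> simp [IsCritIndex, hV, h1, h2]

/-- RVL: taking `w = (t, t, 1)` and integrating gives terms of degrees 4, 6, 7. -/
theorem exists_germ_of_first_second_third {p : Point 2 3} {x U V W : Fin 3 → ℂ}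
    (h : CoordsIn e 0 1 2 p x U V W) (h1 : V 0 = 0) (h2 : W 0 = 0)
    (h3 : W 1 = 0) :
    (GermAt (m := 2) p).Nonempty := by
  obtain ⟨hU, hV, hW⟩ := h.normalized
  refine ⟨_, h.mem_germAt_of_formulas
    (fun t => ![x 0 + t ^ 4 / 8, x 1 + U 1 * t ^ 4 / 8 + t ^ 6 / 24,
      x 2 + U 2 * t ^ 4 / 8 + V 2 * t ^ 6 / 24 + t ^ 7 / 42])
    (fun t => ![1, U 1 + t ^ 2 / 2, U 2 + V 2 * t ^ 2 / 2 + t ^ 3 / 3])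
    (fun t => ![t ^ 2 / 2, 1, V 2 + t]) (fun t => ![t, t, 1])
    (fun t => t ^ 3 / 2) (fun t => t) (fun _ => 1) ![1, 1, 1]
    ?_ ?_ ?_ ?_ ?_ ?_ ?_ ?_ ?_ ?_ ?_ ?_ ?_ ?_ ?_ ?_ ?_ ?_⟩
  iterate 4
    funext a
    fin_cases a <;> simp [hU, hV, hW, h1, h2, h3]
  iterate 3
    intro a t
    fin_cases a <;>
    · simp only [keep]
      refine HasDerivAt.congr_deriv (DifferentiableAt.hasDerivAt (by simp; try fun_prop)) ?_
      simp (disch := fun_prop) [deriv_fun_add]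
      try ring
  · intro a
    fin_cases a <;>
    · simp only [keep]
      refine HasDerivAt.congr_deriv (DifferentiableAt.hasDerivAt (by simp; try fun_prop)) ?_
      simp (disch := fun_prop)
  iterate 3
    intro a
    fin_cases a <;> (simp; try fun_prop)
  iterate 3 simp
  iterate 3
    intro t ht
    simp [ht]
  · intro a
    fin_cases a <;> simp [IsCritIndex, hV, h1, h2, h3]

end

section

/-! ## Leading coefficients of analytic germs -/

/-- The germ `f` at `0` is `t ^ n` times an analytic germ with value `c`. -/
def Ord (n : ℕ) (c : ℂ) (f : ℂ → ℂ) : Prop :=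
  ∃ g : ℂ → ℂ, AnalyticAt ℂ g 0 ∧ g 0 = c ∧ ∀ᶠ t in 𝓝 0, f t = t ^ n * g t

theorem eventually_eq_of_punctured {E : Type*} [NormedAddCommGroup E] [NormedSpace ℂ E]
    {f g : ℂ → E} (hf : AnalyticAt ℂ f 0) (hg : AnalyticAt ℂ g 0)
    (h : ∀ᶠ t in 𝓝[≠] 0, f t = g t) : ∀ᶠ t in 𝓝 0, f t = g t :=
  (hf.frequently_eq_iff_eventually_eq hg).1 h.frequently

variable {n m : ℕ} {c d : ℂ} {f g : ℂ → ℂ}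

theorem Ord.congr (h : Ord n c f) (hfg : ∀ᶠ t in 𝓝 0, g t = f t) : Ord n c g := by
  obtain ⟨u, h1, h2, h3⟩ := h
  exact ⟨u, h1, h2, (hfg.and h3).mono fun t ht => ht.1.trans ht.2⟩

theorem Ord.analyticAt (h : Ord n c f) : AnalyticAt ℂ f 0 := by
  obtain ⟨u, h1, h2, h3⟩ := h
  exact ((analyticAt_id.pow n).mul h1).congr (h3.mono fun t ht => ht.symm)

theorem ord_zero (h : AnalyticAt ℂ f 0) : Ord 0 (f 0) f :=
  ⟨f, h, rfl, Eventually.of_forall fun t => by simp⟩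

theorem Ord.add (hf : Ord n c f) (hg : Ord n d g) : Ord n (c + d) (fun t => f t + g t) := by
  obtain ⟨u, h1, h2, h3⟩ := hf
  obtain ⟨v, h4, h5, h6⟩ := hg
  refine ⟨fun t => u t + v t, h1.add h4, by simp [h2, h5], ?_⟩
  filter_upwards [h3, h6] with t h7 h8
  rw [h7, h8]
  ring

theorem Ord.mul (hf : Ord n c f) (hg : Ord m d g) : Ord (n + m) (c * d) (fun t => f t * g t) := by
  obtain ⟨u, h1, h2, h3⟩ := hf
  obtain ⟨v, h4, h5, h6⟩ := hg
  refine ⟨fun t => u t * v t, h1.mul h4, by simp [h2, h5], ?_⟩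
  filter_upwards [h3, h6] with t h7 h8
  rw [h7, h8]
  ring

theorem Ord.const_mul (a : ℂ) (hf : Ord n c f) : Ord n (a * c) (fun t => a * f t) := by
  obtain ⟨u, h1, h2, h3⟩ := hf
  refine ⟨fun t => a * u t, analyticAt_const.mul h1, by simp [h2], ?_⟩
  filter_upwards [h3] with t h7
  rw [h7]
  ring

theorem Ord.succ_le (hf : Ord (n + 1) c f) : Ord n 0 f := by
  obtain ⟨u, h1, h2, h3⟩ := hf
  refine ⟨fun t => t * u t, analyticAt_id.mul h1, by simp, ?_⟩
  filter_upwards [h3] with t h7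
  rw [h7]
  ring

/-- `Ord` allows a zero coefficient and then only bounds the order from below. Weakening to
coefficient `0` makes terms of different orders summable by `Ord.add`. -/
theorem Ord.of_lt (hf : Ord m c f) (h : n < m) : Ord n 0 f := by
  induction m, h using Nat.le_induction generalizing c with
  | base => exact hf.succ_le
  | succ k _ ih => exact ih hf.succ_le

theorem Ord.unique (hf : Ord n c f) (hf' : Ord n d f) : c = d := by
  obtain ⟨u, h1, rfl, h3⟩ := hf
  obtain ⟨v, h4, rfl, h6⟩ := hf'
  refine (eventually_eq_of_punctured h1 h4 ?_).self_of_nhds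
  filter_upwards [self_mem_nhdsWithin, nhdsWithin_le_nhds h3, nhdsWithin_le_nhds h6] with t ht h7 h8
  exact mul_left_cancel₀ (pow_ne_zero n ht) (h7.symm.trans h8)

theorem Ord.eval (hf : Ord (n + 1) c f) : f 0 = 0 := by
  obtain ⟨u, h1, h2, h3⟩ := hf
  rw [h3.self_of_nhds]
  simp

theorem Ord.eventually_ne_zero (hf : Ord n c f) (hc : c ≠ 0) : ∀ᶠ t in 𝓝[≠] 0, f t ≠ 0 := by
  obtain ⟨u, h1, rfl, h3⟩ := hf
  filter_upwards [self_mem_nhdsWithin, nhdsWithin_le_nhds h3,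
    nhdsWithin_le_nhds (h1.continuousAt.eventually_ne hc)] with t ht h7 h8
  rw [h7]
  exact mul_ne_zero (pow_ne_zero n ht) h8

theorem Ord.deriv (hf : Ord (n + 1) c f) : Ord n ((n + 1) * c) (deriv f) := by
  obtain ⟨u, h1, rfl, h3⟩ := hf
  refine ⟨fun t => (n + 1) * u t + t * _root_.deriv u t,
    (analyticAt_const.mul h1).add (analyticAt_id.mul h1.deriv), by simp, ?_⟩
  filter_upwards [h3.eventually_nhds, h1.eventually_analyticAt] with t ht hu
  rw [EventuallyEq.deriv_eq ht, deriv_fun_mul (by fun_prop) hu.differentiableAt]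
  simp
  ring

theorem le_analyticOrderAt_iff_ord : (AnalyticAt ℂ f 0 ∧ (n : ℕ∞) ≤ analyticOrderAt f 0) ↔
    ∃ c, Ord n c f := by
  constructor
  · rintro ⟨h1, h2⟩
    obtain ⟨g, h3, h4⟩ := (natCast_le_analyticOrderAt h1).1 h2
    exact ⟨g 0, g, h3, rfl, by simpa using h4⟩
  · rintro ⟨c, h⟩
    refine ⟨h.analyticAt, (natCast_le_analyticOrderAt h.analyticAt).2 ?_⟩
    obtain ⟨u, h1, h2, h3⟩ := h
    exact ⟨u, h1, by simpa using h3⟩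

theorem ord_of_deriv (hf : AnalyticAt ℂ f 0) (h0 : f 0 = 0) (h : Ord n c (deriv f)) :
    Ord (n + 1) (c / (n + 1)) f := by
  have h1 := (le_analyticOrderAt_iff_ord.2 ⟨c, h⟩).2
  have h2 := hf.analyticOrderAt_deriv_add_one
  simp only [h0, sub_zero] at h2
  obtain ⟨d, hd⟩ := le_analyticOrderAt_iff_ord.1 ⟨hf, show ((n + 1 : ℕ) : ℕ∞) ≤ _ by
    rw [← h2]
    push_cast
    gcongr⟩
  have h3 : c / (n + 1) = d := by
    rw [h.unique hd.deriv]
    field_simp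
  rwa [h3]

/-- Exactness of the order of the denominator makes the quotient analytic across `0`; this is how
ratio coordinates of a given germ are built. -/
theorem Ord.exists_quotient (hf : Ord (n + m) c f) (hg : Ord n d g) (hd : d ≠ 0) :
    ∃ q, Ord m (c / d) q ∧ ∀ᶠ t in 𝓝 0, f t = g t * q t := by
  obtain ⟨u, h1, rfl, h3⟩ := hf
  obtain ⟨v, h4, rfl, h6⟩ := hg
  refine ⟨fun t => t ^ m * (u t / v t), ⟨fun t => u t / v t, h1.div h4 hd, rfl,
    Eventually.of_forall fun _ => rfl⟩, ?_⟩
  filter_upwards [h3, h6, h4.continuousAt.eventually_ne hd] with t h7 h8 h9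
  rw [h7, h8]
  field_simp
  ring

theorem Ord.sub_leading (hf : Ord n c f) : ∃ d, Ord (n + 1) d (fun t => f t - c * t ^ n) := by
  obtain ⟨u, h1, rfl, h3⟩ := hf
  have h5 : AnalyticAt ℂ (fun t => u t - u 0) 0 := h1.sub analyticAt_const
  obtain ⟨d, v, h4, -, h6⟩ := (le_analyticOrderAt_iff_ord (n := 1)).1 ⟨h5, by
      rw [Nat.cast_one, Order.one_le_iff_ne_zero, h5.analyticOrderAt_ne_zero]
      simp⟩
  refine ⟨v 0, v, h4, rfl, ?_⟩
  filter_upwards [h3, h6] with t h7 h8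
  rw [h7, ← mul_comm (t ^ n), ← mul_sub, h8]
  ring

theorem Ord.comp {τ : ℂ → ℂ} {a : ℂ} (hf : Ord n c f) (hτ : Ord 1 a τ) :
    Ord n (c * a ^ n) (fun t => f (τ t)) := by
  have h0 : τ 0 = 0 := Ord.eval (n := 0) hτ
  have hc := hτ.analyticAt
  obtain ⟨u, h1, rfl, h3⟩ := hf
  obtain ⟨v, h4, rfl, h6⟩ := hτ
  refine ⟨fun t => u (τ t) * v t ^ n, (AnalyticAt.fun_comp (g := u) (by rwa [h0]) hc).mul
    (h4.pow n), by simp [h0], ?_⟩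
  have h7 : Tendsto τ (𝓝 0) (𝓝 0) := by simpa [h0] using hc.continuousAt.tendsto
  filter_upwards [h7.eventually h3, h6] with t h8 h9
  rw [h8]
  nth_rw 1 [h9]
  ring

/-! ## Remainders -/

variable {E F : Type*} [NormedAddCommGroup E] [NormedSpace ℂ E] [NormedAddCommGroup F]
  [NormedSpace ℂ F]

/-- The germ `f` is analytic at `0` and vanishes there to order at least `n`. -/
def Rem (n : ℕ) (f : ℂ → E) : Prop :=
  ∃ g : ℂ → E, AnalyticAt ℂ g 0 ∧ ∀ᶠ t in 𝓝 0, f t = t ^ n • g t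

theorem rem_iff_ord : Rem n f ↔ ∃ c, Ord n c f :=
  ⟨fun ⟨g, h1, h2⟩ => ⟨g 0, g, h1, rfl, h2⟩, fun ⟨_, g, h1, _, h2⟩ => ⟨g, h1, h2⟩⟩

theorem Rem.analyticAt {f : ℂ → E} (h : Rem n f) : AnalyticAt ℂ f 0 := by
  obtain ⟨u, h1, h3⟩ := h
  exact ((analyticAt_id.pow n).smul h1).congr (h3.mono fun t ht => ht.symm)

theorem Rem.map {f : ℂ → E} (h : Rem n f) (A : E →L[ℂ] F) : Rem n (fun t => A (f t)) := by
  obtain ⟨u, h1, h3⟩ := h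
  refine ⟨fun t => A (u t), (A.analyticAt _).fun_comp h1, h3.mono fun t ht => ?_⟩
  simp only [ht, map_smul]

theorem rem_pi {ι : Type*} [Fintype ι] {f : ℂ → ι → ℂ} (h : ∀ i, Rem n (fun t => f t i)) :
    Rem n f := by
  choose g h1 h2 using h
  refine ⟨fun t i => g i t, AnalyticAt.pi h1, ?_⟩
  filter_upwards [eventually_all.2 h2] with t ht
  exact funext ht

theorem Rem.isBigO {f : ℂ → E} (h : Rem n f) : f =O[𝓝 0] fun t => t ^ n := by
  obtain ⟨u, h1, h3⟩ := h
  have h4 : u =O[𝓝 0] fun _ => (1 : ℂ) := h1.continuousAt.isBigO_one ℂ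
  have h5 := (Asymptotics.isBigO_refl (fun t : ℂ => t ^ n) (𝓝 0)).smul h4
  simp only [smul_eq_mul, mul_one] at h5
  exact EventuallyEq.trans_isBigO h3 h5

theorem rem_iff_le_analyticOrderAt {f : ℂ → E} (hf : AnalyticAt ℂ f 0) :
    Rem n f ↔ (n : ℕ∞) ≤ analyticOrderAt f 0 := by
  rw [natCast_le_analyticOrderAt hf]
  simp [Rem]

/-- If the order `k` were smaller than `n`, dividing by `t ^ k` would force the nonzero leading
coefficient to be a limit equal to `0`. -/
theorem rem_of_isBigO {f : ℂ → E} (hf : AnalyticAt ℂ f 0) (h : f =O[𝓝 0] fun t => t ^ n) :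
    Rem n f := by
  rw [rem_iff_le_analyticOrderAt hf]
  by_contra! hlt
  obtain ⟨k, hk⟩ := ENat.ne_top_iff_exists.1 hlt.ne_top
  obtain ⟨u, h1, h2, h3⟩ := hf.analyticOrderAt_eq_natCast.1 hk.symm
  rw [← hk] at hlt
  obtain ⟨j, rfl⟩ := Nat.exists_eq_add_of_lt (Nat.cast_lt.1 hlt)
  have h4 : u =O[𝓝[≠] 0] fun t => t ^ (j + 1) := by
    have h5 : (fun t : ℂ => (t ^ k)⁻¹ • f t) =O[𝓝[≠] 0] fun t => (t ^ k)⁻¹ • t ^ (k + j + 1) :=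
      (Asymptotics.isBigO_refl (fun t : ℂ => (t ^ k)⁻¹) _).smul (h.mono nhdsWithin_le_nhds)
    refine (h5.congr' ?_ ?_)
    · filter_upwards [self_mem_nhdsWithin, nhdsWithin_le_nhds h3] with t ht h6
      have h7 : t ^ k ≠ 0 := pow_ne_zero k ht
      rw [h6, sub_zero, smul_smul, inv_mul_cancel₀ h7, one_smul]
    · filter_upwards [self_mem_nhdsWithin] with t ht
      have h7 : t ^ k ≠ 0 := pow_ne_zero k ht
      rw [smul_eq_mul, add_assoc, pow_add, inv_mul_cancel_left₀ h7]
  have h5 : Tendsto (fun t : ℂ => t ^ (j + 1)) (𝓝[≠] 0) (𝓝 0) := by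
    have : ContinuousAt (fun t : ℂ => t ^ (j + 1)) 0 := by fun_prop
    simpa using this.tendsto.mono_left nhdsWithin_le_nhds
  exact h2 (tendsto_nhds_unique (h1.continuousAt.tendsto.mono_left nhdsWithin_le_nhds)
    (h4.trans_tendsto h5))

/-- The first order Taylor remainder of `G` is quadratic in `γ t - x`, hence of order `2 a`. For `a
= q + 3` this exceeds every exponent in `ords q`. -/
theorem Rem.taylor {a : ℕ} {γ : ℂ → E} {x : E} {G : E → F} (hG : AnalyticAt ℂ G x)
    (hγ : Rem a (fun t => γ t - x)) (ha : a ≠ 0) :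
    Rem (2 * a) (fun t => G (γ t) - G x - fderiv ℂ G x (γ t - x)) := by
  have h0 : γ 0 = x := by
    obtain ⟨u, -, h3⟩ := hγ
    have := h3.self_of_nhds
    rwa [zero_pow ha, zero_smul, sub_eq_zero] at this
  have hγa : AnalyticAt ℂ γ 0 := by
    simpa only [sub_add_cancel] using hγ.analyticAt.fun_add (analyticAt_const (v := x))
  obtain ⟨p, hp⟩ := hG
  have hp' := hp
  have hG : AnalyticAt ℂ G x := ⟨p, hp⟩
  refine rem_of_isBigO ?_ ?_
  · exact ((AnalyticAt.fun_comp (g := G) (by rwa [h0]) hγa).sub analyticAt_const).sub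
      (((fderiv ℂ G x).analyticAt _).fun_comp (hγa.sub analyticAt_const))
  · have h1 := hp.isBigO_sub_partialSum_pow 2
    have h2 : Tendsto (fun t => γ t - x) (𝓝 0) (𝓝 0) := by
      have := hγa.continuousAt.tendsto.sub_const x
      rwa [h0, sub_self] at this
    have h3 := h1.comp_tendsto h2
    have h4 : (fun t => ‖γ t - x‖ ^ 2) =O[𝓝 0] fun t => t ^ (2 * a) := by
      have := hγ.isBigO.norm_left.pow 2
      refine this.congr_right fun t => ?_
      ring
    refine (h3.congr_left fun t => ?_).trans h4
    simp only [Function.comp_apply, FormalMultilinearSeries.partialSum, Finset.sum_range_succ,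
      Finset.sum_range_zero, zero_add, add_sub_cancel]
    rw [hp.coeff_zero, hp.fderiv_eq]
    simp [sub_sub, continuousMultilinearCurryFin1_apply]
    congr
    ext i
    fin_cases i
    rfl

theorem rem_iff_sameJet {N : ℕ} {γ σ : ℂ → Fin (m + 1) → ℂ} (hγ : AnalyticAt ℂ γ 0)
    (hσ : AnalyticAt ℂ σ 0) : Rem (N + 1) (fun t => γ t - σ t) ↔ SameJet N γ σ := by
  rw [rem_iff_le_analyticOrderAt (hγ.fun_sub hσ),
    natCast_le_analyticOrderAt_iff_iteratedDeriv_eq_zero (hγ.fun_sub hσ)]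
  simp only [Nat.lt_succ_iff, SameJet]
  refine forall₂_congr fun i _ => ?_
  rw [← sub_eq_zero (a := iteratedDeriv i γ 0), ← iteratedDeriv_fun_sub hγ.contDiffAt hσ.contDiffAt]

end

section

/-! ## Germs in triangular form -/

/-- After a triangular linear change of coordinates, the components of `g - g 0` have the exact
orders `q + 3`, `2 q + 4`, `2 q + 5`. -/
structure TForm (q : ℕ) (g : ℂ → Fin 3 → ℂ) (u₁ u₂ v₂ : ℂ) (c : Fin 3 → ℂ) : Prop where
  ne_zero : ∀ i, c i ≠ 0
  zero : Ord (q + 3) (c 0) (fun t => g t 0 - g 0 0)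
  one : Ord (2 * q + 4) (c 1) (fun t => g t 1 - g 0 1 - u₁ * (g t 0 - g 0 0))
  two : Ord (2 * q + 5) (c 2) (fun t => g t 2 - g 0 2 - u₂ * (g t 0 - g 0 0) -
    v₂ * (g t 1 - g 0 1 - u₁ * (g t 0 - g 0 0)))

theorem analyticAt_apply {f : ℂ → Fin 3 → ℂ} {t : ℂ} (hf : AnalyticAt ℂ f t) (a : Fin 3) :
    AnalyticAt ℂ (fun s => f s a) t := analyticAt_pi_iff.1 hf a

theorem analyticAt_keep {i : Fin 3} {g u : ℂ → Fin 3 → ℂ} (hg : AnalyticAt ℂ g 0)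
    (hu : AnalyticAt ℂ u 0) : AnalyticAt ℂ (keep (m := 2) i g u) 0 := by
  refine AnalyticAt.pi fun a => ?_
  by_cases h : a = i
  · simpa [keep, h] using analyticAt_apply hg i
  · simpa [keep, h] using analyticAt_apply hu a

theorem RatioOf.eventually_eq {i : Fin 3} {g u : ℂ → Fin 3 → ℂ} (h : RatioOf (m := 2) i g u)
    (hg : AnalyticAt ℂ g 0) (a : Fin 3) :
    ∀ᶠ t in 𝓝 0, deriv (fun s => g s a) t = deriv (fun s => g s i) t * u t a :=
  eventually_eq_of_punctured (analyticAt_apply hg a).deriv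
    ((analyticAt_apply hg i).deriv.fun_mul (analyticAt_apply h.analytic a)) (h.eq a)

theorem ratioOf_mk {i : Fin 3} {g u : ℂ → Fin 3 → ℂ} (hu : ∀ a, AnalyticAt ℂ (fun t => u t a) 0)
    (hi : ∀ t, u t i = 1) (hne : ∀ᶠ t in 𝓝[≠] 0, deriv (fun s => g s i) t ≠ 0)
    (h : ∀ a, ∀ᶠ t in 𝓝 0, deriv (fun s => g s a) t = deriv (fun s => g s i) t * u t a) :
    RatioOf (m := 2) i g u :=
  ⟨AnalyticAt.pi hu, hi, hne, fun a => nhdsWithin_le_nhds (h a)⟩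

theorem ord_of_deriv_eq {n : ℕ} {c : ℂ} {f h : ℂ → ℂ} (hf : AnalyticAt ℂ f 0)
    (hd : ∀ᶠ t in 𝓝 0, deriv f t = h t) (hh : Ord n c h) :
    Ord (n + 1) (c / (n + 1)) (fun t => f t - f 0) := by
  refine ord_of_deriv (hf.fun_sub analyticAt_const) (sub_self _) ?_
  exact hh.congr (hd.mono fun t ht => by rw [deriv_sub_const, ht])

theorem ord_sub_of_deriv_ne_zero {f : ℂ → ℂ} (hf : AnalyticAt ℂ f 0) :
    Ord 1 (deriv f 0) (fun t => f t - f 0) := by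
  simpa using ord_of_deriv_eq hf (Eventually.of_forall fun _ => rfl) (ord_zero hf.deriv)

theorem natCast_succ_ne_zero (n : ℕ) : (n + 1 : ℂ) ≠ 0 := by exact_mod_cast n.succ_ne_zero

/-- The orders of the coordinates of a twice prolonged germ determine the orders of its
components. -/
theorem exists_tForm_of_ratioOf {q : ℕ} {g u v : ℂ → Fin 3 → ℂ} (hg : AnalyticAt ℂ g 0)
    (h₁ : RatioOf (m := 2) 0 g u) (h₂ : RatioOf (m := 2) 1 (keep (m := 2) 0 g u) v)
    {α β δ : ℂ} (hα : α ≠ 0) (hβ : β ≠ 0) (hδ : δ ≠ 0)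
    (hu : Ord (q + 1) α (fun t => u t 1 - u 0 1)) (hv0 : Ord 2 β (fun t => v t 0))
    (hv2 : Ord 1 δ (fun t => v t 2 - v 0 2)) :
    ∃ c, TForm q g (u 0 1) (u 0 2) (v 0 2) c := by
  have ga := analyticAt_apply hg
  have ua := analyticAt_apply h₁.analytic
  have hk := analyticAt_keep (i := 0) hg h₁.analytic
  have hy := h₁.eventually_eq hg 1
  have hz := h₁.eventually_eq hg 2
  have hx : ∀ᶠ t in 𝓝 0, deriv (fun s => g s 0) t = deriv (fun s => u s 1) t * v t 0 :=
    h₂.eventually_eq hk 0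
  have hu2 : ∀ᶠ t in 𝓝 0, deriv (fun s => u s 2) t = deriv (fun s => u s 1) t * v t 2 :=
    h₂.eventually_eq hk 2
  have hu' : Ord q ((q + 1) * α) (deriv fun s => u s 1) := by
    have := hu.deriv
    rwa [show deriv (fun t => u t 1 - u 0 1) = deriv fun s => u s 1 from
      funext fun t => deriv_sub_const _] at this
  -- From `x' = u₁' v₀` the orders `q` and `2` add up. Next, `y' - u₁(0) x' = (u₁ - u₁(0)) x'` has
  -- order `(q + 1) + (q + 2)`.
  have hx' : Ord (q + 2) ((q + 1) * α * β) (deriv fun s => g s 0) := (hu'.mul hv0).congr hx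
  have hX := ord_of_deriv_eq (ga 0) (Eventually.of_forall fun _ => rfl) hx'
  have hY : Ord (2 * q + 4) (α * ((q + 1) * α * β) / ((2 * q + 3 : ℕ) + 1))
      (fun t => g t 1 - g 0 1 - u 0 1 * (g t 0 - g 0 0)) := by
    have h1 : Ord (2 * q + 3) (α * ((q + 1) * α * β))
        (fun t => (u t 1 - u 0 1) * deriv (fun s => g s 0) t) := by
      have := hu.mul hx'
      rwa [show q + 1 + (q + 2) = 2 * q + 3 by ring] at this
    have h2 : AnalyticAt ℂ (fun t => g t 1 - u 0 1 * g t 0) 0 :=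
      (ga 1).fun_sub (analyticAt_const.fun_mul (ga 0))
    refine (ord_of_deriv_eq h2 ?_ h1).congr (Eventually.of_forall fun t => by ring)
    filter_upwards [hy, (ga 0).eventually_analyticAt, (ga 1).eventually_analyticAt] with t h3 h4 h5
    rw [deriv_fun_sub h5.differentiableAt (h4.differentiableAt.const_mul _), deriv_const_mul_field,
      h3]
    ring
  -- The second ratio, corrected by `v₂(0)` times the first, has derivative `u₁' (v₂ - v₂(0))`.
  -- Multiplied by `x'` it gives the derivative of the corrected third component.
  have hr : Ord (q + 2) ((q + 1) * α * δ / ((q + 1 : ℕ) + 1))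
      (fun t => u t 2 - u 0 2 - v 0 2 * (u t 1 - u 0 1)) := by
    have h2 : AnalyticAt ℂ (fun t => u t 2 - v 0 2 * u t 1) 0 :=
      (ua 2).fun_sub (analyticAt_const.fun_mul (ua 1))
    refine (ord_of_deriv_eq h2 ?_ (hu'.mul hv2)).congr (Eventually.of_forall fun t => by ring)
    filter_upwards [hu2, (ua 1).eventually_analyticAt, (ua 2).eventually_analyticAt] with t h3 h4 h5
    rw [deriv_fun_sub h5.differentiableAt (h4.differentiableAt.const_mul _), deriv_const_mul_field,
      h3]
    ring
  have hZ : Ord (2 * q + 5)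
      ((q + 1) * α * β * ((q + 1) * α * δ / ((q + 1 : ℕ) + 1)) / ((2 * q + 4 : ℕ) + 1))
      (fun t => g t 2 - g 0 2 - u 0 2 * (g t 0 - g 0 0) -
        v 0 2 * (g t 1 - g 0 1 - u 0 1 * (g t 0 - g 0 0))) := by
    have h1 := hx'.mul hr
    rw [show q + 2 + (q + 2) = 2 * q + 4 by ring] at h1
    have h2 : AnalyticAt ℂ
        (fun t => g t 2 - u 0 2 * g t 0 - v 0 2 * (g t 1 - u 0 1 * g t 0)) 0 :=
      ((ga 2).fun_sub (analyticAt_const.fun_mul (ga 0))).fun_sub (analyticAt_const.fun_mul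
        ((ga 1).fun_sub (analyticAt_const.fun_mul (ga 0))))
    refine (ord_of_deriv_eq h2 ?_ h1).congr (Eventually.of_forall fun t => by ring)
    filter_upwards [hy, hz, (ga 0).eventually_analyticAt, (ga 1).eventually_analyticAt,
      (ga 2).eventually_analyticAt] with t h3 h4 h5 h6 h7
    have d0 := h5.differentiableAt
    have d1 := h6.differentiableAt
    have d2 := h7.differentiableAt
    rw [deriv_fun_sub (d2.fun_sub (d0.const_mul _)) ((d1.fun_sub (d0.const_mul _)).const_mul _),
      deriv_fun_sub d2 (d0.const_mul _), deriv_const_mul_field, deriv_const_mul_field,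
      deriv_fun_sub d1 (d0.const_mul _), deriv_const_mul_field, h3, h4]
    ring
  have n1 := natCast_succ_ne_zero q
  have n2 := natCast_succ_ne_zero (2 * q + 3)
  have n3 := natCast_succ_ne_zero (2 * q + 4)
  have n4 := natCast_succ_ne_zero (q + 1)
  have n5 := natCast_succ_ne_zero (q + 2)
  refine ⟨![_, _, _], ?_, hX, hY, hZ⟩
  intro i
  fin_cases i
  · exact div_ne_zero (mul_ne_zero (mul_ne_zero n1 hα) hβ) n5
  · exact div_ne_zero (mul_ne_zero hα (mul_ne_zero (mul_ne_zero n1 hα) hβ)) n2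
  · exact div_ne_zero (mul_ne_zero (mul_ne_zero (mul_ne_zero n1 hα) hβ)
      (div_ne_zero (mul_ne_zero (mul_ne_zero n1 hα) hδ) n4)) n3

/-- The leading coefficient of the second ratio coordinate of a germ in triangular form. -/
def leadU (q : ℕ) (c : Fin 3 → ℂ) : ℂ :=
  ((2 * q + 3 : ℕ) + 1) * c 1 / (((q + 2 : ℕ) + 1) * c 0)

/-- The leading coefficient of the third twofold ratio coordinate of a germ in triangular form. -/
def leadV (q : ℕ) (c : Fin 3 → ℂ) : ℂ :=
  ((q + 1 : ℕ) + 1) * (((2 * q + 4 : ℕ) + 1) * c 2 / (((q + 2 : ℕ) + 1) * c 0)) /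
    ((q + 1) * leadU q c)

theorem leadU_ne_zero {q : ℕ} {c : Fin 3 → ℂ} (hc : ∀ i, c i ≠ 0) : leadU q c ≠ 0 :=
  div_ne_zero (mul_ne_zero (natCast_succ_ne_zero _) (hc 1))
    (mul_ne_zero (natCast_succ_ne_zero _) (hc 0))

theorem leadV_ne_zero {q : ℕ} {c : Fin 3 → ℂ} (hc : ∀ i, c i ≠ 0) : leadV q c ≠ 0 :=
  div_ne_zero (mul_ne_zero (natCast_succ_ne_zero _) (div_ne_zero (mul_ne_zero
    (natCast_succ_ne_zero _) (hc 2)) (mul_ne_zero (natCast_succ_ne_zero _) (hc 0))))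
    (mul_ne_zero (natCast_succ_ne_zero _) (leadU_ne_zero hc))

/-- The computation of orders is run backwards: because all orders are exact, the ratios are
quotients of analytic germs with controlled leading coefficients. -/
theorem TForm.exists_ratioOf {q : ℕ} {g : ℂ → Fin 3 → ℂ} {u₁ u₂ v₂ : ℂ} {c : Fin 3 → ℂ}
    (h : TForm q g u₁ u₂ v₂ c) (hg : AnalyticAt ℂ g 0) :
    ∃ u v : ℂ → Fin 3 → ℂ, RatioOf (m := 2) 0 g u ∧
      RatioOf (m := 2) 1 (keep (m := 2) 0 g u) v ∧ u 0 = ![1, u₁, u₂] ∧ v 0 = ![0, 1, v₂] ∧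
      Ord (q + 1) (leadU q c) (fun t => u t 1 - u₁) ∧ (∃ β ≠ 0, Ord 2 β (fun t => v t 0)) ∧
      Ord 1 (leadV q c) (fun t => v t 2 - v₂) := by
  obtain ⟨hc, h0, h1, h2⟩ := h
  have ga := analyticAt_apply hg
  have n1 := natCast_succ_ne_zero q
  have n5 := natCast_succ_ne_zero (q + 2)
  have hx : deriv (fun t => g t 0 - g 0 0) = deriv fun s => g s 0 :=
    funext fun t => deriv_sub_const _
  have dX := h0.deriv
  rw [hx] at dX
  have dY := h1.deriv
  have dZ := h2.deriv
  rw [show 2 * q + 3 = q + 2 + (q + 1) by ring] at dY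
  rw [show 2 * q + 4 = q + 2 + (q + 2) by ring] at dZ
  have hd0 : ((q + 2 : ℕ) + 1 : ℂ) * c 0 ≠ 0 := mul_ne_zero n5 (hc 0)
  -- `Q₁` is `u t 1 - u₁` and `Q₂` is `u t 2 - u₂ - v₂ * Q₁ t`. Below, `w` and `Q₃` become `v t 0`
  -- and `v t 2 - v₂`.
  obtain ⟨Q₁, hQ₁, e1⟩ := dY.exists_quotient dX hd0
  obtain ⟨Q₂, hQ₂, e2⟩ := dZ.exists_quotient dX hd0
  have hα : Ord (q + 1) (leadU q c) Q₁ := by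
    unfold leadU
    rwa [show 2 * q + 3 = q + 2 + (q + 1) by ring]
  have hQ₁' := hα.deriv
  have hα0 : ((q : ℂ) + 1) * leadU q c ≠ 0 := mul_ne_zero n1 (leadU_ne_zero hc)
  obtain ⟨w, hw, e3⟩ := Ord.exists_quotient (m := 2) dX hQ₁' hα0
  have hQ₂' := hQ₂.deriv
  obtain ⟨Q₃, hQ₃, e4⟩ := hQ₂'.exists_quotient hQ₁' hα0
  have hδ : Ord 1 (leadV q c) Q₃ := by
    unfold leadV
    rwa [show 2 * q + 4 = q + 2 + (q + 2) by ring]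
  have hQ₁a := hQ₁.analyticAt
  have hQ₂a := hQ₂.analyticAt
  have g1 : ∀ᶠ t in 𝓝 0, deriv (fun s => g s 1) t = deriv (fun s => g s 0) t * (u₁ + Q₁ t) := by
    filter_upwards [e1, (ga 0).eventually_analyticAt, (ga 1).eventually_analyticAt] with t h3 h4 h5
    rw [deriv_fun_sub (h5.differentiableAt.sub_const _)
      ((h4.differentiableAt.sub_const _).const_mul _), deriv_const_mul_field, deriv_sub_const,
      deriv_sub_const] at h3
    linear_combination h3
  have g2 : ∀ᶠ t in 𝓝 0, deriv (fun s => g s 2) t =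
      deriv (fun s => g s 0) t * (u₂ + v₂ * Q₁ t + Q₂ t) := by
    filter_upwards [e2, g1, (ga 0).eventually_analyticAt, (ga 1).eventually_analyticAt,
      (ga 2).eventually_analyticAt] with t h3 h3' h4 h5 h6
    have d0 := h4.differentiableAt.sub_const (g 0 0)
    have d1 := h5.differentiableAt.sub_const (g 0 1)
    have d2 := h6.differentiableAt.sub_const (g 0 2)
    rw [deriv_fun_sub (d2.fun_sub (d0.const_mul _)) ((d1.fun_sub (d0.const_mul _)).const_mul _),
      deriv_fun_sub d2 (d0.const_mul _), deriv_const_mul_field, deriv_const_mul_field,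
      deriv_fun_sub d1 (d0.const_mul _), deriv_const_mul_field, deriv_sub_const, deriv_sub_const,
      deriv_sub_const] at h3
    linear_combination h3 + v₂ * h3'
  have g3 : ∀ᶠ t in 𝓝 0, deriv (fun s => u₂ + v₂ * Q₁ s + Q₂ s) t =
      deriv (fun s => u₁ + Q₁ s) t * (v₂ + Q₃ t) := by
    filter_upwards [e4, hQ₁a.eventually_analyticAt, hQ₂a.eventually_analyticAt] with t h3 h4 h5
    rw [deriv_fun_add ((h4.differentiableAt.const_mul _).const_add _) h5.differentiableAt,
      deriv_const_add, deriv_const_add, deriv_const_mul_field, h3]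
    ring
  have g4 : ∀ᶠ t in 𝓝 0, deriv (fun s => g s 0) t = deriv (fun s => u₁ + Q₁ s) t * w t := by
    filter_upwards [e3] with t ht
    rw [deriv_const_add, ht]
  have z1 : Q₁ 0 = 0 := hα.eval
  have z2 : Q₂ 0 = 0 := Ord.eval (n := q + 1) hQ₂
  have z3 : Q₃ 0 = 0 := Ord.eval (n := 0) hδ
  have z4 : w 0 = 0 := Ord.eval (n := 1) hw
  refine ⟨fun t => ![1, u₁ + Q₁ t, u₂ + v₂ * Q₁ t + Q₂ t], fun t => ![w t, 1, v₂ + Q₃ t],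
    ratioOf_mk ?_ (fun _ => rfl) (dX.eventually_ne_zero hd0) ?_,
    ratioOf_mk ?_ (fun _ => rfl) ?_ ?_, ?_, ?_, ?_, ⟨_, ?_, hw⟩, ?_⟩
  · intro a
    fin_cases a
    · exact analyticAt_const
    · exact analyticAt_const.fun_add hQ₁a
    · exact (analyticAt_const.fun_add (analyticAt_const.fun_mul hQ₁a)).fun_add hQ₂a
  · intro a
    fin_cases a
    · exact Eventually.of_forall fun t => (mul_one _).symm
    · exact g1
    · exact g2
  · intro a
    fin_cases a
    · exact hw.analyticAt
    · exact analyticAt_const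
    · exact analyticAt_const.fun_add hQ₃.analyticAt
  · filter_upwards [hQ₁'.eventually_ne_zero hα0] with t ht
    change deriv (fun s => u₁ + Q₁ s) t ≠ 0
    rwa [deriv_const_add]
  · intro a
    fin_cases a
    · exact g4
    · exact Eventually.of_forall fun t => (mul_one _).symm
    · exact g3
  · simp [z1, z2]
  · simp [z3, z4]
  · exact hα.congr (Eventually.of_forall fun t => by simp)
  · exact div_ne_zero hd0 hα0
  · exact hδ.congr (Eventually.of_forall fun t => by simp)

end

/-! ### Correspondence between triangular forms and points of level three. -/

section

variable {e : Equiv.Perm (Fin 3)}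

theorem Ord.deriv_eq {c : ℂ} {f : ℂ → ℂ} (h : Ord 1 c f) : _root_.deriv f 0 = c := by
  have h1 := Ord.deriv (n := 0) h
  simpa using (ord_zero h1.analyticAt).unique h1

theorem Ord.deriv_of_sub {n : ℕ} {c a : ℂ} {f : ℂ → ℂ} (h : Ord (n + 1) c (fun t => f t - a)) :
    Ord n ((n + 1) * c) (_root_.deriv f) := by
  have h1 := h.deriv
  rwa [show _root_.deriv (fun t => f t - a) = _root_.deriv f from
    funext fun t => deriv_sub_const _] at h1

theorem Lift3.analyticAt_keep {i j l : Fin 3} {g u v w : ℂ → Fin 3 → ℂ} (hg : AnalyticAt ℂ g 0)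
    (h : Lift3 (m := 2) i j l g u v w) :
    AnalyticAt ℂ (keep (m := 2) j (keep (m := 2) i g u) v) 0 :=
  MonsterTower.analyticAt_keep (MonsterTower.analyticAt_keep hg h.one.analytic) h.two.analytic

/-- The critical indices are 0 and 1, so regularity says that `u 1` and `w 0` have nonzero
derivative at `0`. Then `v₀' = u₁' w₀` gives `v 0` order 2, and `v₂' = u₁' w₂` with `W 2 ≠ 0` gives
`v 2 - V 2` order 1. -/
theorem CoordsIn.exists_tForm_zero {p : Point 2 3} {x U V W : Fin 3 → ℂ}
    (h : CoordsIn e 0 1 1 p x U V W) (hV : V 0 = 0) (hW : W 0 = 0) (hW2 : W 2 ≠ 0)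
    {γ : ℂ → Fin 3 → ℂ} (hγ : γ ∈ GermAt (m := 2) p) :
    ∃ g c, γ = permute e g ∧ TForm 0 g (U 1) (U 2) (V 2) c := by
  obtain ⟨hγa, g, u, v, w, rfl, hl, rfl, rfl, rfl, rfl, hd⟩ := h.mem_germAt_iff.1 hγ
  have hg := analyticAt_permute_iff.1 hγa
  have hk := hl.analyticAt_keep hg
  have ua := analyticAt_apply hl.one.analytic
  have va := analyticAt_apply hl.two.analytic
  have wa := analyticAt_apply hl.three.analytic
  have hα : deriv (fun t => u t 1) 0 ≠ 0 := by
    have := hd 1 (Or.inl rfl)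
    simpa [keep] using this
  have hβ : deriv (fun t => w t 0) 0 ≠ 0 := by
    have := hd 0 (Or.inr ⟨Or.inr ⟨rfl, hV⟩, hW⟩)
    simpa [keep] using this
  have hv0 : ∀ᶠ t in 𝓝 0, deriv (fun s => v s 0) t = deriv (fun s => u s 1) t * w t 0 := by
    simpa [keep] using hl.three.eventually_eq hk 0
  have hv2 : ∀ᶠ t in 𝓝 0, deriv (fun s => v s 2) t = deriv (fun s => u s 1) t * w t 2 := by
    simpa [keep] using hl.three.eventually_eq hk 2
  have o1 := ord_sub_of_deriv_ne_zero (ua 1)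
  have o2 := ord_sub_of_deriv_ne_zero (wa 0)
  simp only [hW, sub_zero] at o2
  have o3 := ord_zero (ua 1).deriv
  have o4 := ord_of_deriv_eq (va 0) hv0 (o3.mul o2)
  simp only [hV, sub_zero] at o4
  have o5 := ord_of_deriv_eq (va 2) hv2 (o3.mul (ord_zero (wa 2)))
  obtain ⟨c, hc⟩ := exists_tForm_of_ratioOf (q := 0) hg hl.one hl.two hα
    (div_ne_zero (mul_ne_zero hα hβ) (natCast_succ_ne_zero _))
    (div_ne_zero (mul_ne_zero hα hW2) (natCast_succ_ne_zero _)) o1 o4 o5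
  exact ⟨g, c, rfl, hc⟩

/-- All three indices are critical, so `v 2`, `w 0`, `w 1` have nonzero derivative at `0`. Since `v
2` is now the denominator, integration gives both `u 1 - U 1` and `v 0` order 2. -/
theorem CoordsIn.exists_tForm_one {p : Point 2 3} {x U V W : Fin 3 → ℂ}
    (h : CoordsIn e 0 1 2 p x U V W) (hV : V 0 = 0) (hW : W 0 = 0) (hW1 : W 1 = 0)
    {γ : ℂ → Fin 3 → ℂ} (hγ : γ ∈ GermAt (m := 2) p) :
    ∃ g c, γ = permute e g ∧ TForm 1 g (U 1) (U 2) (V 2) c := by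
  obtain ⟨hγa, g, u, v, w, rfl, hl, rfl, rfl, rfl, rfl, hd⟩ := h.mem_germAt_iff.1 hγ
  have hg := analyticAt_permute_iff.1 hγa
  have hk := hl.analyticAt_keep hg
  have ua := analyticAt_apply hl.one.analytic
  have va := analyticAt_apply hl.two.analytic
  have wa := analyticAt_apply hl.three.analytic
  have hδ : deriv (fun t => v t 2) 0 ≠ 0 := by
    have := hd 2 (Or.inl rfl)
    simpa [keep] using this
  have hβ : deriv (fun t => w t 0) 0 ≠ 0 := by
    have := hd 0 (Or.inr ⟨Or.inr ⟨rfl, hV⟩, hW⟩)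
    simpa [keep] using this
  have hα : deriv (fun t => w t 1) 0 ≠ 0 := by
    have := hd 1 (Or.inr ⟨Or.inl rfl, hW1⟩)
    simpa [keep] using this
  have hv0 : ∀ᶠ t in 𝓝 0, deriv (fun s => v s 0) t = deriv (fun s => v s 2) t * w t 0 := by
    simpa [keep] using hl.three.eventually_eq hk 0
  have hu1 : ∀ᶠ t in 𝓝 0, deriv (fun s => u s 1) t = deriv (fun s => v s 2) t * w t 1 := by
    simpa [keep] using hl.three.eventually_eq hk 1
  have o1 := ord_sub_of_deriv_ne_zero (wa 1)
  have o2 := ord_sub_of_deriv_ne_zero (wa 0)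
  simp only [hW, hW1, sub_zero] at o1 o2
  have o3 := ord_zero (va 2).deriv
  have o4 := ord_of_deriv_eq (va 0) hv0 (o3.mul o2)
  simp only [hV, sub_zero] at o4
  obtain ⟨c, hc⟩ := exists_tForm_of_ratioOf (q := 1) hg hl.one hl.two
    (div_ne_zero (mul_ne_zero hδ hα) (natCast_succ_ne_zero _))
    (div_ne_zero (mul_ne_zero hδ hβ) (natCast_succ_ne_zero _)) hδ
    (ord_of_deriv_eq (ua 1) hu1 (o3.mul o1)) o4 (ord_sub_of_deriv_ne_zero (va 2))
  exact ⟨g, c, rfl, hc⟩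

/-- The last coordinate `leadV 0 c / leadU 0 c` is the value at `0` of `v₂' / u₁'`. It depends only
on the leading coefficients and is nonzero. -/
theorem TForm.mem_germAt_zero {g : ℂ → Fin 3 → ℂ} {u₁ u₂ v₂ : ℂ} {c : Fin 3 → ℂ}
    (h : TForm 0 g u₁ u₂ v₂ c) (hg : AnalyticAt ℂ g 0) {p : Point 2 3}
    (hp : CoordsIn e 0 1 1 p (g 0) ![1, u₁, u₂] ![0, 1, v₂] ![0, 1, leadV 0 c / leadU 0 c]) :
    permute e g ∈ GermAt (m := 2) p := by
  obtain ⟨u, v, h1, h2, hu0, hv0, hu, ⟨β, hβ, hv⟩, hv2⟩ := h.exists_ratioOf hg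
  have hα : leadU 0 c ≠ 0 := leadU_ne_zero h.ne_zero
  have du : Ord 0 (leadU 0 c) (deriv fun t => u t 1) := by simpa using hu.deriv_of_sub
  have dv := Ord.deriv (n := 1) hv
  have dv2 : Ord 0 (leadV 0 c) (deriv fun t => v t 2) := by
    simpa using Ord.deriv_of_sub (n := 0) hv2
  obtain ⟨w₀, hw₀, e1⟩ := Ord.exists_quotient (m := 1) dv du hα
  obtain ⟨w₂, hw₂, e2⟩ := Ord.exists_quotient (m := 0) dv2 du hα
  have z0 : w₀ 0 = 0 := Ord.eval (n := 0) hw₀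
  have z2 : w₂ 0 = leadV 0 c / leadU 0 c := (ord_zero hw₂.analyticAt).unique hw₂
  refine hp.mem_germAt_iff.2 ⟨analyticAt_permute_iff.2 hg, g, u, v, fun t => ![w₀ t, 1, w₂ t], rfl,
    ⟨h1, h2, ratioOf_mk ?_ (fun _ => rfl) ?_ ?_⟩, rfl, hu0, hv0, ?_, ?_⟩
  · intro a
    fin_cases a
    · exact hw₀.analyticAt
    · exact analyticAt_const
    · exact hw₂.analyticAt
  · simpa [keep] using du.eventually_ne_zero hα
  · intro a
    fin_cases a
    · simpa [keep] using e1
    · simp [keep]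
    · simpa [keep] using e2
  · simp [z0, z2]
  · intro a ha
    fin_cases a
    · have : deriv w₀ 0 ≠ 0 := by
        rw [hw₀.deriv_eq]
        exact div_ne_zero (mul_ne_zero (natCast_succ_ne_zero _) hβ) hα
      simpa [keep] using this
    · have : deriv (fun t => u t 1) 0 ≠ 0 := by
        rwa [(ord_zero du.analyticAt).unique du]
      simpa [keep] using this
    · simp [IsCritIndex] at ha

theorem TForm.mem_germAt_one {g : ℂ → Fin 3 → ℂ} {u₁ u₂ v₂ : ℂ} {c : Fin 3 → ℂ}
    (h : TForm 1 g u₁ u₂ v₂ c) (hg : AnalyticAt ℂ g 0) {p : Point 2 3}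
    (hp : CoordsIn e 0 1 2 p (g 0) ![1, u₁, u₂] ![0, 1, v₂] ![0, 0, 1]) :
    permute e g ∈ GermAt (m := 2) p := by
  obtain ⟨u, v, h1, h2, hu0, hv0, hu, ⟨β, hβ, hv⟩, hv2⟩ := h.exists_ratioOf hg
  have hα : leadU 1 c ≠ 0 := leadU_ne_zero h.ne_zero
  have hδ : leadV 1 c ≠ 0 := leadV_ne_zero h.ne_zero
  have du := hu.deriv_of_sub
  have dv := Ord.deriv (n := 1) hv
  have dv2 : Ord 0 (leadV 1 c) (deriv fun t => v t 2) := by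
    simpa using Ord.deriv_of_sub (n := 0) hv2
  obtain ⟨w₀, hw₀, e1⟩ := Ord.exists_quotient (m := 1) dv dv2 hδ
  obtain ⟨w₁, hw₁, e2⟩ := Ord.exists_quotient (m := 1) du dv2 hδ
  have z0 : w₀ 0 = 0 := Ord.eval (n := 0) hw₀
  have z1 : w₁ 0 = 0 := Ord.eval (n := 0) hw₁
  refine hp.mem_germAt_iff.2 ⟨analyticAt_permute_iff.2 hg, g, u, v, fun t => ![w₀ t, w₁ t, 1], rfl,
    ⟨h1, h2, ratioOf_mk ?_ (fun _ => rfl) ?_ ?_⟩, rfl, hu0, hv0, ?_, ?_⟩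
  · intro a
    fin_cases a
    · exact hw₀.analyticAt
    · exact hw₁.analyticAt
    · exact analyticAt_const
  · simpa [keep] using dv2.eventually_ne_zero hδ
  · intro a
    fin_cases a
    · simpa [keep] using e1
    · simpa [keep] using e2
    · simp [keep]
  · simp [z0, z1]
  · intro a _
    fin_cases a
    · have : deriv w₀ 0 ≠ 0 := by
        rw [hw₀.deriv_eq]
        exact div_ne_zero (mul_ne_zero (natCast_succ_ne_zero _) hβ) hδ
      simpa [keep] using this
    · have : deriv w₁ 0 ≠ 0 := by
        rw [hw₁.deriv_eq]
        exact div_ne_zero (mul_ne_zero (natCast_succ_ne_zero _) hα) hδ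
      simpa [keep] using this
    · have : deriv (fun t => v t 2) 0 ≠ 0 := by
        rwa [(ord_zero dv2.analyticAt).unique dv2]
      simpa [keep] using this

end

section

/-! ## Germs of semigroup type -/

/-- The orders `q + 3`, `2 q + 4`, `2 q + 5`. -/
def ords (q : ℕ) : Fin 3 → ℕ := ![q + 3, 2 * q + 4, 2 * q + 5]

/-- In suitable linear coordinates the components of `γ - γ 0` have the orders `ords q`. -/
def JType (q : ℕ) (γ : ℂ → Fin 3 → ℂ) : Prop :=
  AnalyticAt ℂ γ 0 ∧ ∃ L : (Fin 3 → ℂ) ≃L[ℂ] (Fin 3 → ℂ),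
    ∀ i, Ord (ords q i) 1 (fun t => L (γ t - γ 0) i)

theorem exists_equiv_of_injective (A : (Fin 3 → ℂ) →ₗ[ℂ] (Fin 3 → ℂ)) (hA : Function.Injective A) :
    ∃ L : (Fin 3 → ℂ) ≃L[ℂ] (Fin 3 → ℂ), ∀ v, L v = A v :=
  ⟨(LinearEquiv.ofInjectiveEndo A hA).toContinuousLinearEquiv, fun _ => rfl⟩

theorem exists_scale_equiv (a : Fin 3 → ℂ) (ha : ∀ i, a i ≠ 0) :
    ∃ L : (Fin 3 → ℂ) ≃L[ℂ] (Fin 3 → ℂ), ∀ v i, L v i = a i * v i := by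
  obtain ⟨L, hL⟩ := exists_equiv_of_injective
    (LinearMap.pi fun i => a i • LinearMap.proj (R := ℂ) (φ := fun _ : Fin 3 => ℂ) i) fun v w h => by
      funext i
      exact mul_left_cancel₀ (ha i) (congrFun h i)
  exact ⟨L, fun v i => by rw [hL]; rfl⟩

variable {q : ℕ} {γ σ : ℂ → Fin 3 → ℂ}

theorem JType.mk_of_ne_zero (hγ : AnalyticAt ℂ γ 0) (L : (Fin 3 → ℂ) ≃L[ℂ] (Fin 3 → ℂ))
    (c : Fin 3 → ℂ) (hc : ∀ i, c i ≠ 0)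
    (h : ∀ i, Ord (ords q i) (c i) (fun t => L (γ t - γ 0) i)) : JType q γ := by
  obtain ⟨S, hS⟩ := exists_scale_equiv (fun i => (c i)⁻¹) fun i => inv_ne_zero (hc i)
  refine ⟨hγ, L.trans S, fun i => ?_⟩
  have h1 := (h i).const_mul (c i)⁻¹
  rw [inv_mul_cancel₀ (hc i)] at h1
  exact h1.congr (Eventually.of_forall fun t => hS _ _)

theorem JType.congr (h : JType q γ) (he : ∀ᶠ t in 𝓝 0, σ t = γ t) : JType q σ := by
  obtain ⟨h1, L, h2⟩ := h
  refine ⟨h1.congr (he.mono fun t ht => ht.symm), L, fun i => (h2 i).congr ?_⟩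
  filter_upwards [he] with t ht
  rw [ht, he.self_of_nhds]

theorem ords_lt (q : ℕ) (i : Fin 3) : ords q i < 2 * q + 6 := by
  fin_cases i <;> simp [ords]
  omega

theorem Rem.apply_eq_zero {n : ℕ} {E : Type*} [NormedAddCommGroup E] [NormedSpace ℂ E]
    {f : ℂ → E} (h : Rem n f) (hn : n ≠ 0) : f 0 = 0 := by
  obtain ⟨u, -, h3⟩ := h
  have := h3.self_of_nhds
  rwa [zero_pow hn, zero_smul] at this

theorem Rem.ord_apply {n k : ℕ} {f : ℂ → Fin 3 → ℂ} (h : Rem n f) (hk : k < n) (i : Fin 3) :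
    Ord k 0 (fun t => f t i) := by
  obtain ⟨c, hc⟩ := rem_iff_ord.1
    (h.map (ContinuousLinearMap.proj (R := ℂ) (φ := fun _ : Fin 3 => ℂ) i))
  exact hc.of_lt hk

/-- The type is stable under small perturbations after an invertible linear map. -/
theorem JType.of_rem (h : JType q γ) (hσ : AnalyticAt ℂ σ 0) (D : (Fin 3 → ℂ) ≃L[ℂ] (Fin 3 → ℂ))
    (hr : Rem (2 * q + 6) (fun t => σ t - σ 0 - D (γ t - γ 0))) : JType q σ := by
  obtain ⟨-, L, h2⟩ := h
  refine ⟨hσ, D.symm.trans L, fun i => ?_⟩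
  have h3 := (hr.map ((D.symm.trans L : (Fin 3 → ℂ) ≃L[ℂ] (Fin 3 → ℂ)) :
    (Fin 3 → ℂ) →L[ℂ] (Fin 3 → ℂ))).ord_apply (ords_lt q i) i
  have h4 := (h2 i).add h3
  rw [add_zero] at h4
  refine h4.congr (Eventually.of_forall fun t => ?_)
  simp

theorem JType.of_sub (h : JType q γ) (hσ : AnalyticAt ℂ σ 0)
    (hr : Rem (2 * q + 6) (fun t => σ t - γ t)) : JType q σ := by
  have h0 : σ 0 = γ 0 := sub_eq_zero.1 (hr.apply_eq_zero (by omega))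
  refine h.of_rem hσ (ContinuousLinearEquiv.refl ℂ _) ?_
  simpa [h0] using hr

theorem JType.rem (h : JType q γ) : Rem (q + 3) (fun t => γ t - γ 0) := by
  obtain ⟨-, L, h2⟩ := h
  have h3 : Rem (q + 3) (fun t => L (γ t - γ 0)) := by
    refine rem_pi fun i => ?_
    rw [rem_iff_ord]
    fin_cases i
    · exact ⟨_, h2 0⟩
    · exact ⟨_, (h2 1).of_lt (by simp [ords]; omega)⟩
    · exact ⟨_, (h2 2).of_lt (by simp [ords]; omega)⟩
  simpa using h3.map (L.symm : (Fin 3 → ℂ) →L[ℂ] (Fin 3 → ℂ))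

/-- Along the germ `φ` differs from its linear part by order `2 * (q + 3) = 2 * q + 6`, which is
beyond the three orders; the linear part only changes the linear coordinates. -/
theorem JType.comp_left (h : JType q γ) {φ : (Fin 3 → ℂ) → Fin 3 → ℂ} (hφ : AnalyticAt ℂ φ (γ 0))
    (hinj : Function.Injective (fderiv ℂ φ (γ 0))) : JType q (fun t => φ (γ t)) := by
  obtain ⟨D, hD⟩ := exists_equiv_of_injective (fderiv ℂ φ (γ 0)).toLinearMap hinj
  refine h.of_rem (hφ.fun_comp h.1) D ?_
  have h1 := Rem.taylor hφ h.rem (by omega)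
  rw [show 2 * (q + 3) = 2 * q + 6 by ring] at h1
  simp only [hD]
  exact h1

theorem JType.comp_right (h : JType q γ) {τ : ℂ → ℂ} {a : ℂ} (ha : a ≠ 0) (hτ : Ord 1 a τ) :
    JType q (fun t => γ (τ t)) := by
  obtain ⟨h1, L, h2⟩ := h
  have h0 : τ 0 = 0 := Ord.eval (n := 0) hτ
  refine JType.mk_of_ne_zero (AnalyticAt.fun_comp (g := γ) (by rwa [h0]) hτ.analyticAt) L
    (fun i => a ^ ords q i) (fun i => pow_ne_zero _ ha) fun i => ?_
  have h3 := (h2 i).comp hτ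
  rw [one_mul] at h3
  simpa only [h0] using h3

theorem TForm.jType {e : Equiv.Perm (Fin 3)} {g : ℂ → Fin 3 → ℂ} {u₁ u₂ v₂ : ℂ} {c : Fin 3 → ℂ}
    (h : TForm q g u₁ u₂ v₂ c) (hg : AnalyticAt ℂ g 0) : JType q (permute e g) := by
  let P : Fin 3 → ((Fin 3 → ℂ) →ₗ[ℂ] ℂ) := fun a =>
    LinearMap.proj (R := ℂ) (φ := fun _ : Fin 3 => ℂ) (e a)
  obtain ⟨L, hL⟩ := exists_equiv_of_injective (LinearMap.pi ![P 0, P 1 - u₁ • P 0,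
    P 2 - u₂ • P 0 - v₂ • (P 1 - u₁ • P 0)]) (by
      rw [injective_iff_map_eq_zero]
      intro v hv
      have e0 : v (e 0) = 0 := congrFun hv 0
      have e1 : v (e 1) - u₁ * v (e 0) = 0 := congrFun hv 1
      have e2 : v (e 2) - u₂ * v (e 0) - v₂ * (v (e 1) - u₁ * v (e 0)) = 0 := congrFun hv 2
      rw [e1, e0] at e2
      rw [e0] at e1
      funext s
      obtain ⟨a, rfl⟩ := e.surjective s
      fin_cases a
      · exact e0
      · simpa using e1
      · simpa using e2)
  refine JType.mk_of_ne_zero (analyticAt_permute_iff.2 hg) L c h.ne_zero fun i => ?_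
  simp only [hL]
  fin_cases i
  · simpa [P, ords, permute] using h.zero
  · simpa [P, ords, permute] using h.one
  · simpa [P, ords, permute] using h.two

/-- Gaussian elimination with row exchanges: the exchanges form the permutation `e`, the multipliers
are `u₁`, `u₂`, `v₂`, and the pivots are the leading coefficients `c`. -/
theorem JType.exists_tForm (h : JType q γ) : ∃ (e : Equiv.Perm (Fin 3)) (g : ℂ → Fin 3 → ℂ)
    (u₁ u₂ v₂ : ℂ) (c : Fin 3 → ℂ), γ = permute e g ∧ TForm q g u₁ u₂ v₂ c := by
  obtain ⟨-, L, h2⟩ := h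
  have o0 : Ord (q + 3) 1 (fun t => L (γ t - γ 0) 0) := h2 0
  have o1 : Ord (2 * q + 4) 1 (fun t => L (γ t - γ 0) 1) := h2 1
  have o2 : Ord (2 * q + 5) 1 (fun t => L (γ t - γ 0) 2) := h2 2
  -- `M` is the matrix of `L⁻¹`; its rows write the components of `γ - γ 0` in terms of functions of
  -- exact orders.
  obtain ⟨M, hM⟩ : ∃ M : Fin 3 → Fin 3 → ℂ, ∀ i s, M s i = L.symm (Pi.single i 1) s :=
    ⟨fun s i => L.symm (Pi.single i 1) s, fun _ _ => rfl⟩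
  have hsymm : ∀ (w : Fin 3 → ℂ) s, L.symm w s = M s 0 * w 0 + M s 1 * w 1 + M s 2 * w 2 := by
    intro w s
    have h3 : w = w 0 • Pi.single 0 1 + w 1 • Pi.single 1 1 + w 2 • Pi.single 2 1 := by
      funext i
      fin_cases i <;> simp
    conv_lhs => rw [h3]
    simp only [map_add, map_smul, Pi.add_apply, Pi.smul_apply, smul_eq_mul, ← hM]
    ring
  have hL : ∀ (v : Fin 3 → ℂ) s, v s = M s 0 * L v 0 + M s 1 * L v 1 + M s 2 * L v 2 := by
    intro v s
    rw [← hsymm, L.symm_apply_apply]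
  have hker : ∀ w : Fin 3 → ℂ, (∀ s, M s 0 * w 0 + M s 1 * w 1 + M s 2 * w 2 = 0) → w = 0 := by
    intro w hw
    refine L.symm.injective ?_
    rw [map_zero]
    funext s
    rw [hsymm, hw]
    rfl
  obtain ⟨s₀, hs₀⟩ : ∃ s, M s 0 ≠ 0 := by
    by_contra! hc
    have := congrFun (hker ![1, 0, 0] fun s => by simp [hc]) 0
    simp at this
  -- Second pivot, after the row `s₀` has cleared the first column. If it vanished in every row, the
  -- first two columns would be dependent.
  obtain ⟨s₁, hs₁⟩ : ∃ s, M s 1 - M s 0 / M s₀ 0 * M s₀ 1 ≠ 0 := by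
    by_contra! hc
    have := congrFun (hker ![-(M s₀ 1 / M s₀ 0), 1, 0] fun s => by
      have := hc s
      simp only [Matrix.cons_val_zero, Matrix.cons_val_one, Matrix.cons_val]
      linear_combination this) 1
    simp at this
  have hne : s₁ ≠ s₀ := by
    rintro rfl
    rw [div_self hs₀, one_mul, sub_self] at hs₁
    exact hs₁ rfl
  obtain ⟨e, rfl, rfl⟩ := exists_perm_pair hne
  obtain ⟨a, ha⟩ : ∃ a, a = M (e 1) 0 / M (e 0) 0 := ⟨_, rfl⟩
  obtain ⟨b, hb⟩ : ∃ b, b = M (e 2) 0 / M (e 0) 0 := ⟨_, rfl⟩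
  rw [← ha] at hs₁
  obtain ⟨d, hd⟩ : ∃ d, d = (M (e 2) 1 - b * M (e 0) 1) / (M (e 1) 1 - a * M (e 0) 1) := ⟨_, rfl⟩
  rw [eq_div_iff hs₀] at ha hb
  rw [eq_div_iff hs₁] at hd
  -- If the last pivot vanished, the linear form `v (e 2) - b * v (e 0) - d * (v (e 1) - a * v (e
  -- 0))` would be identically `0`, although it is `1` on the basis vector `e 2`.
  have hκ : M (e 2) 2 - b * M (e 0) 2 - d * (M (e 1) 2 - a * M (e 0) 2) ≠ 0 := by
    intro hc
    have h3 : ∀ v : Fin 3 → ℂ, v (e 2) - b * v (e 0) - d * (v (e 1) - a * v (e 0)) = 0 := by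
      intro v
      rw [hL v (e 0), hL v (e 1), hL v (e 2)]
      linear_combination (-L v 0) * hb + (d * L v 0) * ha - (L v 1) * hd + (L v 2) * hc
    have h4 := h3 (Pi.single (e 2) 1)
    simp at h4
  refine ⟨e, permute e.symm γ, a, b, d, ![M (e 0) 0, M (e 1) 1 - a * M (e 0) 1,
    M (e 2) 2 - b * M (e 0) 2 - d * (M (e 1) 2 - a * M (e 0) 2)], (permute_permute γ).symm,
    ?_, ?_, ?_, ?_⟩
  · intro i
    fin_cases i
    · exact hs₀
    · exact hs₁
    · exact hκ
  · have h3 := ((o0.const_mul (M (e 0) 0)).add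
      ((o1.of_lt (by omega : q + 3 < _)).const_mul (M (e 0) 1))).add
      ((o2.of_lt (by omega : q + 3 < _)).const_mul (M (e 0) 2))
    simp only [mul_one, mul_zero, add_zero] at h3
    refine h3.congr (Eventually.of_forall fun t => ?_)
    exact hL (γ t - γ 0) (e 0)
  · have h3 := (o1.const_mul (M (e 1) 1 - a * M (e 0) 1)).add
      ((o2.of_lt (by omega : 2 * q + 4 < _)).const_mul (M (e 1) 2 - a * M (e 0) 2))
    simp only [mul_one, mul_zero, add_zero] at h3
    refine h3.congr (Eventually.of_forall fun t => ?_)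
    change (γ t - γ 0) (e 1) - a * (γ t - γ 0) (e 0) = _
    rw [hL (γ t - γ 0) (e 0), hL (γ t - γ 0) (e 1)]
    linear_combination (-L (γ t - γ 0) 0) * ha
  · have h3 := o2.const_mul (M (e 2) 2 - b * M (e 0) 2 - d * (M (e 1) 2 - a * M (e 0) 2))
    simp only [mul_one] at h3
    refine h3.congr (Eventually.of_forall fun t => ?_)
    change (γ t - γ 0) (e 2) - b * (γ t - γ 0) (e 0) -
      d * ((γ t - γ 0) (e 1) - a * (γ t - γ 0) (e 0)) = _
    generalize γ t - γ 0 = v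
    rw [hL v (e 0), hL v (e 1), hL v (e 2)]
    linear_combination (-L v 0) * hb + (d * L v 0) * ha - (L v 1) * hd

/-- If an equation `F = 0` with independent differentials held along the germ, the differential of
one component of `F` would be a nonzero linear form vanishing on it to order `2 * q + 6`. The three
exact, distinct, smaller orders exclude this. -/
theorem JType.three_le_embDim (h : JType q γ) : 3 ≤ embDim (m := 2) γ := by
  unfold embDim
  refine le_csInf ⟨3, Set.univ, 0, rfl, fun x _ => hasCodimAt_univ x,
    Eventually.of_forall fun _ => trivial⟩ ?_
  rintro d ⟨N, c, hcd, hN, hγN⟩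
  by_contra! hd
  have hc : 0 < c := by omega
  obtain ⟨F, hF, hsurj, hFN⟩ := hN _ hγN.self_of_nhds
  have hF0 : F (γ 0) = 0 := hFN.self_of_nhds.1 hγN.self_of_nhds
  have h1 := Rem.taylor hF h.rem (by omega)
  have h2 : ∀ᶠ t in 𝓝 0, F (γ t) = 0 := by
    filter_upwards [h.1.continuousAt.eventually hFN, hγN] with t h3 h4 using h3.1 h4
  obtain ⟨-, L, ho⟩ := h
  obtain ⟨A, hA⟩ : ∃ A : (Fin 3 → ℂ) →L[ℂ] ℂ, A = (ContinuousLinearMap.proj (R := ℂ)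
    (φ := fun _ : Fin c => ℂ) ⟨0, hc⟩).comp (fderiv ℂ F (γ 0)) := ⟨_, rfl⟩
  obtain ⟨b, hb⟩ := rem_iff_ord.1 (h1.map (ContinuousLinearMap.proj (R := ℂ)
    (φ := fun _ : Fin c => ℂ) ⟨0, hc⟩))
  -- `F` vanishes on the germ, so the linear term is minus the Taylor remainder.
  have h3 : Ord (2 * (q + 3)) (-1 * b) (fun t => A (γ t - γ 0)) := by
    refine (hb.const_mul (-1)).congr ?_
    filter_upwards [h2] with t ht
    simp [hA, ht, hF0]
  have hA' : ∀ v, A v = A (L.symm (Pi.single 0 1)) * L v 0 + A (L.symm (Pi.single 1 1)) * L v 1 +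
      A (L.symm (Pi.single 2 1)) * L v 2 := by
    intro v
    have h4 : L v = L v 0 • Pi.single 0 1 + L v 1 • Pi.single 1 1 + L v 2 • Pi.single 2 1 := by
      funext i
      fin_cases i <;> simp
    have h5 := congrArg (fun w => A (L.symm w)) h4
    simp only [L.symm_apply_apply, map_add, map_smul, smul_eq_mul] at h5
    rw [h5]
    ring
  generalize A (L.symm (Pi.single 0 1)) = a₀, A (L.symm (Pi.single 1 1)) = a₁,
    A (L.symm (Pi.single 2 1)) = a₂ at hA'
  have o0 : Ord (q + 3) 1 (fun t => L (γ t - γ 0) 0) := ho 0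
  have o1 : Ord (2 * q + 4) 1 (fun t => L (γ t - γ 0) 1) := ho 1
  have o2 : Ord (2 * q + 5) 1 (fun t => L (γ t - γ 0) 2) := ho 2
  -- The coefficients of `t ^ (q + 3)`, `t ^ (2 * q + 4)`, `t ^ (2 * q + 5)` are compared in this
  -- order; each kills one coefficient of the form.
  have ha0 : a₀ = 0 := by
    have h4 := ((o0.const_mul a₀).add ((o1.of_lt (by omega : q + 3 < _)).const_mul a₁)).add
      ((o2.of_lt (by omega : q + 3 < _)).const_mul a₂)
    have h5 := h4.unique ((h3.of_lt (by omega : q + 3 < _)).congr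
      (Eventually.of_forall fun t => (hA' _).symm))
    simpa using h5
  have ha1 : a₁ = 0 := by
    have h4 := (o1.const_mul a₁).add ((o2.of_lt (by omega : 2 * q + 4 < _)).const_mul a₂)
    have h5 := h4.unique ((h3.of_lt (by omega : 2 * q + 4 < _)).congr
      (Eventually.of_forall fun t => by rw [hA', ha0]; ring))
    simpa using h5
  have ha2 : a₂ = 0 := by
    have h5 := (o2.const_mul a₂).unique ((h3.of_lt (by omega : 2 * q + 5 < _)).congr
      (Eventually.of_forall fun t => by rw [hA', ha0, ha1]; ring))
    simpa using h5
  obtain ⟨v, hv⟩ := hsurj (Pi.single ⟨0, hc⟩ 1)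
  have h6 : A v = 1 := by
    rw [hA, ContinuousLinearMap.comp_apply, hv]
    simp
  rw [hA', ha0, ha1, ha2] at h6
  simp at h6

end

section

/-! ## Jets of germs of semigroup type -/

/-- The monomial curve with exponents `ords q`. -/
def monomialCurve (q : ℕ) : ℂ → Fin 3 → ℂ :=
  fun t => ![t ^ (q + 3), t ^ (2 * q + 4), t ^ (2 * q + 5)]

variable {q : ℕ} {γ σ : ℂ → Fin 3 → ℂ}

theorem monomialCurve_zero : monomialCurve q 0 = 0 := by
  funext i
  fin_cases i <;> simp [monomialCurve]

theorem analyticAt_monomialCurve (t : ℂ) : AnalyticAt ℂ (monomialCurve q) t := by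
  refine AnalyticAt.pi fun i => ?_
  fin_cases i <;> exact analyticAt_id.fun_pow _

theorem ord_pow (n : ℕ) : Ord n 1 (fun t => t ^ n) :=
  ⟨fun _ => 1, analyticAt_const, rfl, Eventually.of_forall fun _ => (mul_one _).symm⟩

theorem jType_monomialCurve : JType q (monomialCurve q) := by
  refine ⟨analyticAt_monomialCurve 0, ContinuousLinearEquiv.refl ℂ _, fun i => ?_⟩
  rw [monomialCurve_zero]
  fin_cases i <;> simpa [monomialCurve, ords] using ord_pow _

theorem exists_local_inverse {τ : ℂ → ℂ} (hτ : AnalyticAt ℂ τ 0) (h0 : τ 0 = 0)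
    (hd : deriv τ 0 ≠ 0) : ∃ ρ : ℂ → ℂ, AnalyticAt ℂ ρ 0 ∧ ρ 0 = 0 ∧ deriv ρ 0 ≠ 0 ∧
      ∀ᶠ s in 𝓝 0, τ (ρ s) = s := by
  have h1 := hτ.analyticAt_localInverse hd
  have h2 := hτ.hasStrictDerivAt.eventually_right_inverse hd
  have h3 := hτ.hasStrictDerivAt.to_localInverse hd
  have h4 := (hτ.hasStrictDerivAt.eventually_left_inverse hd).self_of_nhds
  rw [h0] at h1 h2 h3 h4
  exact ⟨_, h1, h4, by rw [h3.hasDerivAt.deriv]; exact inv_ne_zero hd, h2⟩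

theorem ord_one_of_deriv {τ : ℂ → ℂ} (hτ : AnalyticAt ℂ τ 0) (h0 : τ 0 = 0) :
    Ord 1 (deriv τ 0) τ := by
  simpa [h0] using ord_sub_of_deriv_ne_zero hτ

/-- Affine isomorphisms are analytic diffeomorphisms. -/
theorem exists_affine_diffeo (A : (Fin 3 → ℂ) ≃L[ℂ] (Fin 3 → ℂ)) (b : Fin 3 → ℂ) :
    ∃ φ : OpenPartialHomeomorph (Fin 3 → ℂ) (Fin 3 → ℂ), IsAnalyticDiffeo (m := 2) φ ∧
      φ.source = Set.univ ∧ ∀ v, φ v = b + A v := by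
  refine ⟨(A.toHomeomorph.trans (Homeomorph.addLeft b)).toOpenPartialHomeomorph, ⟨?_, ?_⟩, rfl,
    fun v => rfl⟩
  · intro x _
    exact analyticAt_const.fun_add ((A : (Fin 3 → ℂ) →L[ℂ] (Fin 3 → ℂ)).analyticAt x)
  · intro x _
    exact ((A.symm : (Fin 3 → ℂ) →L[ℂ] (Fin 3 → ℂ)).analyticAt _).fun_comp
      (f := fun y : Fin 3 → ℂ => -b + y) (analyticAt_const.fun_add analyticAt_id)

/-- The type of the monomial curve survives a diffeomorphism and a reparametrization, and a change
beyond the `(2 * q + 5)`-jet is a perturbation of order `2 * q + 6`. -/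
theorem JetEquiv.jType (h : JetEquiv (m := 2) (2 * q + 5) γ (monomialCurve q))
    (hγ : AnalyticAt ℂ γ 0) : JType q γ := by
  obtain ⟨σ, ⟨φ, τ, hφ, h0, hτ, hτ0, hτd, hσ⟩, hjet⟩ := h
  obtain ⟨ρ, hρ, hρ0, hρd, hτρ⟩ := exists_local_inverse hτ hτ0 hτd
  have h1 : JType q (fun t => φ (monomialCurve q t)) :=
    jType_monomialCurve.comp_left (hφ.1 _ h0) (hφ.fderiv_injective h0)
  have h2 : JType q σ := by
    refine (h1.comp_right hρd (ord_one_of_deriv hρ hρ0)).congr ?_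
    have h3 : Tendsto ρ (𝓝 0) (𝓝 0) := by simpa [hρ0] using hρ.continuousAt.tendsto
    filter_upwards [hτρ, h3.eventually hσ] with s h4 h5
    rw [← h5, h4]
  exact h2.of_sub hγ ((rem_iff_sameJet (m := 2) hγ h2.1).2 hjet)

/-- The affine map `v ↦ γ 0 + L⁻¹ (T v)` sends the curve reparametrized by `θ` to a germ with the
jet of `γ`. `RLEquiv` reparametrizes the other side, hence the inverse `ρ` of `θ`. -/
theorem jetEquiv_of_rem (hγ : AnalyticAt ℂ γ 0) (L T : (Fin 3 → ℂ) ≃L[ℂ] (Fin 3 → ℂ))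
    {θ : ℂ → ℂ} (hθ : AnalyticAt ℂ θ 0) (hθ0 : θ 0 = 0) (hθd : deriv θ 0 ≠ 0)
    (hr : Rem (2 * q + 6) (fun t => L (γ t - γ 0) - T (monomialCurve q (θ t)))) :
    JetEquiv (m := 2) (2 * q + 5) γ (monomialCurve q) := by
  obtain ⟨ρ, hρ, hρ0, hρd, hθρ⟩ := exists_local_inverse hθ hθ0 hθd
  obtain ⟨φ, hφ, hsrc, hφv⟩ := exists_affine_diffeo (T.trans L.symm) (γ 0)
  have hσ : AnalyticAt ℂ (fun t => φ (monomialCurve q (θ t))) 0 :=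
    (hφ.1 _ (by rw [hsrc]; trivial)).fun_comp
      ((analyticAt_monomialCurve (θ 0)).fun_comp hθ)
  refine ⟨fun t => φ (monomialCurve q (θ t)), ⟨φ, ρ, hφ, by rw [hsrc]; trivial, hρ, hρ0, hρd, ?_⟩,
    (rem_iff_sameJet (m := 2) hγ hσ).1 ?_⟩
  · filter_upwards [hθρ] with s hs
    rw [hs]
  · have h1 := hr.map (L.symm : (Fin 3 → ℂ) →L[ℂ] (Fin 3 → ℂ))
    refine (show (fun t => γ t - φ (monomialCurve q (θ t))) = _ from ?_) ▸ h1
    funext t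
    rw [hφv]
    simp [sub_sub]

theorem exists_triangular_equiv (a b c : ℂ) : ∃ T : (Fin 3 → ℂ) ≃L[ℂ] (Fin 3 → ℂ),
    ∀ v, T v = ![v 0 + a * v 1 + b * v 2, v 1 + c * v 2, v 2] := by
  let P : Fin 3 → ((Fin 3 → ℂ) →ₗ[ℂ] ℂ) := LinearMap.proj (R := ℂ) (φ := fun _ : Fin 3 => ℂ)
  obtain ⟨T, hT⟩ := exists_equiv_of_injective
    (LinearMap.pi ![P 0 + a • P 1 + b • P 2, P 1 + c • P 2, P 2]) (by
      rw [injective_iff_map_eq_zero]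
      intro v hv
      have e0 : v 0 + a * v 1 + b * v 2 = 0 := congrFun hv 0
      have e1 : v 1 + c * v 2 = 0 := congrFun hv 1
      have e2 : v 2 = 0 := congrFun hv 2
      rw [e2, mul_zero, add_zero] at e1
      rw [e1, e2, mul_zero, mul_zero, add_zero, add_zero] at e0
      funext i
      fin_cases i <;> assumption)
  refine ⟨T, fun v => ?_⟩
  rw [hT]
  funext i
  fin_cases i <;> rfl

theorem ord_pow_mul (n : ℕ) {g : ℂ → ℂ} (hg : AnalyticAt ℂ g 0) :
    Ord n (g 0) (fun t => t ^ n * g t) :=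
  ⟨g, hg, rfl, Eventually.of_forall fun _ => rfl⟩

/-- In the adapted coordinates only degrees 3, 4, 5 occur modulo `t ^ 6`, and there is one component
for each; a unitriangular linear map removes the off-diagonal terms. -/
theorem JType.jetEquiv_zero (h : JType 0 γ) : JetEquiv (m := 2) 5 γ (monomialCurve 0) := by
  obtain ⟨hγ, L, ho⟩ := h
  have o0 : Ord 3 1 (fun t => L (γ t - γ 0) 0) := ho 0
  have o1 : Ord 4 1 (fun t => L (γ t - γ 0) 1) := ho 1
  have o2 : Ord 5 1 (fun t => L (γ t - γ 0) 2) := ho 2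
  obtain ⟨p, hp⟩ := o0.sub_leading
  obtain ⟨s, hs⟩ := hp.sub_leading
  obtain ⟨k, hk⟩ := hs.sub_leading
  obtain ⟨r, hr⟩ := o1.sub_leading
  obtain ⟨r', hr'⟩ := hr.sub_leading
  obtain ⟨s', hs'⟩ := o2.sub_leading
  obtain ⟨T, hT⟩ := exists_triangular_equiv p s r
  refine jetEquiv_of_rem (q := 0) (θ := fun t => t) hγ L T analyticAt_id rfl (by simp)
    (rem_pi fun i => rem_iff_ord.2 ?_)
  simp only [hT, monomialCurve]
  fin_cases i
  · refine ⟨k, hk.congr (Eventually.of_forall fun t => ?_)⟩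
    simp
    ring
  · refine ⟨r', hr'.congr (Eventually.of_forall fun t => ?_)⟩
    simp
    ring
  · exact ⟨s', hs'.congr (Eventually.of_forall fun t => by simp)⟩

/-- Degrees 4, 6, 7 are leading degrees, so terms in 6 and 7 are removed linearly. The gap 5 is not
available to linear maps, and its coefficient is absorbed by a reparametrization. -/
theorem JType.jetEquiv_one (h : JType 1 γ) : JetEquiv (m := 2) 7 γ (monomialCurve 1) := by
  obtain ⟨hγ, L, ho⟩ := h
  have o0 : Ord 4 1 (fun t => L (γ t - γ 0) 0) := ho 0
  have o1 : Ord 6 1 (fun t => L (γ t - γ 0) 1) := ho 1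
  have o2 : Ord 7 1 (fun t => L (γ t - γ 0) 2) := ho 2
  obtain ⟨p, hp⟩ := o0.sub_leading
  obtain ⟨s, hs⟩ := hp.sub_leading
  obtain ⟨k, hk⟩ := hs.sub_leading
  obtain ⟨l, hl⟩ := hk.sub_leading
  obtain ⟨r, hr⟩ := o1.sub_leading
  obtain ⟨r', hr'⟩ := hr.sub_leading
  obtain ⟨s', hs'⟩ := o2.sub_leading
  -- `(t + b t ^ 2) ^ 4 = t ^ 4 + 4 b t ^ 5 + 6 b ^ 2 t ^ 6 + 4 b ^ 3 t ^ 7 + b ^ 4 t ^ 8`, so `b =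
  -- p / 4` matches degree 5. The entries of `T` then match degrees 6 and 7, where the sixth power
  -- contributes `6 b t ^ 7`.
  obtain ⟨b, hb⟩ : ∃ b, b = p / 4 := ⟨_, rfl⟩
  obtain ⟨A, hA⟩ : ∃ A, A = s - 6 * b ^ 2 := ⟨_, rfl⟩
  obtain ⟨T, hT⟩ := exists_triangular_equiv A (k - 4 * b ^ 3 - 6 * b * A) (r - 6 * b)
  have hθd : deriv (fun t : ℂ => t + b * t ^ 2) 0 = 1 := by
    rw [deriv_fun_add (by fun_prop) (by fun_prop), deriv_const_mul_field]
    simp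
  refine jetEquiv_of_rem (q := 1) (θ := fun t => t + b * t ^ 2) hγ L T (by fun_prop) (by simp)
    (by rw [hθd]; exact one_ne_zero) (rem_pi fun i => rem_iff_ord.2 ?_)
  simp only [hT, monomialCurve]
  have hb' : p = 4 * b := by
    rw [hb]
    ring
  have hA' : s = A + 6 * b ^ 2 := by
    rw [hA]
    ring
  have e6 : ∀ t : ℂ, (t + b * t ^ 2) ^ 6 = t ^ 6 + 6 * b * t ^ 7 + t ^ 8 * (15 * b ^ 2 +
      20 * b ^ 3 * t + 15 * b ^ 4 * t ^ 2 + 6 * b ^ 5 * t ^ 3 + b ^ 6 * t ^ 4) := fun t => by ring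
  have e7 : ∀ t : ℂ, (t + b * t ^ 2) ^ 7 = t ^ 7 + t ^ 8 * (7 * b + 21 * b ^ 2 * t +
      35 * b ^ 3 * t ^ 2 + 35 * b ^ 4 * t ^ 3 + 21 * b ^ 5 * t ^ 4 + 7 * b ^ 6 * t ^ 5 +
      b ^ 7 * t ^ 6) := fun t => by ring
  -- The tails carry a factor `t ^ 8`, so only their analyticity matters.
  obtain ⟨f6, hf6⟩ : ∃ f : ℂ → ℂ, f = fun t => 15 * b ^ 2 +
      20 * b ^ 3 * t + 15 * b ^ 4 * t ^ 2 + 6 * b ^ 5 * t ^ 3 + b ^ 6 * t ^ 4 := ⟨_, rfl⟩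
  obtain ⟨f7, hf7⟩ : ∃ f : ℂ → ℂ, f = fun t => 7 * b + 21 * b ^ 2 * t +
      35 * b ^ 3 * t ^ 2 + 35 * b ^ 4 * t ^ 3 + 21 * b ^ 5 * t ^ 4 + 7 * b ^ 6 * t ^ 5 +
      b ^ 7 * t ^ 6 := ⟨_, rfl⟩
  have a6 : AnalyticAt ℂ f6 0 := by
    rw [hf6]
    fun_prop
  have a7 : AnalyticAt ℂ f7 0 := by
    rw [hf7]
    fun_prop
  replace e6 : ∀ t : ℂ, (t + b * t ^ 2) ^ 6 = t ^ 6 + 6 * b * t ^ 7 + t ^ 8 * f6 t := by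
    simpa only [hf6] using e6
  replace e7 : ∀ t : ℂ, (t + b * t ^ 2) ^ 7 = t ^ 7 + t ^ 8 * f7 t := by
    simpa only [hf7] using e7
  fin_cases i
  · refine ⟨_, (hl.add (ord_pow_mul 8 (g := fun t => -b ^ 4 - A * f6 t -
      (k - 4 * b ^ 3 - 6 * b * A) * f7 t) (by fun_prop))).congr (Eventually.of_forall fun t => ?_)⟩
    simp only [hb', hA', Fin.zero_eta, Pi.sub_apply, Matrix.cons_val_zero, Matrix.cons_val_one,
      Matrix.cons_val, Nat.reduceAdd, mul_one, e6, e7]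
    ring
  · refine ⟨_, (hr'.add (ord_pow_mul 8 (g := fun t => -f6 t - (r - 6 * b) * f7 t)
      (by fun_prop))).congr (Eventually.of_forall fun t => ?_)⟩
    simp only [Fin.mk_one, Pi.sub_apply, Matrix.cons_val_zero, Matrix.cons_val_one,
      Matrix.cons_val, Nat.reduceAdd, mul_one, e6, e7]
    ring
  · refine ⟨_, (hs'.add (ord_pow_mul 8 (g := fun t => -f7 t) (by fun_prop))).congr
      (Eventually.of_forall fun t => ?_)⟩
    simp only [Fin.reduceFinMk, Pi.sub_apply, Matrix.cons_val_zero, Matrix.cons_val_one,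
      Matrix.cons_val, Nat.reduceAdd, mul_one, e7]
    ring

end

section

open Stage

/-! ## Regular points over a point -/

section Regular

variable {m k : ℕ}

/-- The direction with all coframe components equal to `1` avoids every hyperplane `θ_a = 0`. -/
theorem exists_not_isCritical_over (p : Point m k) :
    ∃ P : Point m (k + 1), proj P = p ∧ ¬ IsCritical P := by
  have hT := tower_charted m k
  obtain ⟨P, rfl, c, -, h⟩ := hT.exists_point_over (hT.mem_idx p)
    (θ := fun _ => 1) (fun h => one_ne_zero (congrFun h 0))
  refine ⟨P, rfl, fun hP => ?_⟩
  obtain ⟨a, -, ha⟩ := (isCritical_iff (hT.mem_idx (proj P))).1 hP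
  have h1 := congrFun h a
  exact one_ne_zero (h1.trans ((congrArg (c • ·) ha).trans (smul_zero c)))

/-- The kept index `i` is critical upstairs, so the projected curve is still immersed. Its direction
is the line of `P`, which is regular by hypothesis. -/
theorem mem_germAt_proj {P : Point m (k + 1)} {γ : ℂ → Fin (m + 1) → ℂ} (h : γ ∈ GermAt P)
    (hP : ¬ IsCritical P) : γ ∈ GermAt (proj P) := by
  have hw := (tower_charted m k).mem_idx (proj P)
  generalize (tower m k).idx (proj P) = w at hw
  obtain ⟨i, hi⟩ := exists_mem_src_of_proj hw
  obtain ⟨hγ, X, hX, hl, hX0, -, hc⟩ := (mem_germAt_iff hi).1 h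
  have hX1 := analyticAt_fst_comp hX
  have h0 : (Prod.fst (X 0) : Coord m k) = (tower m k).coord w (proj P) :=
    congrArg (fun Y : Coord m (k + 1) => (Prod.fst Y : Coord m k)) hX0
  have h1 := (IsLiftOf.eventually_eq hl.2 hX1 (analyticAt_snd_comp hX)).self_of_nhds
  have h2 : coframe m k w (deriv (fun t => (Prod.fst (X t) : Coord m k)) 0) i ≠ 0 := by
    have h3 := hc i (mem_crit_succ.2 (Or.inl rfl))
    rw [deriv_coord_succ hX] at h3
    have h4 := coframe_succ_self w i
      (deriv (fun t => (Prod.fst (X t) : Coord m k)) 0)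
      (deriv (fun t => (Prod.snd (X t) : Fin m → ℂ)) 0)
    exact fun h5 => h3 (h4.trans h5)
  refine (mem_germAt_iff hw).2 ⟨hγ, _, hX1, hl.1, h0, ?_, fun a ha h3 => ?_⟩
  · intro h3
    rw [h3] at h2
    exact h2 (congrFun (map_zero (coframeL m k w)) i)
  · rw [h1, Pi.smul_apply, smul_eq_mul, mul_eq_zero, or_iff_right h2] at h3
    have h4 : lastVec w i P a = 0 := by
      have h5 : (Prod.snd (X 0) : Fin m → ℂ) = Prod.snd ((tower m (k + 1)).coord (w, i) P) :=
        congrArg (fun Y : Coord m (k + 1) => (Prod.snd Y : Fin m → ℂ)) hX0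
      rwa [h5] at h3
    exact hP ((isCritical_iff hw).2 ⟨a, h0 ▸ ha, (dir_eq_zero_iff hi).2 h4⟩)

end Regular

/-! ## Points realized by germs of semigroup type -/

/-- The points realized by germs of the type `ords q`. -/
def realized (q : ℕ) : Set (Point 2 3) := {p | ∃ γ ∈ GermAt (m := 2) p, JType q γ}

/-- The points at the origin realized by the monomial curves. -/
def IsModel (q : ℕ) (p : Point 2 3) : Prop :=
  ∀ g : ℂ → Fin 3 → ℂ, AnalyticAt ℂ g 0 → g 0 = 0 → TForm q g 0 0 0 (fun _ => 1) →
    g ∈ GermAt (m := 2) p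

variable {e : Equiv.Perm (Fin 3)} {p : Point 2 3} {x U V W : Fin 3 → ℂ} {γ : ℂ → Fin 3 → ℂ}

theorem CoordsIn.jType_zero (h : CoordsIn e 0 1 1 p x U V W) (hV : V 0 = 0) (hW : W 0 = 0)
    (hW2 : W 2 ≠ 0) (hγ : γ ∈ GermAt (m := 2) p) : JType 0 γ := by
  obtain ⟨g, c, rfl, hg⟩ := h.exists_tForm_zero hV hW hW2 hγ
  exact hg.jType (analyticAt_permute_iff.1 hγ.1)

theorem CoordsIn.jType_one (h : CoordsIn e 0 1 2 p x U V W) (hV : V 0 = 0) (hW : W 0 = 0)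
    (hW1 : W 1 = 0) (hγ : γ ∈ GermAt (m := 2) p) : JType 1 γ := by
  obtain ⟨g, c, rfl, hg⟩ := h.exists_tForm_one hV hW hW1 hγ
  exact hg.jType (analyticAt_permute_iff.1 hγ.1)

theorem JType.exists_coordsIn_zero (h : JType 0 γ) : ∃ (e : Equiv.Perm (Fin 3)) (p : Point 2 3)
    (x U V W : Fin 3 → ℂ), CoordsIn e 0 1 1 p x U V W ∧ V 0 = 0 ∧ W 0 = 0 ∧ W 2 ≠ 0 ∧
      γ ∈ GermAt (m := 2) p := by
  obtain ⟨e, g, u₁, u₂, v₂, c, rfl, hg⟩ := h.exists_tForm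
  obtain ⟨p, hp⟩ := exists_coordsIn_point e 0 1 1 (g 0) (U := ![1, u₁, u₂]) (V := ![0, 1, v₂])
    (W := ![0, 1, leadV 0 c / leadU 0 c]) rfl rfl rfl
  exact ⟨e, p, _, _, _, _, hp, rfl, rfl, div_ne_zero (leadV_ne_zero hg.ne_zero)
    (leadU_ne_zero hg.ne_zero), hg.mem_germAt_zero (analyticAt_permute_iff.1 h.1) hp⟩

theorem JType.exists_coordsIn_one (h : JType 1 γ) : ∃ (e : Equiv.Perm (Fin 3)) (p : Point 2 3)
    (x U V W : Fin 3 → ℂ), CoordsIn e 0 1 2 p x U V W ∧ V 0 = 0 ∧ W 0 = 0 ∧ W 1 = 0 ∧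
      γ ∈ GermAt (m := 2) p := by
  obtain ⟨e, g, u₁, u₂, v₂, c, rfl, hg⟩ := h.exists_tForm
  obtain ⟨p, hp⟩ := exists_coordsIn_point e 0 1 2 (g 0) (U := ![1, u₁, u₂]) (V := ![0, 1, v₂])
    (W := ![0, 0, 1]) rfl rfl rfl
  exact ⟨e, p, _, _, _, _, hp, rfl, rfl, rfl,
    hg.mem_germAt_one (analyticAt_permute_iff.1 h.1) hp⟩

theorem germAt_unique {p p' : Point 2 3} (h : γ ∈ GermAt (m := 2) p)
    (h' : PassesThrough (m := 2) γ p') : p = p' :=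
  (germAt_subset h).unique h'

/-- A germ of type 0 also realizes a point with the stated coordinates, and a germ realizes only one
point; conversely the explicit germ over such coordinates has the type. -/
theorem mem_realized_zero_iff : p ∈ realized 0 ↔ ∃ (e : Equiv.Perm (Fin 3)) (x U V W : Fin 3 → ℂ),
    CoordsIn e 0 1 1 p x U V W ∧ V 0 = 0 ∧ W 0 = 0 ∧ W 2 ≠ 0 := by
  constructor
  · rintro ⟨γ, hγ, h⟩
    obtain ⟨e, p', x, U, V, W, h1, h2, h3, h4, h5⟩ := h.exists_coordsIn_zero
    rw [germAt_unique hγ (germAt_subset h5)]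
    exact ⟨e, x, U, V, W, h1, h2, h3, h4⟩
  · rintro ⟨e, x, U, V, W, h1, h2, h3, h4⟩
    obtain ⟨γ, hγ, -⟩ := exists_germ_of_first_second_second h1 h2 h3
    exact ⟨γ, hγ, h1.jType_zero h2 h3 h4 hγ⟩

theorem mem_realized_one_iff : p ∈ realized 1 ↔ ∃ (e : Equiv.Perm (Fin 3)) (x U V W : Fin 3 → ℂ),
    CoordsIn e 0 1 2 p x U V W ∧ V 0 = 0 ∧ W 0 = 0 ∧ W 1 = 0 := by
  constructor
  · rintro ⟨γ, hγ, h⟩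
    obtain ⟨e, p', x, U, V, W, h1, h2, h3, h4, h5⟩ := h.exists_coordsIn_one
    rw [germAt_unique hγ (germAt_subset h5)]
    exact ⟨e, x, U, V, W, h1, h2, h3, h4⟩
  · rintro ⟨e, x, U, V, W, h1, h2, h3, h4⟩
    obtain ⟨γ, hγ⟩ := exists_germ_of_first_second_third h1 h2 h3 h4
    exact ⟨γ, hγ, h1.jType_one h2 h3 h4 hγ⟩

theorem jType_of_mem_realized {q : ℕ} (hq : q < 2) (hp : p ∈ realized q)
    (hγ : γ ∈ GermAt (m := 2) p) : JType q γ := by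
  interval_cases q
  · obtain ⟨e, x, U, V, W, h1, h2, h3, h4⟩ := mem_realized_zero_iff.1 hp
    exact h1.jType_zero h2 h3 h4 hγ
  · obtain ⟨e, x, U, V, W, h1, h2, h3, h4⟩ := mem_realized_one_iff.1 hp
    exact h1.jType_one h2 h3 h4 hγ

theorem JType.exists_mem_realized {q : ℕ} (hq : q < 2) (h : JType q γ) :
    ∃ p ∈ realized q, γ ∈ GermAt (m := 2) p := by
  interval_cases q
  · obtain ⟨e, p, x, U, V, W, -, -, -, -, h5⟩ := h.exists_coordsIn_zero
    exact ⟨p, ⟨γ, h5, h⟩, h5⟩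
  · obtain ⟨e, p, x, U, V, W, -, -, -, -, h5⟩ := h.exists_coordsIn_one
    exact ⟨p, ⟨γ, h5, h⟩, h5⟩

theorem exists_isModel {q : ℕ} (hq : q < 2) : ∃ p, IsModel q p := by
  have h1 : ∀ g : ℂ → Fin 3 → ℂ, permute 1 g = g := fun g => rfl
  interval_cases q
  · obtain ⟨p, hp⟩ := exists_coordsIn_point 1 0 1 1 0 (U := ![1, 0, 0]) (V := ![0, 1, 0])
      (W := ![0, 1, leadV 0 (fun _ => 1) / leadU 0 (fun _ => 1)]) rfl rfl rfl
    refine ⟨p, fun g hg h0 h => ?_⟩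
    rw [← h1 g]
    exact h.mem_germAt_zero hg (h0.symm ▸ hp)
  · obtain ⟨p, hp⟩ := exists_coordsIn_point 1 0 1 2 0 (U := ![1, 0, 0]) (V := ![0, 1, 0])
      (W := ![0, 0, 1]) rfl rfl rfl
    refine ⟨p, fun g hg h0 h => ?_⟩
    rw [← h1 g]
    exact h.mem_germAt_one hg (h0.symm ▸ hp)

theorem tForm_of_ord {q : ℕ} {g : ℂ → Fin 3 → ℂ} (h0 : g 0 = 0)
    (h : ∀ i, Ord (ords q i) 1 (fun t => g t i)) : TForm q g 0 0 0 (fun _ => 1) := by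
  refine ⟨fun _ => one_ne_zero, ?_, ?_, ?_⟩
  · simpa [h0, ords] using h 0
  · simpa [h0, ords] using h 1
  · simpa [h0, ords] using h 2

/-- A germ `γ` of type `q` is the image, under an affine diffeomorphism, of `L (γ - γ 0)`, whose
leading coefficients are `1` and which therefore realizes the model point. Conversely, a
diffeomorphism carries the monomial curve to a germ of the same type. Uniqueness of the point under
a germ converts both facts into statements on points. -/
theorem isOrbit_realized {q : ℕ} (hq : q < 2) : IsOrbit (m := 2) (realized q) := by
  obtain ⟨p₀, hp₀⟩ := exists_isModel hq
  refine ⟨p₀, Set.ext fun p => ⟨?_, ?_⟩⟩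
  · rintro ⟨γ, hγ, hJ, L, hL⟩
    obtain ⟨φ, hφ, hsrc, hv⟩ := exists_affine_diffeo L.symm (γ 0)
    have h0 : L (γ 0 - γ 0) = 0 := by simp
    have ha : AnalyticAt ℂ (fun t => L (γ t - γ 0)) 0 :=
      ((L : (Fin 3 → ℂ) →L[ℂ] (Fin 3 → ℂ)).analyticAt _).fun_comp (hJ.fun_sub analyticAt_const)
    have h1 := hp₀ (fun t => L (γ t - γ 0)) ha h0 (tForm_of_ord h0 hL)
    have hs : ∀ v, v ∈ φ.source := fun v => by
      rw [hsrc]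
      trivial
    refine ⟨φ, hφ, hs _, ?_⟩
    have h2 := (germAt_subset h1).map hφ (hs _)
    have h3 : (fun t => φ (L (γ t - γ 0))) = γ := by
      funext t
      simp [hv]
    rw [h3] at h2
    exact (germAt_unique hγ h2).symm
  · rintro ⟨φ, hφ, hs, rfl⟩
    have hord : ∀ i, Ord (ords q i) 1 (fun t => monomialCurve q t i) := by
      intro i
      fin_cases i <;> exact ord_pow _
    have h1 := germAt_subset
      (hp₀ _ (analyticAt_monomialCurve 0) monomialCurve_zero (tForm_of_ord monomialCurve_zero hord))
    rw [h1.base_eq] at hs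
    obtain ⟨p, hp, hγ⟩ := (jType_monomialCurve.comp_left (hφ.1 _ hs)
      (hφ.fderiv_injective hs)).exists_mem_realized hq
    rwa [← germAt_unique hγ (h1.map hφ hs)]

theorem realized_zero_subset : realized 0 ⊆ RVT 2 := by
  intro p hp
  obtain ⟨e, x, U, V, W, h1, h2, h3, -⟩ := mem_realized_zero_iff.1 hp
  exact h1.mem_RVT_iff.2 ⟨h2, by rw [h1.normalized.2.2]; exact one_ne_zero, h3⟩

theorem realized_one : realized 1 = RVL 2 := by
  ext p
  constructor
  · intro hp
    obtain ⟨e, x, U, V, W, h1, h2, h3, h4⟩ := mem_realized_one_iff.1 hp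
    exact h1.mem_RVL_iff.2 ⟨h2, h4, h3⟩
  · intro hp
    obtain ⟨e, x, U, V, W, h | ⟨h, -⟩ | ⟨h, -⟩ | ⟨h, -⟩ | ⟨h, h1⟩⟩ := exists_coordsIn p
    · exact absurd (h.mem_RVL_iff.1 hp).1 (by rw [h.normalized.2.1]; exact one_ne_zero)
    · exact absurd (h.mem_RVL_iff.1 hp).1 (by rw [h.normalized.2.1]; exact one_ne_zero)
    · exact absurd (h.mem_RVL_iff.1 hp).2.1 (by rw [h.normalized.2.2]; exact one_ne_zero)
    · exact absurd (h.mem_RVL_iff.1 hp).2.2 (by rw [h.normalized.2.2]; exact one_ne_zero)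
    · exact mem_realized_one_iff.2 ⟨e, x, U, V, W, h, h1⟩

theorem disjoint_RVT_RVL : Disjoint (RVT 2) (RVL 2) := by
  rw [Set.disjoint_left]
  intro p hp hp'
  rw [← realized_one] at hp'
  obtain ⟨e, x, U, V, W, h1, -, -, h4⟩ := mem_realized_one_iff.1 hp'
  exact (h1.mem_RVT_iff.1 hp).2.1 h4

theorem exists_planar_germ (p : Point 2 3) :
    (∃ γ ∈ GermAt (m := 2) p, embDim (m := 2) γ ≤ 2) ∨ p ∈ realized 0 ∨ p ∈ realized 1 := by
  obtain ⟨e, x, U, V, W, h | ⟨h, h1⟩ | ⟨h, h1⟩ | ⟨h, h1, h2⟩ | ⟨h, h1⟩⟩ := exists_coordsIn p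
  · exact Or.inl (exists_planar_germ_of_first_first_first h)
  · exact Or.inl (exists_planar_germ_of_first_first_second h h1)
  · by_cases h2 : W 0 = 0
    · by_cases h3 : W 2 = 0
      · obtain ⟨γ, hγ, h4⟩ := exists_germ_of_first_second_second h h1 h2
        exact Or.inl ⟨γ, hγ, h4 h3⟩
      · exact Or.inr (Or.inl (mem_realized_zero_iff.2 ⟨e, x, U, V, W, h, h1, h2, h3⟩))
    · exact Or.inl (exists_planar_germ_of_first_second_second h h1 h2)
  · exact Or.inl (exists_planar_germ_of_first_second_first h h1 h2)
  · exact Or.inr (Or.inr (mem_realized_one_iff.2 ⟨e, x, U, V, W, h, h1⟩))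

theorem isSpatial_of_mem_realized {q : ℕ} (hq : q < 2) (hp : p ∈ realized q) :
    IsSpatial (m := 2) p := by
  refine ⟨fun γ hγ => (jType_of_mem_realized hq hp hγ).three_le_embDim, ?_⟩
  obtain ⟨γ, hγ, h⟩ := hp
  exact ⟨γ, hγ, le_antisymm embDim_le h.three_le_embDim⟩

theorem setOf_isSpatial : {p : Point 2 3 | IsSpatial p} = realized 0 ∪ RVL 2 := by
  rw [← realized_one]
  ext p
  constructor
  · intro hp
    refine (exists_planar_germ p).resolve_left ?_
    rintro ⟨γ, hγ, h⟩
    have := hp.1 γ hγ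
    omega
  · rintro (hp | hp)
    · exact isSpatial_of_mem_realized (by norm_num) hp
    · exact isSpatial_of_mem_realized (by norm_num) hp

theorem isCritical_of_mem_realized (hp : p ∈ realized 0 ∨ p ∈ realized 1) :
    IsCritical (m := 2) p := by
  rcases hp with hp | hp
  · obtain ⟨e, x, U, V, W, h, h1, h2, -⟩ := mem_realized_zero_iff.1 hp
    exact h.isCritical_iff.2 (Or.inr ⟨h1, h2⟩)
  · obtain ⟨e, x, U, V, W, h, h1, h2, h3⟩ := mem_realized_one_iff.1 hp
    exact h.isCritical_iff.2 (Or.inl h3)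

/-- Below level three every point is realized by a planar germ. -/
theorem not_isSpatial_of_lt_three : ∀ k < 3, ∀ p : Point 2 k, ¬ IsSpatial p := by
  have hproj : ∀ {k : ℕ} (p : Point 2 k), ∃ P : Point 2 (k + 1), ¬ IsCritical P ∧
      ∀ γ ∈ GermAt (m := 2) P, γ ∈ GermAt (m := 2) p := by
    intro k p
    obtain ⟨P, rfl, hP⟩ := exists_not_isCritical_over p
    exact ⟨P, hP, fun γ hγ => mem_germAt_proj hγ hP⟩
  -- A regular point over `p` lies in neither `realized 0` nor `realized 1`, whose points are
  -- critical; so it has a planar germ, and this germ also realizes `p`.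
  have h2 : ∀ p : Point 2 2, ∃ γ ∈ GermAt (m := 2) p, embDim (m := 2) γ ≤ 2 := by
    intro p
    obtain ⟨P, hP, h⟩ := hproj p
    obtain ⟨γ, hγ, hd⟩ := (exists_planar_germ P).resolve_right
      fun h => hP (isCritical_of_mem_realized h)
    exact ⟨γ, h γ hγ, hd⟩
  have hstep : ∀ {k : ℕ}, (∀ p : Point 2 (k + 1), ∃ γ ∈ GermAt (m := 2) p,
      embDim (m := 2) γ ≤ 2) → ∀ p : Point 2 k, ∃ γ ∈ GermAt (m := 2) p, embDim (m := 2) γ ≤ 2 := by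
    intro k h p
    obtain ⟨P, -, hP⟩ := hproj p
    obtain ⟨γ, hγ, hd⟩ := h P
    exact ⟨γ, hP γ hγ, hd⟩
  have key : ∀ k < 3, ∀ p : Point 2 k, ∃ γ ∈ GermAt (m := 2) p, embDim (m := 2) γ ≤ 2 := by
    intro k hk
    interval_cases k
    · exact hstep (hstep h2)
    · exact hstep h2
    · exact h2
  intro k hk p hp
  obtain ⟨γ, hγ, h⟩ := key k hk p
  have := hp.1 γ hγ
  omega

end

section

open Stage

/-! ## Submanifolds -/

variable {m k : ℕ}

theorem hasCodimAt_of_linear {E : Type*} [NormedAddCommGroup E] [NormedSpace ℂ E] {N : Set E}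
    {x : E} {c : ℕ} (A : E →L[ℂ] (Fin c → ℂ)) (hA : Function.Surjective A)
    (h : ∀ᶠ y in 𝓝 x, (y ∈ N ↔ A y = 0)) : HasCodimAt N x c :=
  ⟨A, A.analyticAt x, by rwa [A.fderiv], h⟩

theorem mem_coord_image_iff {w : ChartIndex m k} {N : Set (Point m k)} {y : Coord m k} :
    y ∈ (tower m k).coord w '' (N ∩ (tower m k).src w) ↔ (tower_charted m k).point w y ∈ N := by
  have hT := tower_charted m k
  constructor
  · rintro ⟨p, ⟨hp, hw⟩, rfl⟩
    rwa [hT.point_coord hw]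
  · exact fun h => ⟨_, ⟨h, hT.point_mem w y⟩, hT.coord_point w y⟩

theorem HasCodim.inter_isOpen {N U : Set (Point m k)} {c : ℕ} (h : HasCodim N c) (hU : IsOpen U) :
    HasCodim (U ∩ N) c := by
  intro p hp
  have hT := tower_charted m k
  obtain ⟨F, h1, h2, h3⟩ := h p hp.2
  refine ⟨F, h1, h2, ?_⟩
  have h4 := hT.tendsto_point ((tower m k).idx p) ((tower m k).coord ((tower m k).idx p) p)
  rw [hT.point_coord (hT.mem_idx p)] at h4
  filter_upwards [h3, h4.eventually (hU.mem_nhds hp.1)] with y h5 h6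
  rw [← h5, mem_coord_image_iff, mem_coord_image_iff]
  exact and_iff_right h6

/-- A new coordinate of level two, as a linear map on `Coord m 3`. -/
def secondCLM (a : Fin m) : Coord m 3 →L[ℂ] ℂ :=
  (ContinuousLinearMap.proj (R := ℂ) (φ := fun _ : Fin m => ℂ) a).comp
    ((ContinuousLinearMap.snd ℂ (Coord m 1) (Fin m → ℂ)).comp
      (ContinuousLinearMap.fst ℂ (Coord m 2) (Fin m → ℂ)))

/-- A new coordinate of level three, as a linear map on `Coord m 3`. -/
def thirdCLM (a : Fin m) : Coord m 3 →L[ℂ] ℂ :=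
  (ContinuousLinearMap.proj (R := ℂ) (φ := fun _ : Fin m => ℂ) a).comp
    (ContinuousLinearMap.snd ℂ (Coord m 2) (Fin m → ℂ))

theorem unitAt_of_ne {i a : Fin (m + 1)} (h : a ≠ i) :
    ∃ b : Fin m, i.succAbove b = a ∧ ∀ u, unitAt i u a = u b := by
  obtain ⟨b, rfl⟩ := Fin.exists_succAbove_eq h
  exact ⟨b, rfl, fun u => unitAt_succAbove i u b⟩

theorem mem_RVT_point_iff {i j l : Fin (m + 1)} (y : Coord m 3) :
    (tower_charted m 3).point (word3 i j l) y ∈ RVT m ↔ unitAt j y.1.2 i = 0 ∧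
      unitAt l y.2 j ≠ 0 ∧ unitAt l y.2 i = 0 := by
  have hT := tower_charted m 3
  have h := mem_RVT_iff (hT.point_mem (word3 i j l) y)
  have h1 := hT.coord_point (word3 i j l) y
  have h2 : lastVec (word1 i) j (proj (hT.point (word3 i j l) y)) = unitAt j y.1.2 :=
    congrArg (fun X : Coord m 3 => unitAt j X.1.2) h1
  have h3 : lastVec (word2 i j) l (hT.point (word3 i j l) y) = unitAt l y.2 :=
    congrArg (fun X : Coord m 3 => unitAt l X.2) h1
  rwa [h2, h3] at h

theorem mem_RVL_point_iff {i j l : Fin (m + 1)} (y : Coord m 3) :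
    (tower_charted m 3).point (word3 i j l) y ∈ RVL m ↔ unitAt j y.1.2 i = 0 ∧
      unitAt l y.2 j = 0 ∧ unitAt l y.2 i = 0 := by
  have hT := tower_charted m 3
  have h := mem_RVL_iff (hT.point_mem (word3 i j l) y)
  have h1 := hT.coord_point (word3 i j l) y
  have h2 : lastVec (word1 i) j (proj (hT.point (word3 i j l) y)) = unitAt j y.1.2 :=
    congrArg (fun X : Coord m 3 => unitAt j X.1.2) h1
  have h3 : lastVec (word2 i j) l (hT.point (word3 i j l) y) = unitAt l y.2 :=
    congrArg (fun X : Coord m 3 => unitAt l X.2) h1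
  rwa [h2, h3] at h

/-- In the preferred chart the normalizations at `j` and `l` force `i ≠ j` and `i ≠ l`. The two
vanishing components are therefore genuine coordinates of levels two and three, and the third
condition is open. -/
theorem hasCodim_RVT : HasCodim (RVT m) 2 := by
  intro p hp
  have hT := tower_charted m 3
  have hw := hT.mem_idx p
  generalize (tower m 3).idx p = w at hw
  obtain ⟨⟨⟨⟨⟩, i⟩, j⟩, l⟩ := w
  change HasCodimAt ((tower m 3).coord (word3 i j l) '' (RVT m ∩ (tower m 3).src (word3 i j l)))
    ((tower m 3).coord (word3 i j l) p) 2
  obtain ⟨x, hx⟩ : ∃ x, x = (tower m 3).coord (word3 i j l) p := ⟨_, rfl⟩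
  have h1 : x ∈ (tower m 3).coord (word3 i j l) '' (RVT m ∩ (tower m 3).src (word3 i j l)) :=
    ⟨p, ⟨hp, hw⟩, hx.symm⟩
  rw [← hx]
  obtain ⟨h2, h3, h4⟩ := (mem_RVT_point_iff x).1 (mem_coord_image_iff.1 h1)
  have hij : i ≠ j := by
    rintro rfl
    rw [unitAt_self] at h2
    exact one_ne_zero h2
  have hil : i ≠ l := by
    rintro rfl
    rw [unitAt_self] at h4
    exact one_ne_zero h4
  obtain ⟨a, -, ha⟩ := unitAt_of_ne hij
  obtain ⟨b, -, hb⟩ := unitAt_of_ne hil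
  refine hasCodimAt_of_linear (ContinuousLinearMap.pi ![secondCLM a, thirdCLM b]) ?_ ?_
  · intro z
    refine ⟨((0, fun _ => z 0), fun _ => z 1), ?_⟩
    funext s
    fin_cases s <;> rfl
  · have h5 : ∀ᶠ y : Coord m 3 in 𝓝 x, unitAt l y.2 j ≠ 0 := by
      have h6 : AnalyticAt ℂ (fun y : Coord m 3 => unitAt l y.2) x :=
        (analyticAt_unitAt l _).fun_comp (analyticAt_snd (k := 2) x)
      exact (analyticAt_pi_iff.1 h6 j).continuousAt.eventually_ne h3
    filter_upwards [h5] with y hy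
    rw [mem_coord_image_iff, mem_RVT_point_iff, ha, hb, and_iff_right hy, funext_iff,
      Fin.forall_fin_two]
    rfl

/-- Here `i`, `j`, `l` are pairwise distinct, so one coordinate of level two and two different
coordinates of level three vanish, with no further condition. -/
theorem hasCodim_RVL : HasCodim (RVL m) 3 := by
  intro p hp
  have hT := tower_charted m 3
  have hw := hT.mem_idx p
  generalize (tower m 3).idx p = w at hw
  obtain ⟨⟨⟨⟨⟩, i⟩, j⟩, l⟩ := w
  change HasCodimAt ((tower m 3).coord (word3 i j l) '' (RVL m ∩ (tower m 3).src (word3 i j l)))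
    ((tower m 3).coord (word3 i j l) p) 3
  obtain ⟨x, hx⟩ : ∃ x, x = (tower m 3).coord (word3 i j l) p := ⟨_, rfl⟩
  have h1 : x ∈ (tower m 3).coord (word3 i j l) '' (RVL m ∩ (tower m 3).src (word3 i j l)) :=
    ⟨p, ⟨hp, hw⟩, hx.symm⟩
  rw [← hx]
  obtain ⟨h2, h3, h4⟩ := (mem_RVL_point_iff x).1 (mem_coord_image_iff.1 h1)
  have hij : i ≠ j := by
    rintro rfl
    rw [unitAt_self] at h2
    exact one_ne_zero h2
  have hil : i ≠ l := by
    rintro rfl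
    rw [unitAt_self] at h4
    exact one_ne_zero h4
  have hjl : j ≠ l := by
    rintro rfl
    rw [unitAt_self] at h3
    exact one_ne_zero h3
  obtain ⟨a, -, ha⟩ := unitAt_of_ne hij
  obtain ⟨b, hbi, hb⟩ := unitAt_of_ne hil
  obtain ⟨c, hcj, hc⟩ := unitAt_of_ne hjl
  have hbc : b ≠ c := by
    rintro rfl
    exact hij (hbi.symm.trans hcj)
  refine hasCodimAt_of_linear (ContinuousLinearMap.pi ![secondCLM a, thirdCLM c, thirdCLM b]) ?_
    (Eventually.of_forall fun y => ?_)
  · intro z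
    refine ⟨((0, fun _ => z 0), fun s => if s = c then z 1 else z 2), ?_⟩
    funext s
    fin_cases s
    · rfl
    · exact if_pos rfl
    · exact if_neg hbc
  · rw [mem_coord_image_iff, mem_RVL_point_iff, ha, hb, hc, funext_iff]
    simp only [Fin.forall_fin_succ, IsEmpty.forall_iff, and_true]
    rfl

/-- Inside RVT the set is the nonvanishing of one coordinate in each chart `e 0, e 1, e 1`. The
union over all permutations `e` is open and independent of a choice of chart. -/
theorem exists_isOpen_realized_zero :
    ∃ U : Set (Point 2 3), IsOpen U ∧ realized 0 = U ∩ RVT 2 := by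
  refine ⟨⋃ e : Equiv.Perm (Fin 3), (tower 2 3).src (word3 (e 0) (e 1) (e 1)) ∩
    (tower 2 3).coord (word3 (e 0) (e 1) (e 1)) ⁻¹' {y | unitAt (m := 2) (e 1) y.2 (e 2) ≠ 0},
    isOpen_iUnion fun e => Charted.isOpen_src_inter _ ?_, ?_⟩
  · refine isOpen_iff_mem_nhds.2 fun y hy => ?_
    have h6 : AnalyticAt ℂ (fun y : Coord 2 3 => unitAt (m := 2) (e 1) y.2) y :=
      (analyticAt_unitAt (e 1) _).fun_comp (analyticAt_snd (k := 2) y)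
    exact (analyticAt_pi_iff.1 h6 (e 2)).continuousAt.eventually_ne hy
  · ext p
    rw [Set.mem_inter_iff, Set.mem_iUnion]
    constructor
    · intro hp
      refine ⟨?_, realized_zero_subset hp⟩
      obtain ⟨e, x, U, V, W, h, h1, h2, h3⟩ := mem_realized_zero_iff.1 hp
      refine ⟨e, h.mem, ?_⟩
      have h4 := congrFun h.three (e 2)
      simp only [Function.comp_apply, Equiv.symm_apply_apply] at h4
      exact fun h5 => h3 (h4.symm.trans h5)
    · rintro ⟨⟨e, h1, h2⟩, h3⟩
      have h4 := coordsIn_self (e := e) (i := 0) (j := 1) (l := 1) h1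
      obtain ⟨h5, -, h6⟩ := h4.mem_RVT_iff.1 h3
      exact mem_realized_zero_iff.2 ⟨e, _, _, _, _, h4, h5, h6, h2⟩

/-! ## Germs realizing the spatial points -/

theorem exists_realized_iff_jetEquiv {q : ℕ} (hq : q < 2) {γ : ℂ → Fin 3 → ℂ}
    (hγ : AnalyticAt ℂ γ 0) : (∃ p ∈ realized q, γ ∈ GermAt (m := 2) p) ↔
      JetEquiv (m := 2) (2 * q + 5) γ (monomialCurve q) := by
  constructor
  · rintro ⟨p, hp, h⟩
    have hJ := jType_of_mem_realized hq hp h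
    interval_cases q
    · exact hJ.jetEquiv_zero
    · exact hJ.jetEquiv_one
  · exact fun h => (h.jType hγ).exists_mem_realized hq

end

end MonsterTower

end

theorem mainTheorem4 :
    (∀ k < 3, ∀ p : Point 2 k, ¬ IsSpatial p) ∧
    ∃ O : Set (Point 2 3),
      {p : Point 2 3 | IsSpatial p} = O ∪ RVL 2 ∧ Disjoint O (RVL 2) ∧
      IsOrbit O ∧ IsOrbit (RVL 2) ∧
      O ⊆ RVT 2 ∧ (∃ U : Set (Point 2 3), IsOpen U ∧ O = U ∩ RVT 2) ∧
      HasCodim (RVT 2) 2 ∧ HasCodim O 2 ∧ HasCodim (RVL 2) 3 ∧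
      (∀ γ : ℂ → (Fin 3 → ℂ), AnalyticAt ℂ γ 0 →
        SameJet 5 γ (fun t => ![t ^ 3, t ^ 4, t ^ 5]) → ∃ p ∈ O, γ ∈ GermAt p) ∧
      (∀ γ : ℂ → (Fin 3 → ℂ), AnalyticAt ℂ γ 0 →
        ((∃ p ∈ O, γ ∈ GermAt p) ↔ JetEquiv 5 γ (fun t => ![t ^ 3, t ^ 4, t ^ 5]))) ∧
      (∀ γ : ℂ → (Fin 3 → ℂ), AnalyticAt ℂ γ 0 →
        ((∃ p ∈ RVL 2, γ ∈ GermAt p) ↔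
          JetEquiv 7 γ (fun t => ![t ^ 4, t ^ 6, t ^ 7]))) := by
  obtain ⟨U, hU, hUO⟩ := exists_isOpen_realized_zero
  refine ⟨not_isSpatial_of_lt_three, realized 0, setOf_isSpatial,
    disjoint_RVT_RVL.mono_left realized_zero_subset, isOrbit_realized (by norm_num),
    realized_one ▸ isOrbit_realized (by norm_num), realized_zero_subset, ⟨U, hU, hUO⟩,
    hasCodim_RVT, hUO ▸ hasCodim_RVT.inter_isOpen hU, hasCodim_RVL, fun γ hγ h => ?_,
    fun γ hγ => exists_realized_iff_jetEquiv (q := 0) (by norm_num) hγ, fun γ hγ => ?_⟩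
  · exact (jType_monomialCurve.of_sub hγ ((rem_iff_sameJet (m := 2) hγ
      (analyticAt_monomialCurve (q := 0) 0)).2 h)).exists_mem_realized (by norm_num)
  · rw [← realized_one]
    exact exists_realized_iff_jetEquiv (q := 1) (by norm_num) hγ
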